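/- **Setting.** Let $\mathsf N\ge 0$ be an integer (for $\mathsf N=0$, $\mathcal H=\mathbb C$ and products and sums over sites are empty), $2s_1,\dots,2s_{\mathsf N}$ positive integers, $\eta\in\mathbb C\setminus\{0\}$, $\xi_1,\dots,\xi_{\mathsf N}\in\mathbb C$, $\mathcal H=\bigotimes_{n=1}^{\mathsf N}\mathbb C^{2s_n+1}$, and let $K$ be a complex $2\times2$ matrix with eigenvalues $\mathsf k_1\ne\mathsf k_2$, both nonzero (so $K$ is diagonalizable, simple and invertible). With the spin-$s_n$ matrices $S_n^z=\mathrm{diag}(s_n,s_n-1,\dots,-s_n)$, $S_n^+=(S_n^-)^t$, where $S_n^+$ has superdiagonal entries $\sqrt{j(2s_n+1-j)}$, $j=1,\dots,2s_n$, and zeros elsewhere, put $$\mathsf L_{0n}(\lambda)=\begin{pmatrix}\lambda+\eta(\tfrac12+S_n^z)&\eta S_n^-\\ \eta S_n^+&\lambda+\eta(\tfrac12-S_n^z)\end{pmatrix},\qquad \mathsf M_0(\lambda)=K_0\,\mathsf L_{0\mathsf N}(\lambda-\xi_{\mathsf N})\cdots\mathsf L_{01}(\lambda-\xi_1),$$ $\mathsf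 T^{(K)}(\lambda)=\mathrm{tr}_0\,\mathsf M_0(\lambda)\in\mathrm{End}(\mathcal H)$, and, with $P^+_{1\dots m}$ the symmetric projector on $(\mathbb C^2)^{\otimes m}$ and $V^+_{1\dots m}$ its range, $$\mathsf T^{(K|m)}(\lambda)=\mathrm{tr}_{V^+_{1\dots m}}\,P^+_{1\dots m}\mathsf M_1(\lambda+(m-1)\eta)\cdots\mathsf M_m(\lambda)P^+_{1\dots m}.$$ Put $\xi_n^{(k)}=\xi_n-\tfrac{\eta}{2}+(s_n-k)\eta$, $a(\lambda)=\prod_n(\lambda-\xi_n+\tfrac\eta2+s_n\eta)$, $d(\lambda)=\prod_n(\lambda-\xi_n+\tfrac\eta2-s_n\eta)$, and $g_a(\lambda)=\prod_{b\ne a}\frac{\lambda-\xi_b^{(0)}}{\xi_a^{(0)}-\xi_b^{(0)}}$. For a function $t$ let $D_{t,n}$ be the tridiagonal $(2s_n+1)\times(2s_n+1)$ matrix with rows indexed by $i=0,\dots,2s_n$, whose row $i$ has diagonal entry $t(\xi_n^{(i)})$, superdiagonal entry $-\mathsf k_1a(\xi_n^{(i)})$ (if $i<2s_n$) and subdiagonal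 entry $-\mathsf k_2d(\xi_n^{(i)})$ (if $i>0$); $D_{t,n}^{(2s_n+1,2s_n+1)}$ is $D_{t,n}$ with its last row and last column removed. For a covector $\langle S|$ of $\mathcal H$ and $h_n\in\{0,\dots,2s_n\}$ put $$\langle h_1,\dots,h_{\mathsf N}|=\langle S|\prod_{n=1}^{\mathsf N}\bigl(\mathsf T^{(K|2s_n)}(\xi_n^{(2s_n-1)})\bigr)^{h_n}.$$ Call the inhomogeneities *generic* if $\xi_n^{(h)}\ne\xi_m^{(k)}$ for all $n\ne m$, $0\le h\le 2s_n$, $0\le k\le2s_m$. The *spectrum* of $\mathsf T^{(K)}$ is the set of functions $t$ on $\mathbb C$ for which some nonzero $v\in\mathcal H$ satisfies $\mathsf T^{(K)}(\lambda)v=t(\lambda)v$ for all $\lambda$; such a $v$ is an eigenvector for $t$. **Theorem 4.3.** 1. (The basis exists almost everywhere.) If $\mathsf k_1^j\neq\mathsf k_2^j$ for all $1\le j\le 2s_n$ and all $n$ (i.e. the fused twist matrices have simple spectrum), there is a nonzero polynomial $P$ in $\xi_1,\dots,\xi_{\mathsf N}$ and the coordinates of $\langle S|$ such that, whenever $P\ne0$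 at $(\xi,\langle S|)$, the inhomogeneities are generic and the covectors $\langle h_1,\dots,h_{\mathsf N}|$ form a basis of the space of covectors of $\mathcal H$. 2. Let the inhomogeneities be generic. Then the spectrum of $\mathsf T^{(K)}$ is exactly the set of polynomials $$t(\lambda)=\mathrm{tr}K\prod_{a=1}^{\mathsf N}(\lambda-\xi_a^{(0)})+\sum_{a=1}^{\mathsf N}g_a(\lambda)x_a,$$ where $(x_1,\dots,x_{\mathsf N})$ runs over all solutions in $\mathbb C^{\mathsf N}$ of the $\mathsf N$ equations $\det D_{t,n}=0$, $n=1,\dots,\mathsf N$, whose $n$-th left-hand side is a polynomial of degree $2s_n+1$ in $x_1,\dots,x_{\mathsf N}$. For each $t$ in the spectrum the eigenvector is unique up to a scalar factor. If moreover the covectors $\langle h_1,\dots,h_{\mathsf N}|$ built on $\langle S|$ form a basis, then for each $t$ in the spectrum there is a unique eigenvector $|t\rangle$ with $\langle S|t\rangle=1$, and it is also the unique vector of $\mathcal H$ with $$\langle h_1,\dots,h_{\mathsf N}|t\rangle=\prod_{n=1}^{\mathsf N}\Bigl(\det D_{t,n}^{(2s_n+1,2s_n+1)}\Bigr)^{h_n}\qquad\text{for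 all }h_n\in\{0,\dots,2s_n\}.$$ -/

import Mathlib

open Polynomial

noncomputable section

namespace SpinChain

/-- Action of a one-leg matrix `A` on the leg `n` of a tensor product `⨂ i, R ^ (d i)`, as a
matrix in the product basis: identity on all the other legs. -/
def leg {ι : Type*} [Fintype ι] [DecidableEq ι] {d : ι → Type*} [∀ i, DecidableEq (d i)]
    {R : Type*} [Zero R] (n : ι) (A : Matrix (d n) (d n) R) :
    Matrix (∀ i, d i) (∀ i, d i) R :=
  Matrix.of fun i j => if ∀ m, m ≠ n → i m = j m then A (i n) (j n) else 0

/-! ### Spin representations of `sl₂`.  The integer `l` is twice the spin. -/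

/-- `S^z = diag (s, s - 1, …, -s)` with `s = l / 2`. -/
def spinZ (l : ℕ) : Matrix (Fin (l + 1)) (Fin (l + 1)) ℂ :=
  Matrix.diagonal fun i => (l : ℂ) / 2 - (i : ℕ)

/-- `S^+`: superdiagonal entries `x(1), …, x(2s)`, `x(j) = √(j (2s + 1 - j))`
(the row with zero-based index `i` carries `x(i + 1)`). -/
def spinPlus (l : ℕ) : Matrix (Fin (l + 1)) (Fin (l + 1)) ℂ :=
  Matrix.of fun i j =>
    if (j : ℕ) = i + 1 then ((Real.sqrt (((i : ℕ) + 1 : ℝ) * ((l : ℝ) - (i : ℕ))) : ℝ) : ℂ) else 0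

/-- `S^-` is the transpose of `S^+`. -/
def spinMinus (l : ℕ) : Matrix (Fin (l + 1)) (Fin (l + 1)) ℂ := (spinPlus l).transpose

variable {N : ℕ}

/-- Labels of the product basis of `H = ⨂ n, ℂ ^ (l n + 1)`; also the labels
`h = (h₁, …, h_N)`, `0 ≤ h_n ≤ 2 s_n`, of the covectors of the SoV basis. -/
abbrev Conf (l : Fin N → ℕ) : Type := ∀ n : Fin N, Fin (l n + 1)

/-- Operators on the quantum space `H`, as matrices in the product basis. -/
abbrev Op (l : Fin N → ℕ) : Type := Matrix (Conf l) (Conf l) ℂ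

/-- The Lax operator `L_{0n}(u)`, a `2 × 2` matrix with entries acting on the site `n` of `H`. -/
def lax (l : Fin N → ℕ) (η : ℂ) (n : Fin N) (u : ℂ) : Matrix (Fin 2) (Fin 2) (Op l) :=
  let Z := spinZ (l n)
  !![leg n (u • 1 + η • ((1 / 2 : ℂ) • 1 + Z)), leg n (η • spinMinus (l n));
     leg n (η • spinPlus (l n)), leg n (u • 1 + η • ((1 / 2 : ℂ) • 1 - Z))]

/-- The monodromy matrix `K₀ L_{0N}(u - ξ_N) ⋯ L_{01}(u - ξ₁)`. -/
def monodromy (l : Fin N → ℕ) (ξ : Fin N → ℂ) (η : ℂ) (K : Matrix (Fin 2) (Fin 2) ℂ) (u : ℂ) :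
    Matrix (Fin 2) (Fin 2) (Op l) :=
  K.map (fun c => c • (1 : Op l)) *
    ((List.finRange N).reverse.map fun n => lax l η n (u - ξ n)).prod

/-- The transfer matrix `T^{(K)}(u) = tr₀ M₀(u)`. -/
def transfer (l : Fin N → ℕ) (ξ : Fin N → ℂ) (η : ℂ) (K : Matrix (Fin 2) (Fin 2) ℂ) (u : ℂ) :
    Op l :=
  (monodromy l ξ η K u).trace

/-- The permutation operator `v₁ ⊗ ⋯ ⊗ v_m ↦ v_{π 1} ⊗ ⋯ ⊗ v_{π m}` on `(ℂ²)^{⊗ m}`, with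
coefficients in the ring `R`. -/
def permOp (R : Type*) [Zero R] [One R] {m : ℕ} (π : Equiv.Perm (Fin m)) :
    Matrix (Fin m → Fin 2) (Fin m → Fin 2) R :=
  Matrix.of fun i j => if i = j ∘ π then 1 else 0

/-- The symmetric projector `P⁺_{1…m} = (1 / m!) ∑_π P_π`, acting on `(ℂ²)^{⊗ m}` and trivially
on the quantum space. -/
def symProj (l : Fin N → ℕ) (m : ℕ) : Matrix (Fin m → Fin 2) (Fin m → Fin 2) (Op l) :=
  ((m.factorial : ℂ)⁻¹) • ∑ π : Equiv.Perm (Fin m), permOp (Op l) π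

/-- The fused monodromy matrix `P⁺ M₁(u + (m-1)η) ⋯ M_m(u) P⁺` (the auxiliary leg with zero-based
index `k` carries `M(u + (m - 1 - k) η)`). -/
def fusedMonodromy (l : Fin N → ℕ) (ξ : Fin N → ℂ) (η : ℂ) (K : Matrix (Fin 2) (Fin 2) ℂ)
    (m : ℕ) (u : ℂ) : Matrix (Fin m → Fin 2) (Fin m → Fin 2) (Op l) :=
  symProj l m *
    ((List.finRange m).map fun k =>
      leg (d := fun _ : Fin m => Fin 2) k
        (monodromy l ξ η K (u + ((m : ℂ) - 1 - (k : ℕ)) * η))).prod *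
    symProj l m

/-- The fused transfer matrix `T^{(K|m)}(u)`.  The trace over the range `V⁺` of `P⁺` is the trace
over the whole `(ℂ²)^{⊗ m}`, because the fused monodromy matrix is of the form `P⁺ X P⁺`. -/
def fusedTransfer (l : Fin N → ℕ) (ξ : Fin N → ℂ) (η : ℂ) (K : Matrix (Fin 2) (Fin 2) ℂ)
    (m : ℕ) (u : ℂ) : Op l :=
  (fusedMonodromy l ξ η K m u).trace

/-- `ξ_n^{(k)} = ξ_n - η / 2 + (s_n - k) η`. -/
def node (l : Fin N → ℕ) (ξ : Fin N → ℂ) (η : ℂ) (n : Fin N) (k : ℕ) : ℂ :=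
  ξ n - η / 2 + ((l n : ℂ) / 2 - k) * η

/-- `a(u) = ∏_n (u - ξ_n + η / 2 + s_n η)`. -/
def aFun (l : Fin N → ℕ) (ξ : Fin N → ℂ) (η : ℂ) (u : ℂ) : ℂ :=
  ∏ n, (u - (ξ n - η / 2) + (l n : ℂ) / 2 * η)

/-- `d(u) = ∏_n (u - ξ_n + η / 2 - s_n η)`. -/
def dFun (l : Fin N → ℕ) (ξ : Fin N → ℂ) (η : ℂ) (u : ℂ) : ℂ :=
  ∏ n, (u - (ξ n - η / 2) - (l n : ℂ) / 2 * η)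

/-- Inhomogeneities in generic position: the strings `ξ_n^{(0)}, …, ξ_n^{(2 s_n)}` of different
sites are disjoint. -/
def StringsDisjoint (l : Fin N → ℕ) (ξ : Fin N → ℂ) (η : ℂ) : Prop :=
  ∀ n m : Fin N, n ≠ m → ∀ h ≤ l n, ∀ k ≤ l m, node l ξ η n h ≠ node l ξ η m k

/-- The covector `⟨h₁, …, h_N| = ⟨S| ∏_n T^{(K|2 s_n)}(ξ_n^{(2 s_n - 1)}) ^ {h_n}`. -/
def sovCovector (l : Fin N → ℕ) (ξ : Fin N → ℂ) (η : ℂ) (K : Matrix (Fin 2) (Fin 2) ℂ)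
    (S : Conf l → ℂ) (h : Conf l) : Conf l → ℂ :=
  Matrix.vecMul S
    ((List.finRange N).map fun n =>
      fusedTransfer l ξ η K (l n) (node l ξ η n (l n - 1)) ^ (h n : ℕ)).prod

/-- The covectors `⟨h₁, …, h_N|` form a basis of the space of covectors of `H`. -/
def IsSoVBasis (l : Fin N → ℕ) (ξ : Fin N → ℂ) (η : ℂ) (K : Matrix (Fin 2) (Fin 2) ℂ)
    (S : Conf l → ℂ) : Prop :=
  LinearIndependent ℂ (sovCovector l ξ η K S) ∧
    Submodule.span ℂ (Set.range (sovCovector l ξ η K S)) = ⊤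

/-- `v` satisfies `T^{(K)}(u) v = t(u) v` for all `u` (`v = 0` allowed). -/
def IsEigen (l : Fin N → ℕ) (ξ : Fin N → ℂ) (η : ℂ) (K : Matrix (Fin 2) (Fin 2) ℂ)
    (t : ℂ → ℂ) (v : Conf l → ℂ) : Prop :=
  ∀ u : ℂ, Matrix.mulVec (transfer l ξ η K u) v = t u • v

/-- The spectrum of the family `T^{(K)}(u)`: the functions `u ↦ t(u)` for which there is a common
eigenvector. -/
def transferSpectrum (l : Fin N → ℕ) (ξ : Fin N → ℂ) (η : ℂ) (K : Matrix (Fin 2) (Fin 2) ℂ) :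
    Set (ℂ → ℂ) :=
  {t | ∃ v : Conf l → ℂ, v ≠ 0 ∧ IsEigen l ξ η K t v}

/-- `g_a(u) = ∏_{b ≠ a} (u - ξ_b^{(0)}) / (ξ_a^{(0)} - ξ_b^{(0)})`. -/
def gFun (l : Fin N → ℕ) (ξ : Fin N → ℂ) (η : ℂ) (a : Fin N) (u : ℂ) : ℂ :=
  ∏ b ∈ Finset.univ.erase a,
    (u - node l ξ η b 0) / (node l ξ η a 0 - node l ξ η b 0)

/-- `t(u) = tr K ∏_a (u - ξ_a^{(0)}) + ∑_a g_a(u) x_a`. -/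
def tFun (l : Fin N → ℕ) (ξ : Fin N → ℂ) (η : ℂ) (K : Matrix (Fin 2) (Fin 2) ℂ)
    (x : Fin N → ℂ) (u : ℂ) : ℂ :=
  K.trace * ∏ a, (u - node l ξ η a 0) + ∑ a, gFun l ξ η a u * x a

/-- The tridiagonal matrix `D_{t,n}` of size `2 s_n + 1`; the row with zero-based index `i` is
evaluated at `ξ_n^{(i)}`. -/
def dMat (l : Fin N → ℕ) (ξ : Fin N → ℂ) (η k₁ k₂ : ℂ) (t : ℂ → ℂ) (n : Fin N) :
    Matrix (Fin (l n + 1)) (Fin (l n + 1)) ℂ :=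
  Matrix.of fun i j =>
    if j = i then t (node l ξ η n i)
    else if (j : ℕ) = i + 1 then -k₁ * aFun l ξ η (node l ξ η n i)
    else if (i : ℕ) = j + 1 then -k₂ * dFun l ξ η (node l ξ η n i)
    else 0

/-- The minor `D_{t,n}^{(2 s_n + 1, 2 s_n + 1)}`: last row and last column removed. -/
def dMinor (l : Fin N → ℕ) (ξ : Fin N → ℂ) (η k₁ k₂ : ℂ) (t : ℂ → ℂ) (n : Fin N) :
    Matrix (Fin (l n)) (Fin (l n)) ℂ :=
  (dMat l ξ η k₁ k₂ t n).submatrix Fin.castSucc Fin.castSucc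

/-- The set of solutions `x` of the `N` equations `det D_{t,n} = 0`, with `t` built from `x`. -/
def solutions (l : Fin N → ℕ) (ξ : Fin N → ℂ) (η : ℂ) (K : Matrix (Fin 2) (Fin 2) ℂ)
    (k₁ k₂ : ℂ) : Set (Fin N → ℂ) :=
  {x | ∀ n, (dMat l ξ η k₁ k₂ (tFun l ξ η K x) n).det = 0}

end SpinChain

end

/-! The spectrum is read off in an auxiliary basis of covectors, different from the covectors
`sovCovector`. Let A, B, C, D be the entries of a monodromy matrix that obeys the Yangian relation
`RTT` and has scalar quantum determinant (`HasQDet`). Since `K` is not scalar, some vector e = (-z,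
1) is not an eigenvector of `K`. This yields scalar matrices with K = G P and G of second column e,
for which P L G has the same trace as K L. In this gauge a product of coherent covectors is a left
eigencovector of B and is killed by D at every ξ_n^{(0)}. Applying A along each string ξ_n^{(0)},
ξ_n^{(1)}, … gives Sklyanin's covectors `W h`: they are eigencovectors of B with distinct
eigenvalues, A raises h_n, and D lowers it with the quantum determinant as coefficient
(`exists_isSeparated`, `exists_isSeparated_twist`). Only generic inhomogeneities are needed, with no
condition on powers of the eigenvalues of `K`.

Paired with an eigenvector, the one-step action on `W h` becomes a three-term recursion at each
site. Its solution is the continuant `cont`, and the vanishing of `W h` past the end of a string is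
the equation det D_{t,n} = 0. Conversely, a solution prescribes all pairings of a vector with the
basis. The eigenvalue equation then holds at N distinct points, and hence everywhere, because both
sides are polynomials of degree at most N with the same coefficient of degree N
(`IsSeparated.exists_eigen`). Uniqueness holds because every pairing is a multiple of the one with
`W 0`.

By fusion, T^{(K|m)} at ξ_n^{(m-1)} is the same continuant in the operators T(ξ_n^{(k)})
(`fusedTransfer_eq_cont`). On an eigenvector it therefore acts by a tridiagonal determinant, which
for m = 2s_n is the minor. This gives the factorized wave function on any basis of covectors
`sovCovector`.

For the existence of that basis, the determinant of the covectors is a polynomial in the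
inhomogeneities and ⟨S|, so one nonzero value suffices. With ξ_b = b/ε and ε → 0, the rescaled fused
operators decouple into one-site operators. Their eigenvalues, found with the generating function of
Krawtchouk polynomials, are proportional to (k₂/k₁)^j for 0 ≤ j ≤ 2s_n. The power condition makes
them distinct, and interpolation on a grid shows that the limiting determinant is nonzero
(`exists_linearIndependent_sovCovector`). -/

noncomputable section

namespace SpinChain

/-! ### One-leg operators -/

section Leg

variable {ι : Type*} [Fintype ι] [DecidableEq ι] {d : ι → Type*} [∀ i, DecidableEq (d i)]

theorem sum_ite_agree_off [∀ i, Fintype (d i)] {M : Type*} [AddCommMonoid M] (n : ι)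
    (i : ∀ m, d m) (f : (∀ m, d m) → M) :
    (∑ k, if ∀ m, m ≠ n → i m = k m then f k else 0) = ∑ x, f (Function.update i n x) := by
  rw [← Finset.sum_filter]
  symm
  refine Finset.sum_nbij' (fun x => Function.update i n x) (fun k => k n) ?_ ?_ ?_ ?_ ?_
  · intro x _
    simp only [Finset.mem_filter, Finset.mem_univ, true_and]
    intro m hm
    simp [hm]
  · simp
  · simp
  · intro k hk
    simp only [Finset.mem_filter, Finset.mem_univ, true_and] at hk
    ext m
    by_cases hm : m = n
    · subst hm; simp
    · simp [hm, hk m hm]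
  · simp

theorem leg_apply {R : Type*} [Zero R] (n : ι) (A : Matrix (d n) (d n) R) (i j : ∀ m, d m) :
    leg n A i j = if ∀ m, m ≠ n → i m = j m then A (i n) (j n) else 0 := rfl

theorem leg_mul [∀ i, Fintype (d i)] {R : Type*} [NonUnitalNonAssocSemiring R] (n : ι)
    (A B : Matrix (d n) (d n) R) : leg n (A * B) = leg n A * leg n B := by
  ext i j
  simp only [Matrix.mul_apply, leg_apply, ite_mul, zero_mul]
  rw [sum_ite_agree_off]
  have h : ∀ x, (∀ m, m ≠ n → Function.update i n x m = j m) ↔ ∀ m, m ≠ n → i m = j m := by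
    intro x
    refine forall₂_congr fun m hm => ?_
    simp [hm]
  simp only [h, Function.update_self]
  split_ifs <;> simp

theorem leg_add {R : Type*} [AddZeroClass R] (n : ι) (A B : Matrix (d n) (d n) R) :
    leg n (A + B) = leg n A + leg n B := by
  ext i j
  simp only [leg_apply, Matrix.add_apply]
  split_ifs <;> simp

theorem leg_smul {R S : Type*} [Zero R] [SMulZeroClass S R] (n : ι) (c : S)
    (A : Matrix (d n) (d n) R) : leg n (c • A) = c • leg n A := by
  ext i j
  simp only [leg_apply, Matrix.smul_apply]
  split_ifs <;> simp

theorem leg_one {R : Type*} [Zero R] [One R] (n : ι) :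
    leg n (1 : Matrix (d n) (d n) R) = 1 := by
  ext i j
  simp only [leg_apply, Matrix.one_apply]
  by_cases h : i = j
  · simp [h]
  · rw [if_neg h]
    split_ifs with h1 h2
    · exfalso
      apply h
      ext m
      by_cases hm : m = n
      · subst hm; exact h2
      · exact h1 m hm
    · rfl
    · rfl

/-- `leg n` as a homomorphism of algebras. -/
def legHom [∀ i, Fintype (d i)] (n : ι) :
    Matrix (d n) (d n) ℂ →ₐ[ℂ] Matrix (∀ i, d i) (∀ i, d i) ℂ :=
  AlgHom.ofLinearMap
    { toFun := leg n, map_add' := leg_add n, map_smul' := fun c A => leg_smul n c A }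
    (leg_one n) (leg_mul n)

theorem legHom_apply [∀ i, Fintype (d i)] (n : ι) (A : Matrix (d n) (d n) ℂ) :
    legHom n A = leg n A := rfl

theorem leg_mul_leg_apply [∀ i, Fintype (d i)] {n m : ι} (hnm : n ≠ m)
    (A : Matrix (d n) (d n) ℂ) (B : Matrix (d m) (d m) ℂ) (i j : ∀ m, d m) :
    (leg n A * leg m B) i j =
      if ∀ p, p ≠ n → p ≠ m → i p = j p then A (i n) (j n) * B (i m) (j m) else 0 := by
  simp only [Matrix.mul_apply, leg_apply, ite_mul, zero_mul]
  rw [sum_ite_agree_off]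
  have h : ∀ x, (∀ p, p ≠ m → Function.update i n x p = j p) ↔
      x = j n ∧ ∀ p, p ≠ n → p ≠ m → i p = j p := by
    intro x
    constructor
    · intro h
      refine ⟨by simpa using h n hnm, fun p hpn hpm => by simpa [hpn] using h p hpm⟩
    · rintro ⟨rfl, h⟩ p hpm
      by_cases hpn : p = n
      · subst hpn; simp
      · simp [hpn, h p hpn hpm]
  simp only [h, Function.update_self, Function.update_of_ne hnm.symm]
  by_cases hc : ∀ p, p ≠ n → p ≠ m → i p = j p
  · simp only [and_iff_left hc, if_pos hc]
    simp
  · simp [hc]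

theorem commute_leg [∀ i, Fintype (d i)] {n m : ι} (hnm : n ≠ m)
    (A : Matrix (d n) (d n) ℂ) (B : Matrix (d m) (d m) ℂ) : Commute (leg n A) (leg m B) := by
  ext i j
  rw [leg_mul_leg_apply hnm, leg_mul_leg_apply hnm.symm]
  have : (∀ p, p ≠ n → p ≠ m → i p = j p) ↔ (∀ p, p ≠ m → p ≠ n → i p = j p) := by
    constructor <;> intro h p h1 h2 <;> exact h p h2 h1
  simp only [this, mul_comm]

/-- The product vector `⨂ n, w n`. -/
def prodVec (w : ∀ n, d n → ℂ) (c : ∀ n, d n) : ℂ := ∏ n, w n (c n)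

theorem prodVec_update (w : ∀ n, d n → ℂ) (c : ∀ n, d n) (n : ι) (x : d n) :
    prodVec w (Function.update c n x) = w n x * ∏ m ∈ Finset.univ.erase n, w m (c m) := by
  rw [prodVec, ← Finset.mul_prod_erase _ _ (Finset.mem_univ n)]
  congr 1
  · simp
  · refine Finset.prod_congr rfl fun m hm => ?_
    rw [Function.update_of_ne (Finset.ne_of_mem_erase hm)]

theorem prodVec_eq (w : ∀ n, d n → ℂ) (c : ∀ n, d n) (n : ι) :
    prodVec w c = w n (c n) * ∏ m ∈ Finset.univ.erase n, w m (c m) := by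
  rw [← prodVec_update, Function.update_eq_self]

theorem leg_mulVec_prodVec [∀ i, Fintype (d i)] (n : ι) (A : Matrix (d n) (d n) ℂ)
    (w : ∀ n, d n → ℂ) (c : ℂ) (h : A.mulVec (w n) = c • w n) :
    (leg n A).mulVec (prodVec w) = c • prodVec w := by
  ext i
  simp only [Matrix.mulVec, dotProduct, leg_apply, ite_mul, zero_mul]
  rw [sum_ite_agree_off]
  have h2 := congrFun h (i n)
  simp only [Matrix.mulVec, dotProduct, Pi.smul_apply, smul_eq_mul] at h2
  simp only [Function.update_self, prodVec_update, Pi.smul_apply, smul_eq_mul, ← mul_assoc]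
  rw [← Finset.sum_mul, h2, prodVec_eq w i n]
  ring

theorem prodVec_vecMul_leg [∀ i, Fintype (d i)] (n : ι) (A : Matrix (d n) (d n) ℂ)
    (w : ∀ n, d n → ℂ) (c : ℂ) (h : A.vecMul (w n) = c • w n) :
    (leg n A).vecMul (prodVec w) = c • prodVec w := by
  ext j
  have h3 : ∀ i : (∀ m, d m), (∀ m, m ≠ n → i m = j m) ↔ (∀ m, m ≠ n → j m = i m) :=
    fun (i : ∀ m, d m) => forall₂_congr fun m _ => eq_comm
  simp only [Matrix.vecMul, dotProduct, leg_apply, mul_ite, mul_zero, h3]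
  rw [sum_ite_agree_off]
  have h2 := congrFun h (j n)
  simp only [Matrix.vecMul, dotProduct, Pi.smul_apply, smul_eq_mul] at h2
  simp only [Function.update_self, prodVec_update, Pi.smul_apply, smul_eq_mul]
  rw [prodVec_eq w j n, ← mul_assoc, ← h2, Finset.sum_mul]
  exact Finset.sum_congr rfl fun x _ => by ring

theorem prodVec_ne_zero (w : ∀ n, d n → ℂ) (h : ∀ n, w n ≠ 0) : prodVec w ≠ 0 := by
  have h2 : ∀ n, ∃ x, w n x ≠ 0 := fun n => Function.ne_iff.mp (h n)
  choose x hx using h2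
  intro h0
  exact Finset.prod_ne_zero_iff.mpr (fun n _ => hx n) (congrFun h0 x)

end Leg

/-! ### Yangian relations -/

section Yangian

variable {A : Type*} [Ring A] [Algebra ℂ A]

/-- The relation `R₁₂(u - v) M₁(u) M₂(v) = M₂(v) M₁(u) R₁₂(u - v)`, `R(u) = u + η P`. -/
def RTT (η : ℂ) (M : ℂ → Matrix (Fin 2) (Fin 2) A) : Prop :=
  ∀ u v i j k l, (u - v) • (M u i j * M v k l) + η • (M u k j * M v i l) =
    (u - v) • (M v k l * M u i j) + η • (M v k j * M u i l)

/-- The antisymmetric symbol. -/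
def eps (i k : Fin 2) : ℂ := (k : ℕ) - (i : ℕ)

/-- `M₁(u) M₂(u - η) P⁻ = q(u) P⁻`: the quantum determinant of `M` is the scalar `q`. -/
def HasQDet (η : ℂ) (M : ℂ → Matrix (Fin 2) (Fin 2) A) (q : ℂ → ℂ) : Prop :=
  ∀ u i j k l, M u i j * M (u - η) k l - M u i l * M (u - η) k j =
    (eps i k * eps j l * q u) • (1 : A)

/-- This is the coproduct of the Yangian. Entries of the two factors commute, so a product of two
entries regroups into a block in `M` and a block in `M'`, and the exchange relation is applied to
one block after the other. -/
theorem RTT.mul {η : ℂ} {M M' : ℂ → Matrix (Fin 2) (Fin 2) A} (h : RTT η M) (h' : RTT η M')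
    (hc : ∀ u v i j k l, Commute (M u i j) (M' v k l)) : RTT η fun u => M u * M' u := by
  have key : ∀ u v i j k l, (M u * M' u) i j * (M v * M' v) k l =
      ∑ a, ∑ b, (M u i a * M v k b) * (M' u a j * M' v b l) := by
    intro u v i j k l
    simp only [Matrix.mul_apply, Finset.sum_mul_sum]
    refine Finset.sum_congr rfl fun a _ => Finset.sum_congr rfl fun b _ => ?_
    rw [mul_assoc, ← mul_assoc (M' u a j), ← (hc v u k b a j).eq]
    simp only [mul_assoc]
  intro u v i j k l
  have e0 : (u - v) • (∑ a, ∑ b, (M u i a * M v k b) * (M' u a j * M' v b l)) +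
      η • (∑ a, ∑ b, (M u k a * M v i b) * (M' u a j * M' v b l)) =
      ∑ a, ∑ b, ((u - v) • (M v k b * M u i a) + η • (M v k a * M u i b)) *
      (M' u a j * M' v b l) := by
    simp only [← h u v i _ k _, add_mul, Finset.smul_sum, Finset.sum_add_distrib, smul_mul_assoc]
  have e1 : (∑ a, ∑ b, ((u - v) • (M v k b * M u i a) + η • (M v k a * M u i b)) *
      (M' u a j * M' v b l)) = ∑ a, ∑ b, (M v k b * M u i a) *
        ((u - v) • (M' u a j * M' v b l) + η • (M' u b j * M' v a l)) := by
    simp only [add_mul, mul_add, Finset.sum_add_distrib, smul_mul_assoc, mul_smul_comm]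
    congr 1
    exact Finset.sum_comm
  simp only [key]
  rw [e0, e1, Finset.sum_comm]
  simp only [Finset.smul_sum, h' u v _ j _ l, mul_add, Finset.sum_add_distrib, mul_smul_comm]

/-- The relation for `M'` turns the inner double sum into an antisymmetrization over the
intermediate indices, which is the quantum determinant of `M`. -/
theorem HasQDet.mul {η : ℂ} {M M' : ℂ → Matrix (Fin 2) (Fin 2) A} {q q' : ℂ → ℂ}
    (h : HasQDet η M q) (h' : HasQDet η M' q')
    (hc : ∀ u v i j k l, Commute (M u i j) (M' v k l)) :
    HasQDet η (fun u => M u * M' u) fun u => q u * q' u := by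
  have key : ∀ u v i j k l, (M u * M' u) i j * (M v * M' v) k l =
      ∑ a, ∑ b, (M u i a * M v k b) * (M' u a j * M' v b l) := by
    intro u v i j k l
    simp only [Matrix.mul_apply, Finset.sum_mul_sum]
    refine Finset.sum_congr rfl fun a _ => Finset.sum_congr rfl fun b _ => ?_
    rw [mul_assoc, ← mul_assoc (M' u a j), ← (hc v u k b a j).eq]
    simp only [mul_assoc]
  intro u i j k l
  simp only [key]
  rw [← Finset.sum_sub_distrib]
  simp only [← Finset.sum_sub_distrib, ← mul_sub, h' u _ j _ l, mul_smul_comm, mul_one]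
  have e := h u i 0 k 1
  simp only [Fin.sum_univ_two, eps, Fin.val_zero, Fin.val_one, Nat.cast_zero, Nat.cast_one,
    sub_self, zero_mul, zero_smul, sub_zero, zero_sub, one_mul, add_zero, zero_add,
    neg_mul, mul_neg, mul_one, neg_smul] at e ⊢
  rw [neg_zero, zero_add, ← sub_eq_add_neg, ← smul_sub, e, smul_smul]
  congr 1
  ring

theorem rtt_const (η : ℂ) (K : Matrix (Fin 2) (Fin 2) ℂ) :
    RTT η fun _ => K.map fun c => c • (1 : A) := by
  intro u v i j k l
  simp only [Matrix.map_apply, smul_mul_smul_comm, mul_one]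
  rw [mul_comm (K i j)]

theorem hasQDet_const (η : ℂ) (K : Matrix (Fin 2) (Fin 2) ℂ) :
    HasQDet η (fun _ => K.map fun c => c • (1 : A)) fun _ => K.det := by
  intro u i j k l
  simp only [Matrix.map_apply, smul_mul_smul_comm, mul_one, ← sub_smul]
  congr 1
  rw [Matrix.det_fin_two]
  fin_cases i <;> fin_cases j <;> fin_cases k <;> fin_cases l <;> simp [eps] <;> ring

theorem commute_const (K : Matrix (Fin 2) (Fin 2) ℂ) (x : A) (i j : Fin 2) :
    Commute ((K.map fun c => c • (1 : A)) i j) x := by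
  simp only [Matrix.map_apply]
  exact (Commute.one_left x).smul_left _

theorem RTT.map {B : Type*} [Ring B] [Algebra ℂ B] {η : ℂ} {M : ℂ → Matrix (Fin 2) (Fin 2) A}
    (h : RTT η M) (f : A →ₐ[ℂ] B) : RTT η fun u => (M u).map f := by
  intro u v i j k l
  simpa using congrArg f (h u v i j k l)

theorem HasQDet.map {B : Type*} [Ring B] [Algebra ℂ B] {η : ℂ}
    {M : ℂ → Matrix (Fin 2) (Fin 2) A} {q : ℂ → ℂ}
    (h : HasQDet η M q) (f : A →ₐ[ℂ] B) : HasQDet η (fun u => (M u).map f) q := by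
  intro u i j k l
  simpa using congrArg f (h u i j k l)

theorem RTT.shift {η : ℂ} {M : ℂ → Matrix (Fin 2) (Fin 2) A} (h : RTT η M) (c : ℂ) :
    RTT η fun u => M (u - c) := by
  intro u v i j k l
  have := h (u - c) (v - c) i j k l
  rwa [sub_sub_sub_cancel_right] at this

theorem HasQDet.shift {η : ℂ} {M : ℂ → Matrix (Fin 2) (Fin 2) A} {q : ℂ → ℂ}
    (h : HasQDet η M q) (c : ℂ) : HasQDet η (fun u => M (u - c)) fun u => q (u - c) := by
  intro u i j k l
  have := h (u - c) i j k l
  rwa [sub_right_comm] at this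

end Yangian

/-! ### The Lax operator of one site -/

section Lax

theorem spinPlus_apply (l : ℕ) (i j : Fin (l + 1)) : spinPlus l i j =
    if (j : ℕ) = i + 1 then ((Real.sqrt (((i : ℕ) + 1 : ℝ) * ((l : ℝ) - (i : ℕ))) : ℝ) : ℂ)
    else 0 := rfl

theorem spinMinus_apply (l : ℕ) (i j : Fin (l + 1)) : spinMinus l i j = spinPlus l j i := rfl

theorem sqrt_mul_sqrt_spin (l : ℕ) (i : ℕ) (hi : i ≤ l) :
    ((Real.sqrt (((i : ℕ) + 1 : ℝ) * ((l : ℝ) - (i : ℕ))) : ℝ) : ℂ) *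
      ((Real.sqrt (((i : ℕ) + 1 : ℝ) * ((l : ℝ) - (i : ℕ))) : ℝ) : ℂ) =
      ((i : ℂ) + 1) * ((l : ℂ) - i) := by
  have h : (0 : ℝ) ≤ (i + 1 : ℝ) * ((l : ℝ) - i) := by
    have : (i : ℝ) ≤ l := by exact_mod_cast hi
    exact mul_nonneg (by positivity) (by linarith)
  rw [← Complex.ofReal_mul, Real.mul_self_sqrt h]
  push_cast
  ring

theorem spinPlus_mul_spinMinus (l : ℕ) : spinPlus l * spinMinus l =
    Matrix.diagonal fun i : Fin (l + 1) => (((i : ℕ) : ℂ) + 1) * ((l : ℂ) - (i : ℕ)) := by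
  ext i j
  rw [Matrix.mul_apply]
  simp only [spinMinus_apply, spinPlus_apply]
  by_cases hij : i = j
  · subst hij
    rw [Matrix.diagonal_apply_eq]
    by_cases hi : (i : ℕ) + 1 < l + 1
    · rw [Finset.sum_eq_single (⟨i + 1, hi⟩ : Fin (l + 1))]
      · simp only [if_true]
        exact sqrt_mul_sqrt_spin l i (by omega)
      · intro b _ hb
        rw [if_neg (fun h => hb (Fin.ext h)), zero_mul]
      · simp
    · have hl : (i : ℕ) = l := by omega
      rw [Finset.sum_eq_zero]
      · rw [hl]; ring
      · intro b _
        rw [if_neg (by omega), zero_mul]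
  · rw [Matrix.diagonal_apply_ne _ hij, Finset.sum_eq_zero]
    intro b _
    by_cases h1 : (b : ℕ) = i + 1
    · rw [if_neg (c := (b : ℕ) = j + 1), mul_zero]
      intro h2
      exact hij (Fin.ext (by omega))
    · rw [if_neg h1, zero_mul]

theorem spinMinus_mul_spinPlus (l : ℕ) : spinMinus l * spinPlus l =
    Matrix.diagonal fun i : Fin (l + 1) => ((i : ℕ) : ℂ) * ((l : ℂ) + 1 - (i : ℕ)) := by
  ext i j
  rw [Matrix.mul_apply]
  simp only [spinMinus_apply, spinPlus_apply]
  by_cases hij : i = j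
  · subst hij
    rw [Matrix.diagonal_apply_eq]
    by_cases hi : (i : ℕ) = 0
    · rw [Finset.sum_eq_zero]
      · rw [hi]; simp
      · intro b _
        rw [if_neg (by omega), zero_mul]
    · obtain ⟨p, hp⟩ := Nat.exists_eq_succ_of_ne_zero hi
      have hpl : p < l + 1 := by omega
      rw [Finset.sum_eq_single (⟨p, hpl⟩ : Fin (l + 1))]
      · simp only [if_pos hp]
        rw [sqrt_mul_sqrt_spin l p (by omega), hp]
        push_cast
        ring
      · intro b _ hb
        rw [if_neg, zero_mul]
        intro h
        exact hb (Fin.ext (by simp only; omega))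
      · simp
  · rw [Matrix.diagonal_apply_ne _ hij, Finset.sum_eq_zero]
    intro b _
    by_cases h1 : (i : ℕ) = b + 1
    · rw [if_neg (c := (j : ℕ) = b + 1), mul_zero]
      intro h2
      exact hij (Fin.ext (by omega))
    · rw [if_neg h1, zero_mul]

theorem spinZ_mul_spinPlus (l : ℕ) :
    spinZ l * spinPlus l = spinPlus l * spinZ l + spinPlus l := by
  ext i j
  rw [spinZ, Matrix.add_apply, Matrix.diagonal_mul, Matrix.mul_diagonal, spinPlus_apply]
  split_ifs with h
  · rw [h]; push_cast; ring
  · ring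

theorem spinZ_mul_spinMinus (l : ℕ) :
    spinZ l * spinMinus l = spinMinus l * spinZ l - spinMinus l := by
  ext i j
  rw [spinZ, Matrix.sub_apply, Matrix.diagonal_mul, Matrix.mul_diagonal, spinMinus_apply,
    spinPlus_apply]
  split_ifs with h
  · rw [h]; push_cast; ring
  · ring

theorem spinMinus_mul_spinPlus_eq (l : ℕ) : spinMinus l * spinPlus l =
    spinPlus l * spinMinus l - (2 : ℂ) • spinZ l := by
  rw [spinMinus_mul_spinPlus, spinPlus_mul_spinMinus, spinZ]
  ext i j
  by_cases hij : i = j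
  · subst hij
    simp
    ring
  · simp [hij]

/-- The image of the generators of `gl₂` in the spin `l / 2` representation. -/
def siteGen (l : ℕ) : Matrix (Fin 2) (Fin 2) (Matrix (Fin (l + 1)) (Fin (l + 1)) ℂ) :=
  !![(1 / 2 : ℂ) • 1 + spinZ l, spinMinus l; spinPlus l, (1 / 2 : ℂ) • 1 - spinZ l]

/-- The Lax operator of a single site. -/
def siteLax (l : ℕ) (η u : ℂ) :
    Matrix (Fin 2) (Fin 2) (Matrix (Fin (l + 1)) (Fin (l + 1)) ℂ) :=
  u • 1 + η • siteGen l

theorem siteLax_apply (l : ℕ) (η u : ℂ) (i j : Fin 2) :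
    siteLax l η u i j = u • (if i = j then 1 else 0) + η • siteGen l i j := rfl

/-- These are the relations of gl₂ in transposed indexing. They are all that the Yangian relation of
u + ηE requires. -/
theorem siteGen_comm (l : ℕ) (i j k m : Fin 2) :
    siteGen l i j * siteGen l k m = siteGen l k m * siteGen l i j +
      ((if i = m then siteGen l k j else 0) - if k = j then siteGen l i m else 0) := by
  fin_cases i <;> fin_cases j <;> fin_cases k <;> fin_cases m <;>
    simp [siteGen, mul_add, add_mul, mul_sub, sub_mul, spinZ_mul_spinPlus, spinZ_mul_spinMinus,
      spinMinus_mul_spinPlus_eq] <;> module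

theorem rtt_siteLax (l : ℕ) (η : ℂ) : RTT η (siteLax l η) := by
  intro u v i j k m
  simp only [siteLax_apply, mul_add, add_mul, smul_mul_smul_comm, mul_ite, ite_mul, mul_one,
    one_mul, mul_zero, zero_mul, siteGen_comm l i j k m]
  rw [siteGen_comm l k j i m]
  simp only [eq_comm (a := i), eq_comm (a := k)]
  split_ifs <;> module

theorem eps_swap (i k : Fin 2) : eps k i = -eps i k := by simp [eps]

theorem hasQDet_siteLax (l : ℕ) (η : ℂ) : HasQDet η (siteLax l η) fun u =>
    (u + η / 2 + (l : ℂ) / 2 * η) * (u - η / 2 - (l : ℂ) / 2 * η) := by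
  -- The column pair (0, 1) suffices: the left side is antisymmetric under exchange of the two
  -- column indices.
  have key : ∀ u i k, siteLax l η u i 0 * siteLax l η (u - η) k 1 -
      siteLax l η u i 1 * siteLax l η (u - η) k 0 = (eps i k * ((u + η / 2 + (l : ℂ) / 2 * η) *
        (u - η / 2 - (l : ℂ) / 2 * η))) • 1 := by
    intro u i k
    -- The Casimir identity, with value s(s + 1) = (l² + 2l)/4. It is what makes the quantum
    -- determinant a scalar.
    have hz : spinZ l * spinZ l = (((l : ℂ) ^ 2 + 2 * l) / 4) • 1 - spinZ l -
        spinMinus l * spinPlus l := by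
      rw [spinMinus_mul_spinPlus, spinZ, Matrix.diagonal_mul_diagonal]
      ext i j
      by_cases hij : i = j
      · subst hij
        simp
        ring
      · simp [hij]
    have hpm : spinPlus l * spinMinus l = spinMinus l * spinPlus l + (2 : ℂ) • spinZ l := by
      rw [spinMinus_mul_spinPlus_eq]; module
    fin_cases i <;> fin_cases k <;>
      simp [siteLax_apply, siteGen, eps, mul_add, add_mul, mul_sub, sub_mul, smul_add, smul_sub,
        spinZ_mul_spinPlus, spinZ_mul_spinMinus, hz, hpm] <;> module
  intro u i j k m
  have h := key u i k
  fin_cases j <;> fin_cases m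
  · simp [eps]
  · simpa [eps] using h
  · have h2 := congrArg Neg.neg h
    rw [neg_sub, ← neg_smul, ← neg_mul, ← eps_swap] at h2
    refine Eq.trans h2 ?_
    rw [eps_swap i k]
    congr 1
    simp [eps]
  · simp [eps]

/-- The covector is the `l`-th tensor power of (1, z) in the normalized basis of symmetric tensors,
whence the square roots of binomials. The generators act on it as first-order differential operators
in z. -/
theorem vecMul_coherent_spinMinus (l : ℕ) (z : ℂ) (j : Fin (l + 1)) :
    (spinMinus l).vecMul (fun i : Fin (l + 1) => ((Real.sqrt (l.choose i) : ℝ) : ℂ) * z ^ (i : ℕ)) j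
      = ((Real.sqrt (l.choose j) : ℝ) : ℂ) * z ^ (j : ℕ) * (z * ((l : ℂ) - (j : ℕ))) := by
  simp only [Matrix.vecMul, dotProduct, spinMinus_apply, spinPlus_apply]
  by_cases hj : (j : ℕ) + 1 < l + 1
  · rw [Finset.sum_eq_single (⟨j + 1, hj⟩ : Fin (l + 1))]
    · simp only [if_true]
      have h : Real.sqrt (l.choose (j + 1)) * Real.sqrt (((j : ℕ) + 1 : ℝ) * ((l : ℝ) - (j : ℕ))) =
          Real.sqrt (l.choose j) * ((l : ℝ) - (j : ℕ)) := by
        have hle : (j : ℝ) ≤ l := by exact_mod_cast (by omega : (j : ℕ) ≤ l)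
        have h1 : (l.choose (j + 1) : ℝ) * (j + 1) = l.choose j * ((l : ℝ) - j) := by
          have := Nat.choose_succ_right_eq l j
          rw [← Nat.cast_sub (by omega)]
          exact_mod_cast this
        rw [← Real.sqrt_mul (by positivity), ← mul_assoc, h1, mul_assoc,
          Real.sqrt_mul (by positivity), Real.sqrt_mul_self (by linarith)]
      have h' := congrArg (fun x : ℝ => (x : ℂ)) h
      push_cast at h'
      push_cast
      rw [pow_succ]
      linear_combination z ^ (j : ℕ) * z * h'
    · intro b _ hb
      rw [if_neg (fun h => hb (Fin.ext h)), mul_zero]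
    · simp
  · have hl : (j : ℕ) = l := by omega
    rw [Finset.sum_eq_zero]
    · rw [hl]; ring
    · intro b _
      rw [if_neg (by omega), mul_zero]

/-- The extra factor `z` on the left avoids z^(j-1), so that j = 0 and z = 0 need no separate form.
The Lax operator is applied to (-z, 1), which supplies exactly this factor. -/
theorem vecMul_coherent_spinPlus (l : ℕ) (z : ℂ) (j : Fin (l + 1)) :
    z * (spinPlus l).vecMul
      (fun i : Fin (l + 1) => ((Real.sqrt (l.choose i) : ℝ) : ℂ) * z ^ (i : ℕ)) j
      = ((Real.sqrt (l.choose j) : ℝ) : ℂ) * z ^ (j : ℕ) * ((j : ℕ) : ℂ) := by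
  simp only [Matrix.vecMul, dotProduct, spinPlus_apply]
  by_cases hj : (j : ℕ) = 0
  · rw [Finset.sum_eq_zero]
    · rw [hj]; simp
    · intro b _
      rw [if_neg (by omega), mul_zero]
  · obtain ⟨p, hp⟩ := Nat.exists_eq_succ_of_ne_zero hj
    have hpl : p < l + 1 := by omega
    rw [Finset.sum_eq_single (⟨p, hpl⟩ : Fin (l + 1))]
    · simp only [if_pos hp]
      have h : Real.sqrt (l.choose p) * Real.sqrt (((p : ℕ) + 1 : ℝ) * ((l : ℝ) - (p : ℕ))) =
          Real.sqrt (l.choose (p + 1)) * ((p : ℝ) + 1) := by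
        have hle : (p : ℝ) ≤ l := by exact_mod_cast (by omega : (p : ℕ) ≤ l)
        have h1 : (l.choose (p + 1) : ℝ) * (p + 1) = l.choose p * ((l : ℝ) - p) := by
          have := Nat.choose_succ_right_eq l p
          rw [← Nat.cast_sub (by omega)]
          exact_mod_cast this
        rw [← Real.sqrt_mul (by positivity), mul_comm (((p : ℕ) + 1 : ℝ)), ← mul_assoc, ← h1,
          mul_assoc, Real.sqrt_mul (by positivity), Real.sqrt_mul_self (by positivity)]
      have h' := congrArg (fun x : ℝ => (x : ℂ)) h
      push_cast at h'
      rw [hp, Nat.succ_eq_add_one]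
      push_cast
      rw [pow_succ]
      linear_combination z ^ p * z * h'
    · intro b _ hb
      rw [if_neg, mul_zero]
      intro h
      exact hb (Fin.ext (by simp only; omega))
    · simp

/-- The coherent covector `ω(z)` satisfies `ω L(u) e = (u + η / 2 - l η / 2) e ω`, `e = (-z, 1)`. -/
theorem exists_site_reference (l : ℕ) (η z : ℂ) : ∃ ω : Fin (l + 1) → ℂ, ω ≠ 0 ∧ ∀ u i,
    (-z • siteLax l η u i 0 + siteLax l η u i 1).vecMul ω =
      ((u + η / 2 - (l : ℂ) / 2 * η) * (![-z, 1] : Fin 2 → ℂ) i) • ω := by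
  refine ⟨fun i => ((Real.sqrt (l.choose i) : ℝ) : ℂ) * z ^ (i : ℕ), ?_, ?_⟩
  · intro h
    have := congrFun h 0
    simp at this
  · intro u i
    ext j
    have hm := vecMul_coherent_spinMinus l z j
    have hp := vecMul_coherent_spinPlus l z j
    have hz : (spinZ l).vecMul
        (fun i : Fin (l + 1) => ((Real.sqrt (l.choose i) : ℝ) : ℂ) * z ^ (i : ℕ)) j =
        ((Real.sqrt (l.choose j) : ℝ) : ℂ) * z ^ (j : ℕ) * ((l : ℂ) / 2 - (j : ℕ)) := by
      rw [spinZ, Matrix.vecMul_diagonal]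
    fin_cases i
    · simp [siteLax_apply, siteGen, Matrix.vecMul_add, Matrix.vecMul_smul, Matrix.vecMul_neg,
        hm, hz]
      ring
    · simp [siteLax_apply, siteGen, Matrix.vecMul_add, Matrix.vecMul_smul, Matrix.vecMul_sub,
        Matrix.vecMul_neg, hz]
      linear_combination (-η) * hp

end Lax

/-! ### Fusion -/

section Continuant

/-- The continuant attached to a sequence `T` of operators and a sequence `q` of scalars. -/
def cont {A : Type*} [Ring A] [Algebra ℂ A] (T : ℕ → A) (q : ℕ → ℂ) : ℕ → A
  | 0 => 1
  | 1 => T 0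
  | m + 2 => cont T q (m + 1) * T (m + 1) - q m • cont T q m

end Continuant

/-! ### Fusion through generating functions of columns. -/

section ColumnWords

variable {A : Type*} [Ring A] [Algebra ℂ A]

/-- The generating function `M_{0j} + M_{1j} X` of a column. -/
def colGen (M : Matrix (Fin 2) (Fin 2) A) (j : Fin 2) : A[X] := C (M 0 j) + C (M 1 j) * X

/-- Ordered product of column generating functions with arguments `w, w - η, …`; the word of
columns is read backwards. -/
def colWord (η : ℂ) (M : ℂ → Matrix (Fin 2) (Fin 2) A) (w : ℂ) : List (Fin 2) → A[X]
  | [] => 1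
  | j :: js => colWord η M w js * colGen (M (w - js.length * η)) j

/-- Exchanging the columns produces an error antisymmetric in the row indices, by the quantum
determinant relation. The commuting variable X records only the number of ones among the rows, hence
symmetrizes them, and the error cancels. -/
theorem colGen_swap {η : ℂ} {M : ℂ → Matrix (Fin 2) (Fin 2) A} {q : ℂ → ℂ} (h : HasQDet η M q)
    (u : ℂ) (a b : Fin 2) :
    colGen (M u) a * colGen (M (u - η)) b = colGen (M u) b * colGen (M (u - η)) a := by
  have h00 : M u 0 a * M (u - η) 0 b = M u 0 b * M (u - η) 0 a := by
    have := h u 0 a 0 b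
    simp only [eps, sub_self, zero_mul, zero_smul] at this
    exact sub_eq_zero.mp this
  have h11 : M u 1 a * M (u - η) 1 b = M u 1 b * M (u - η) 1 a := by
    have := h u 1 a 1 b
    simp only [eps, sub_self, zero_mul, zero_smul] at this
    exact sub_eq_zero.mp this
  have h01 : M u 0 a * M (u - η) 1 b + M u 1 a * M (u - η) 0 b =
      M u 0 b * M (u - η) 1 a + M u 1 b * M (u - η) 0 a := by
    have h1 := h u 0 a 1 b
    have h2 := h u 1 a 0 b
    have h3 : (M u 0 a * M (u - η) 1 b - M u 0 b * M (u - η) 1 a) +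
        (M u 1 a * M (u - η) 0 b - M u 1 b * M (u - η) 0 a) = 0 := by
      rw [h1, h2, ← add_smul, eps_swap 0 1]
      simp
    rw [← sub_eq_zero, ← h3]
    abel
  have expand : ∀ a b, colGen (M u) a * colGen (M (u - η)) b =
      C (M u 0 a * M (u - η) 0 b) + C (M u 0 a * M (u - η) 1 b + M u 1 a * M (u - η) 0 b) * X +
        C (M u 1 a * M (u - η) 1 b) * X ^ 2 := by
    intro a b
    simp only [colGen, mul_add, add_mul, C_add, C_mul, pow_two]
    rw [mul_assoc (C (M u 1 a)) X, X_mul_C, mul_assoc (C (M u 1 a)) X, ← mul_assoc X, X_mul_C]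
    simp only [mul_assoc]
    abel
  rw [expand, expand, h00, h11, h01]

/-- Adjacent exchanges generate all permutations, so a word matters only through its number of ones.
This plays the role of symmetry of the fused monodromy in its column indices. -/
theorem colWord_perm {η : ℂ} {M : ℂ → Matrix (Fin 2) (Fin 2) A} {q : ℂ → ℂ} (h : HasQDet η M q)
    (w : ℂ) {js ks : List (Fin 2)} (hp : js.Perm ks) : colWord η M w js = colWord η M w ks := by
  induction hp with
  | nil => rfl
  | cons j hp ih => simp only [colWord, ih, hp.length_eq]
  | swap a b js =>
    simp only [colWord, List.length_cons]
    have := colGen_swap h (w - js.length * η) a b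
    rw [show w - js.length * η - η = w - ((js.length + 1 : ℕ) : ℂ) * η by push_cast; ring] at this
    rw [mul_assoc, mul_assoc, this]
  | trans _ _ ih1 ih2 => exact ih1.trans ih2

theorem coeff_colWord_of_length_lt (η : ℂ) (M : ℂ → Matrix (Fin 2) (Fin 2) A) (w : ℂ)
    (js : List (Fin 2)) (b : ℕ) (hb : js.length < b) : (colWord η M w js).coeff b = 0 := by
  induction js generalizing b with
  | nil =>
    rw [colWord, coeff_one, if_neg]
    simp at hb
    omega
  | cons j js ih =>
    obtain ⟨c, rfl⟩ := Nat.exists_eq_succ_of_ne_zero (by omega : b ≠ 0)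
    simp only [List.length_cons] at hb
    rw [colWord, colGen, mul_add, ← mul_assoc, coeff_add, coeff_mul_C, coeff_mul_X, coeff_mul_C,
      ih _ (by omega), ih _ (by omega)]
    simp

/-- The standard column word with `b` ones and `m - b` zeros. -/
def stdWord (m b : ℕ) : List (Fin 2) := List.replicate b 1 ++ List.replicate (m - b) 0

/-- The trace of the `m`-fold fused monodromy with arguments `w, w - η, …, w - (m - 1) η`. -/
def fusedSum (η : ℂ) (M : ℂ → Matrix (Fin 2) (Fin 2) A) (w : ℂ) (m : ℕ) : A :=
  ∑ b ∈ Finset.range (m + 1), (colWord η M w (stdWord m b)).coeff b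

theorem fusedSum_zero (η : ℂ) (M : ℂ → Matrix (Fin 2) (Fin 2) A) (w : ℂ) :
    fusedSum η M w 0 = 1 := by
  simp [fusedSum, stdWord, colWord]

theorem coeff_colWord_cons_succ (η : ℂ) (M : ℂ → Matrix (Fin 2) (Fin 2) A) (w : ℂ) (j : Fin 2)
    (js : List (Fin 2)) (b : ℕ) : (colWord η M w (j :: js)).coeff (b + 1) =
      (colWord η M w js).coeff (b + 1) * M (w - js.length * η) 0 j +
      (colWord η M w js).coeff b * M (w - js.length * η) 1 j := by
  rw [colWord, colGen, mul_add, ← mul_assoc, coeff_add, coeff_mul_C, coeff_mul_X, coeff_mul_C]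

theorem coeff_colWord_cons_zero (η : ℂ) (M : ℂ → Matrix (Fin 2) (Fin 2) A) (w : ℂ) (j : Fin 2)
    (js : List (Fin 2)) : (colWord η M w (j :: js)).coeff 0 =
      (colWord η M w js).coeff 0 * M (w - js.length * η) 0 j := by
  rw [colWord, colGen, mul_add, ← mul_assoc, coeff_add, coeff_mul_C, coeff_mul_X_zero, add_zero]

theorem length_stdWord {m b : ℕ} (h : b ≤ m) : (stdWord m b).length = m := by
  simp [stdWord]
  omega

theorem stdWord_succ_succ (m b : ℕ) : stdWord (m + 1) (b + 1) = 1 :: stdWord m b := by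
  simp [stdWord, List.replicate_succ]

theorem stdWord_succ_perm {m b : ℕ} (h : b ≤ m) :
    (stdWord (m + 1) b).Perm (0 :: stdWord m b) := by
  simp only [stdWord]
  rw [show m + 1 - b = (m - b) + 1 by omega, List.replicate_succ]
  exact List.perm_middle

theorem fusedSum_one (η : ℂ) (M : ℂ → Matrix (Fin 2) (Fin 2) A) (w : ℂ) :
    fusedSum η M w 1 = (M w).trace := by
  simp [fusedSum, stdWord, colWord, colGen, Finset.sum_range_succ, Matrix.trace, coeff_one]

/-- The fusion relation. -/
theorem fusedSum_succ_succ {η : ℂ} {M : ℂ → Matrix (Fin 2) (Fin 2) A} {q : ℂ → ℂ}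
    (h : HasQDet η M q) (w : ℂ) (m : ℕ) : fusedSum η M w (m + 2) =
      fusedSum η M w (m + 1) * (M (w - ((m + 1 : ℕ) : ℂ) * η)).trace -
        q (w - m * η) • fusedSum η M w m := by
  set u := w - (m : ℂ) * η with hu
  have hu' : w - ((m + 1 : ℕ) : ℂ) * η = u - η := by rw [hu]; push_cast; ring
  rw [hu']
  -- `Z a b` has `a` ones among the rows and `b` ones among the columns. The head of a column word
  -- is the rightmost factor, so prepending a letter brings in the next argument u - η.
  set Z : ℕ → ℕ → A := fun a b => (colWord η M w (stdWord (m + 1) b)).coeff a with hZ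
  have hlen : ∀ b ≤ m + 1, w - ((stdWord (m + 1) b).length : ℂ) * η = u - η := by
    intro b hb
    rw [length_stdWord hb, hu']
  have h1 : fusedSum η M w (m + 2) = Z 0 0 * M (u - η) 0 0 +
      ∑ b ∈ Finset.range (m + 2), (Z (b + 1) b * M (u - η) 0 1 + Z b b * M (u - η) 1 1) := by
    rw [fusedSum, Finset.sum_range_succ', add_comm]
    congr 1
    · rw [colWord_perm h w (stdWord_succ_perm (Nat.zero_le (m + 1))), coeff_colWord_cons_zero,
        hlen 0 (Nat.zero_le _)]
    · refine Finset.sum_congr rfl fun b hb => ?_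
      rw [stdWord_succ_succ, coeff_colWord_cons_succ,
        hlen b (by have := Finset.mem_range.mp hb; omega)]
  have h2 : fusedSum η M w (m + 1) * (M (u - η)).trace =
      ∑ b ∈ Finset.range (m + 2), (Z b b * M (u - η) 0 0 + Z b b * M (u - η) 1 1) := by
    rw [fusedSum, Matrix.trace, Fin.sum_univ_two, Finset.sum_mul]
    exact Finset.sum_congr rfl fun b _ => by rw [mul_add]; rfl
  have hq0 : M u 0 1 * M (u - η) 0 0 = M u 0 0 * M (u - η) 0 1 := by
    have := h u 0 1 0 0
    simp only [eps, sub_self, zero_mul, zero_smul] at this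
    exact sub_eq_zero.mp this
  have hq1 : M u 1 1 * M (u - η) 0 0 - M u 1 0 * M (u - η) 0 1 = q u • 1 := by
    have := h u 1 1 0 0
    simpa [eps] using this
  -- One more factor is split off, with column 1 chosen last in the first term and column 0 in the
  -- second. The row-0 contributions cancel by `hq0`, and the row-1 contributions form the quantum
  -- determinant by `hq1`.
  have h3 : ∀ b ≤ m, Z (b + 1) (b + 1) * M (u - η) 0 0 - Z (b + 1) b * M (u - η) 0 1 =
      q u • (colWord η M w (stdWord m b)).coeff b := by
    intro b hb
    simp only [hZ]
    rw [stdWord_succ_succ, colWord_perm h w (stdWord_succ_perm hb), coeff_colWord_cons_succ,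
      coeff_colWord_cons_succ, length_stdWord hb, ← hu]
    simp only [add_mul, mul_assoc, hq0]
    rw [add_sub_add_left_eq_sub, ← mul_sub, hq1, mul_smul_comm, mul_one]
  have h4 : Z (m + 2) (m + 1) = 0 := by
    simp only [hZ]
    exact coeff_colWord_of_length_lt _ _ _ _ _ (by rw [length_stdWord le_rfl]; omega)
  have h5 : q u • fusedSum η M w m = ∑ b ∈ Finset.range (m + 1),
      (Z (b + 1) (b + 1) * M (u - η) 0 0 - Z (b + 1) b * M (u - η) 0 1) := by
    rw [fusedSum, Finset.smul_sum]
    exact Finset.sum_congr rfl fun b hb =>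
      (h3 b (by have := Finset.mem_range.mp hb; omega)).symm
  rw [h1, h2, h5]
  simp only [Finset.sum_add_distrib, Finset.sum_sub_distrib]
  rw [Finset.sum_range_succ (fun b => Z (b + 1) b * M (u - η) 0 1), h4, zero_mul, add_zero,
    Finset.sum_range_succ' (fun b => Z b b * M (u - η) 0 0)]
  abel

theorem fusedSum_eq_cont {η : ℂ} {M : ℂ → Matrix (Fin 2) (Fin 2) A} {q : ℂ → ℂ}
    (h : HasQDet η M q) (w : ℂ) (m : ℕ) : fusedSum η M w m =
      cont (fun k => (M (w - k * η)).trace) (fun k => q (w - k * η)) m := by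
  induction m using Nat.twoStepInduction with
  | zero => rw [fusedSum_zero, cont]
  | one => rw [fusedSum_one, cont]; simp
  | more m h1 h2 => rw [fusedSum_succ_succ h, h1, h2, cont]

/-- Coefficients of a column word as sums over row words. -/
theorem sum_rowWords (η : ℂ) (M : ℂ → Matrix (Fin 2) (Fin 2) A) (w : ℂ) (m : ℕ)
    (j : Fin m → Fin 2) :
    ∑ i : Fin m → Fin 2,
      C ((List.ofFn fun k : Fin m => M (w - (k : ℕ) * η) (i k) (j k)).prod) *
        X ^ (∑ k, (i k : ℕ)) = colWord η M w (List.ofFn j).reverse := by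
  induction m with
  | zero => simp [colWord]
  | succ m ih =>
    rw [List.ofFn_succ', List.concat_eq_append, List.reverse_append, List.reverse_singleton,
      List.singleton_append, colWord, ← ih,
      ← Equiv.sum_comp (M := A[X]) (Fin.snocEquiv fun _ : Fin (m + 1) => Fin 2), Fintype.sum_prod_type]
    simp only [List.length_reverse, List.length_ofFn, Fin.snocEquiv_apply, List.ofFn_succ',
      List.concat_eq_append, List.prod_append, List.prod_singleton, Fin.snoc_castSucc,
      Fin.snoc_last, Fin.sum_univ_castSucc (n := m), Fin.val_castSucc, Fin.val_last]
    rw [Finset.sum_comm, Finset.sum_mul]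
    refine Finset.sum_congr rfl fun i _ => ?_
    rw [Fin.sum_univ_two]
    simp only [colGen, mul_add, C_mul, Fin.val_zero, Fin.val_one, add_zero, pow_succ]
    congr 1
    · simp only [mul_assoc]
      rw [X_pow_mul_C]
    · simp only [mul_assoc]
      rw [← mul_assoc (X ^ _) (C _), X_pow_mul_C]
      simp only [mul_assoc]

end ColumnWords

/-! ### The trace over the symmetric subspace -/

section SymTrace

/-- The number of ones in a word. -/
def ones {m : ℕ} (i : Fin m → Fin 2) : ℕ := ∑ k, (i k : ℕ)

theorem ones_le {m : ℕ} (i : Fin m → Fin 2) : ones i ≤ m := by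
  calc ones i ≤ ∑ _k : Fin m, 1 := Finset.sum_le_sum fun k _ => by omega
    _ = m := by simp

theorem ones_comp_perm {m : ℕ} (i : Fin m → Fin 2) (π : Equiv.Perm (Fin m)) :
    ones (i ∘ π) = ones i := Equiv.sum_comp π fun k => (i k : ℕ)

theorem list_perm_stdWord (js : List (Fin 2)) : (js.map fun j : Fin 2 => (j : ℕ)).sum ≤ js.length ∧
    js.Perm (stdWord js.length (js.map fun j : Fin 2 => (j : ℕ)).sum) := by
  induction js with
  | nil => simp [stdWord]
  | cons j js ih =>
    obtain ⟨h1, h2⟩ := ih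
    fin_cases j
    · refine ⟨by simp; omega, ?_⟩
      simp only [List.map_cons, List.sum_cons, List.length_cons, Fin.zero_eta, Fin.val_zero,
        zero_add]
      exact (h2.cons 0).trans (stdWord_succ_perm h1).symm
    · refine ⟨by simp; omega, ?_⟩
      simp only [List.map_cons, List.sum_cons, List.length_cons, Fin.mk_one, Fin.val_one,
        add_comm 1, stdWord_succ_succ]
      exact h2.cons 1

theorem ofFn_perm_stdWord {m : ℕ} (i : Fin m → Fin 2) :
    (List.ofFn i).Perm (stdWord m (ones i)) := by
  have h := (list_perm_stdWord (List.ofFn i)).2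
  rw [List.length_ofFn, List.map_ofFn, List.sum_ofFn] at h
  exact h

theorem exists_perm_of_ones_eq {m : ℕ} {i j : Fin m → Fin 2} (h : ones i = ones j) :
    ∃ σ : Equiv.Perm (Fin m), j = i ∘ σ := by
  have hp : (List.ofFn i).Perm (List.ofFn j) :=
    (ofFn_perm_stdWord i).trans (h ▸ (ofFn_perm_stdWord j).symm)
  have hs : i ∘ Tuple.sort i = j ∘ Tuple.sort j :=
    List.ofFn_injective <| List.Perm.eq_of_pairwise'
      (Tuple.monotone_sort i).sortedLE_ofFn.pairwise (Tuple.monotone_sort j).sortedLE_ofFn.pairwise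
      (((Tuple.sort i).ofFn_comp_perm i).trans (hp.trans ((Tuple.sort j).ofFn_comp_perm j).symm))
  refine ⟨Tuple.sort i * (Tuple.sort j)⁻¹, ?_⟩
  rw [Equiv.Perm.coe_mul, ← Function.comp_assoc, hs, Function.comp_assoc, ← Equiv.Perm.coe_mul,
    mul_inv_cancel, Equiv.Perm.coe_one, Function.comp_id]

theorem exists_ones_eq {m b : ℕ} (h : b ≤ m) : ∃ i : Fin m → Fin 2, ones i = b := by
  refine ⟨fun k => if (k : ℕ) < b then 1 else 0, ?_⟩
  have : ∀ k : Fin m, ((if (k : ℕ) < b then 1 else 0 : Fin 2) : ℕ) = if (k : ℕ) < b then 1 else 0 :=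
    fun k => by split_ifs <;> rfl
  simp only [ones, this]
  rw [Finset.sum_boole, Fin.card_filter_val_lt]
  simpa using h

variable {N : ℕ}

theorem list_prod_leg_apply {R : Type*} [Ring R] {m : ℕ}
    (M : Fin m → Matrix (Fin 2) (Fin 2) R) (ks : List (Fin m)) (hk : ks.Nodup)
    (i j : Fin m → Fin 2) :
    (ks.map fun k => leg (d := fun _ : Fin m => Fin 2) k (M k)).prod i j =
      if ∀ p, p ∉ ks → i p = j p then (ks.map fun k => M k (i k) (j k)).prod else 0 := by
  induction ks generalizing i with
  | nil => simp [Matrix.one_apply, funext_iff]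
  | cons k ks ih =>
    rw [List.nodup_cons] at hk
    rw [List.map_cons, List.prod_cons, Matrix.mul_apply]
    simp only [leg_apply, ite_mul, zero_mul]
    refine Eq.trans (Finset.sum_congr rfl fun _ _ => by congr)
      ((sum_ite_agree_off (d := fun _ : Fin m => Fin 2) k i fun p => M k (i k) (p k) *
        (ks.map fun k => leg (d := fun _ : Fin m => Fin 2) k (M k)).prod p j).trans ?_)
    have h1 : ∀ x : Fin 2, (∀ p, p ∉ ks → Function.update i k x p = j p) ↔
        x = j k ∧ ∀ p, p ∉ k :: ks → i p = j p := by
      intro x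
      constructor
      · intro h
        refine ⟨by simpa using h k hk.1, fun p hp => ?_⟩
        rw [List.mem_cons, not_or] at hp
        simpa [hp.1] using h p hp.2
      · rintro ⟨rfl, h⟩ p hp
        by_cases hpk : p = k
        · subst hpk; simp
        · simp [hpk, h p (by simp [hpk, hp])]
    have h2 : ∀ x : Fin 2, (ks.map fun p => M p (Function.update i k x p) (j p)) =
        ks.map fun p => M p (i p) (j p) := by
      intro x
      refine List.map_congr_left fun p hp => ?_
      rw [Function.update_of_ne]
      rintro rfl
      exact hk.1 hp
    simp only [ih hk.2, h1, h2, Function.update_self, List.map_cons, List.prod_cons]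
    by_cases hc : ∀ p, p ∉ k :: ks → i p = j p
    · rw [if_pos hc, Finset.sum_eq_single (j k)]
      · rw [if_pos ⟨rfl, hc⟩]
      · intro x _ hx
        rw [if_neg fun h => hx h.1, mul_zero]
      · simp
    · rw [if_neg hc]
      refine Finset.sum_eq_zero fun x _ => ?_
      rw [if_neg fun h => hc h.2, mul_zero]

/-- A matrix element of the product of monodromies before symmetrization. -/
def wordElt {R : Type*} [Ring R] (η : ℂ) (M : ℂ → Matrix (Fin 2) (Fin 2) R) (w : ℂ) {m : ℕ}
    (i j : Fin m → Fin 2) : R :=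
  (List.ofFn fun k : Fin m => M (w - (k : ℕ) * η) (i k) (j k)).prod

theorem sum_wordElt_ones {R : Type*} [Ring R] [Algebra ℂ R] (η : ℂ)
    (M : ℂ → Matrix (Fin 2) (Fin 2) R) (w : ℂ) {m : ℕ} (j : Fin m → Fin 2) (b : ℕ) :
    (∑ i with ones i = b, wordElt η M w i j) = (colWord η M w (List.ofFn j).reverse).coeff b := by
  rw [← sum_rowWords, finsetSum_coeff, Finset.sum_filter]
  refine Finset.sum_congr rfl fun i _ => ?_
  rw [coeff_C_mul_X_pow]
  simp only [eq_comm (a := b)]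
  rfl

/-- Averaging over permutations is averaging over the orbit, which consists of all words with the
same number of ones. Counting pairs (permutation, word) twice avoids computing stabilizers. -/
theorem sum_perm_wordElt {R : Type*} [Ring R] [Algebra ℂ R] (η : ℂ)
    (M : ℂ → Matrix (Fin 2) (Fin 2) R) (w : ℂ) {m : ℕ} (i j : Fin m → Fin 2) :
    ((m.factorial : ℂ)⁻¹) • ∑ π : Equiv.Perm (Fin m), wordElt η M w (i ∘ π) j =
      (((Finset.univ.filter fun i' : Fin m → Fin 2 => ones i' = ones i).card : ℂ)⁻¹) •
        (colWord η M w (List.ofFn j).reverse).coeff (ones i) := by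
  set O := Finset.univ.filter fun i' : Fin m → Fin 2 => ones i' = ones i with hO
  have h1 : ∀ i' ∈ O, ∑ π : Equiv.Perm (Fin m), wordElt η M w (i' ∘ π) j =
      ∑ π : Equiv.Perm (Fin m), wordElt η M w (i ∘ π) j := by
    intro i' hi'
    obtain ⟨σ, rfl⟩ := exists_perm_of_ones_eq (Finset.mem_filter.mp hi').2.symm
    simp only [Function.comp_assoc, ← Equiv.Perm.coe_mul]
    exact Equiv.sum_comp (Equiv.mulLeft σ) fun π : Equiv.Perm (Fin m) => wordElt η M w (i ∘ π) j
  have h2 : ∀ π : Equiv.Perm (Fin m), ∑ i' ∈ O, wordElt η M w (i' ∘ π) j =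
      ∑ i' ∈ O, wordElt η M w i' j := by
    intro π
    refine Finset.sum_nbij' (fun i' => i' ∘ π) (fun i' => i' ∘ π.symm) ?_ ?_ ?_ ?_ ?_
    · intro i' hi'
      simpa [hO, ones_comp_perm] using hi'
    · intro i' hi'
      simpa [hO, ones_comp_perm] using hi'
    · intro i' _
      ext k; simp
    · intro i' _
      ext k; simp
    · intro i' _; rfl
  have h3 : O.card • ∑ π : Equiv.Perm (Fin m), wordElt η M w (i ∘ π) j =
      m.factorial • ∑ i' ∈ O, wordElt η M w i' j := by
    rw [← Finset.sum_const, ← Finset.sum_congr rfl h1, Finset.sum_comm,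
      Finset.sum_congr rfl fun π _ => h2 π, Finset.sum_const, Finset.card_univ,
      Fintype.card_perm, Fintype.card_fin]
  have hc : (O.card : ℂ) ≠ 0 := by
    rw [Nat.cast_ne_zero, ← Nat.pos_iff_ne_zero, Finset.card_pos]
    exact ⟨i, by simp [hO]⟩
  have hf : (m.factorial : ℂ) ≠ 0 := Nat.cast_ne_zero.mpr m.factorial_ne_zero
  rw [← sum_wordElt_ones, inv_smul_eq_iff₀ hf, smul_comm, eq_inv_smul_iff₀ hc]
  simpa only [Nat.cast_smul_eq_nsmul] using h3

theorem symProj_apply (l : Fin N → ℕ) (m : ℕ) (i j : Fin m → Fin 2) : symProj l m i j =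
    ((m.factorial : ℂ)⁻¹) • ∑ π : Equiv.Perm (Fin m), if i = j ∘ π then (1 : Op l) else 0 := by
  simp [symProj, Matrix.sum_apply, permOp]

theorem symProj_mul_apply (l : Fin N → ℕ) (m : ℕ)
    (Y : Matrix (Fin m → Fin 2) (Fin m → Fin 2) (Op l)) (i j : Fin m → Fin 2) :
    (symProj l m * Y) i j =
      ((m.factorial : ℂ)⁻¹) • ∑ π : Equiv.Perm (Fin m), Y (i ∘ π) j := by
  simp only [Matrix.mul_apply, symProj_apply, smul_mul_assoc, Finset.sum_mul, ite_mul, one_mul,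
    zero_mul]
  rw [← Finset.smul_sum, Finset.sum_comm]
  congr 1
  rw [← Equiv.sum_comp (Equiv.inv (Equiv.Perm (Fin m)))]
  refine Finset.sum_congr rfl fun π _ => ?_
  have h : ∀ k : Fin m → Fin 2, i = k ∘ (π⁻¹ : Equiv.Perm (Fin m)) ↔ k = i ∘ π := by
    intro k
    constructor
    · rintro rfl
      ext p; simp
    · rintro rfl
      ext p; simp
  simp only [Equiv.inv_apply, h, Finset.sum_ite_eq', Finset.mem_univ, if_true]

theorem mul_symProj_apply (l : Fin N → ℕ) (m : ℕ)
    (Y : Matrix (Fin m → Fin 2) (Fin m → Fin 2) (Op l)) (i j : Fin m → Fin 2) :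
    (Y * symProj l m) i j =
      ((m.factorial : ℂ)⁻¹) • ∑ π : Equiv.Perm (Fin m), Y i (j ∘ π) := by
  simp only [Matrix.mul_apply, symProj_apply, mul_smul_comm, Finset.mul_sum, mul_ite, mul_one,
    mul_zero]
  rw [← Finset.smul_sum, Finset.sum_comm]
  simp

/-- The left projector averages over rows, and `colWord_perm` gives symmetry in the columns, so
diagonal elements depend only on the number of ones. Summing over the words with b ones cancels the
reciprocal of their number. -/
theorem fusedTransfer_eq_fusedSum (l : Fin N → ℕ) (ξ : Fin N → ℂ) (η : ℂ)
    (K : Matrix (Fin 2) (Fin 2) ℂ) {q : ℂ → ℂ} (hq : HasQDet η (monodromy l ξ η K) q)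
    (m : ℕ) (u : ℂ) : fusedTransfer l ξ η K m u =
      fusedSum η (monodromy l ξ η K) (u + ((m : ℂ) - 1) * η) m := by
  set w := u + ((m : ℂ) - 1) * η with hw
  set Y := ((List.finRange m).map fun k => leg (d := fun _ : Fin m => Fin 2) k
        (monodromy l ξ η K (u + ((m : ℂ) - 1 - (k : ℕ)) * η))).prod with hY
  have hYapp : ∀ i j, Y i j = wordElt η (monodromy l ξ η K) w i j := by
    intro i j
    rw [hY, list_prod_leg_apply _ _ (List.nodup_finRange m), if_pos (by simp), wordElt,
      List.ofFn_eq_map]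
    congr 2
    ext1 k
    rw [hw]
    congr 2
    ring
  set g : ℕ → Op l := fun b => (((Finset.univ.filter
    fun i' : Fin m → Fin 2 => ones i' = b).card : ℂ)⁻¹) •
        (colWord η (monodromy l ξ η K) w (stdWord m b)).coeff b with hg
  -- The right projector only permutes the column word, which keeps the number of ones; hence it
  -- changes no diagonal element.
  have hcol : ∀ i j : Fin m → Fin 2, ones j = ones i →
      (symProj l m * Y) i j = g (ones i) := by
    intro i j hij
    rw [symProj_mul_apply]
    simp only [hYapp]
    rw [sum_perm_wordElt, colWord_perm hq w ((List.reverse_perm _).trans (ofFn_perm_stdWord j)),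
      hij]
  have hf : (m.factorial : ℂ) ≠ 0 := Nat.cast_ne_zero.mpr m.factorial_ne_zero
  have hdiag : ∀ i, fusedMonodromy l ξ η K m u i i = g (ones i) := by
    intro i
    rw [fusedMonodromy, mul_symProj_apply, Finset.sum_congr rfl fun (π : Equiv.Perm (Fin m)) _ =>
      hcol i (i ∘ π) (ones_comp_perm i π), Finset.sum_const, Finset.card_univ,
      Fintype.card_perm, Fintype.card_fin, ← Nat.cast_smul_eq_nsmul ℂ, smul_smul,
      inv_mul_cancel₀ hf, one_smul]
  rw [fusedTransfer, Matrix.trace, fusedSum]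
  simp only [Matrix.diag_apply, hdiag]
  rw [← Finset.sum_fiberwise_of_maps_to (s := Finset.univ) (t := Finset.range (m + 1))
    (g := ones) (fun i _ => Finset.mem_range.mpr (Nat.lt_succ_of_le (ones_le i)))]
  refine Finset.sum_congr rfl fun b hb => ?_
  rw [Finset.sum_congr rfl (g := fun _ => g b) fun i hi => by rw [(Finset.mem_filter.mp hi).2],
    Finset.sum_const, ← Nat.cast_smul_eq_nsmul ℂ, hg, smul_smul, mul_inv_cancel₀, one_smul]
  rw [Nat.cast_ne_zero, ← Nat.pos_iff_ne_zero, Finset.card_pos]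
  obtain ⟨i, hi⟩ := exists_ones_eq (Nat.lt_succ_iff.mp (Finset.mem_range.mp hb))
  exact ⟨i, by simp [hi]⟩

end SymTrace

/-! ### The separated basis -/

section DualBasis

variable {κ ι : Type*} [Fintype κ] [Fintype ι]

theorem eq_zero_of_forall_dotProduct {w : κ → ι → ℂ} (hw : Submodule.span ℂ (Set.range w) = ⊤)
    {v : ι → ℂ} (hv : ∀ h, w h ⬝ᵥ v = 0) : v = 0 := by
  classical
  have : ∀ x : ι → ℂ, x ⬝ᵥ v = 0 := by
    intro x
    have hx : x ∈ Submodule.span ℂ (Set.range w) := hw ▸ Submodule.mem_top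
    induction hx using Submodule.span_induction with
    | mem x hx => obtain ⟨h, rfl⟩ := hx; exact hv h
    | zero => simp
    | add x y _ _ hx hy => rw [add_dotProduct, hx, hy, add_zero]
    | smul c x _ hx => rw [smul_dotProduct, hx, smul_zero]
  ext i
  simpa using this (Pi.single i 1)

theorem exists_dotProduct_eq {w : κ → ι → ℂ} (hw : Submodule.span ℂ (Set.range w) = ⊤)
    (hcard : Fintype.card κ = Fintype.card ι) (f : κ → ℂ) : ∃ v, ∀ h, w h ⬝ᵥ v = f h := by
  let Φ : (ι → ℂ) →ₗ[ℂ] (κ → ℂ) := Matrix.mulVecLin (Matrix.of w)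
  have hΦ : ∀ v h, Φ v h = w h ⬝ᵥ v := fun v h => rfl
  have hinj : Function.Injective Φ := by
    rw [← LinearMap.ker_eq_bot, LinearMap.ker_eq_bot']
    intro v hv
    exact eq_zero_of_forall_dotProduct hw fun h => by rw [← hΦ, hv]; rfl
  have hsurj := (LinearMap.injective_iff_surjective_of_finrank_eq_finrank
    (by simp [hcard])).mp hinj
  obtain ⟨v, hv⟩ := hsurj f
  exact ⟨v, fun h => by rw [← hΦ, hv]⟩

theorem span_range_eq_top {w : κ → ι → ℂ} (hw : LinearIndependent ℂ w)
    (hcard : Fintype.card κ = Fintype.card ι) : Submodule.span ℂ (Set.range w) = ⊤ := by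
  classical
  exact hw.span_eq_top_of_card_eq_finrank' (by simp [hcard])

end DualBasis

/-! ### Sklyanin's covectors for a monodromy with a reference eigencovector of B. -/

section Separation

variable {σ ι : Type*} [Fintype σ] [DecidableEq σ] [Fintype ι] [DecidableEq ι]

/-- The family of covectors `W h` separates the variables of the commuting family `T`. -/
structure IsSeparated (l : σ → ℕ) (ζ : σ → ℕ → ℂ) (q : σ → ℕ → ℂ) (T : ℂ → Matrix ι ι ℂ)
    (W : (σ → ℕ) → ι → ℂ) : Prop where
  step : ∀ h : σ → ℕ, (∀ n, h n ≤ l n) → ∀ n, (T (ζ n (h n))).vecMul (W h) =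
    W (Function.update h n (h n + 1)) +
      if h n = 0 then 0 else q n (h n - 1) • W (Function.update h n (h n - 1))
  boundary : ∀ h : σ → ℕ, (∀ n, h n ≤ l n) → ∀ n, h n = l n →
    W (Function.update h n (h n + 1)) = 0
  indep : LinearIndependent ℂ fun h : ∀ n, Fin (l n + 1) => W fun n => h n

theorem update_induction {P : (σ → ℕ) → Prop} (h0 : P 0)
    (hs : ∀ h n, P h → P (Function.update h n (h n + 1))) (h : σ → ℕ) : P h := by
  induction hm : ∑ n, h n generalizing h with
  | zero =>
    have : h = 0 := by
      ext n
      exact Finset.sum_eq_zero_iff.mp hm n (Finset.mem_univ n)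
    rwa [this]
  | succ m ih =>
    obtain ⟨n, hn⟩ : ∃ n, h n ≠ 0 := by
      by_contra hc
      push Not at hc
      simp [hc] at hm
    obtain ⟨k, hk⟩ := Nat.exists_eq_succ_of_ne_zero hn
    have h1 : h = Function.update (Function.update h n k) n
        (Function.update h n k n + 1) := by
      rw [Function.update_self, Function.update_idem, ← Nat.succ_eq_add_one, ← hk,
        Function.update_eq_self]
    rw [h1]
    refine hs _ n (ih _ ?_)
    have h2 := Finset.sum_update_of_mem (Finset.mem_univ n) h k
    have h3 := Finset.add_sum_erase Finset.univ h (Finset.mem_univ n)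
    rw [Finset.sdiff_singleton_eq_erase] at h2
    omega

/-- With A = `M _ 0 0`, B = `M _ 0 1`, D = `M _ 1 1`, the covector `W h` is `ω` multiplied by A at
the first h_n nodes of each string. The exchange relations shift the eigenvalue of B, and the
quantum determinant makes D undo a step of A. The disjoint strings separate the eigenvalues of B,
which yields independence and also the truncation. -/
theorem exists_isSeparated {l : σ → ℕ} {ζ : σ → ℕ → ℂ} {η : ℂ} (hη : η ≠ 0)
    (hζ : ∀ n k, ζ n (k + 1) = ζ n k - η)
    (hdisj : ∀ n m, n ≠ m → ∀ h ≤ l n, ∀ k ≤ l m, ζ n h ≠ ζ m k)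
    {M : ℂ → Matrix (Fin 2) (Fin 2) (Matrix ι ι ℂ)} {Q : ℂ → ℂ} (hM : RTT η M)
    (hQ : HasQDet η M Q) (hcont : Continuous fun u => M u 0 1)
    (hQ0 : ∀ n, ∀ k < l n, Q (ζ n k) ≠ 0)
    {ω : ι → ℂ} (hω : ω ≠ 0) (hB : ∀ u, (M u 0 1).vecMul ω = (∏ n, (u - ζ n 0)) • ω)
    (hD : ∀ n, (M (ζ n 0) 1 1).vecMul ω = 0) (hcard : Fintype.card ι = ∏ n, (l n + 1)) :
    ∃ W, IsSeparated l ζ (fun n k => Q (ζ n k)) (fun u => (M u).trace) W := by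
  have hAA : ∀ u v, Commute (M u 0 0) (M v 0 0) := by
    intro u v
    have h1 := hM u v 0 0 0 0
    have h2 := hM v u 0 0 0 0
    -- Either relation alone gives only (u - v + η)[A(u), A(v)] = 0. Their difference carries the
    -- factor 2η, which never vanishes.
    have h3 : (2 * η) • (M u 0 0 * M v 0 0) = (2 * η) • (M v 0 0 * M u 0 0) := by
      have h4 := congrArg₂ (· - ·) h1 h2
      rw [← sub_eq_zero] at h4 ⊢
      rw [← h4]
      module
    exact smul_right_injective _ (mul_ne_zero two_ne_zero hη) h3
  let F : σ → ℕ → Matrix ι ι ℂ := fun n j => ((List.range j).map fun k => M (ζ n k) 0 0).prod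
  have hFs : ∀ n j, F n (j + 1) = F n j * M (ζ n j) 0 0 := fun n j => List.prod_range_succ _ _
  have hF : ∀ n m j k, Commute (F n j) (F m k) := by
    intro n m j k
    refine Commute.list_prod_left _ _ fun x hx => Commute.list_prod_right _ _ fun y hy => ?_
    obtain ⟨a, _, rfl⟩ := List.mem_map.mp hx
    obtain ⟨b, _, rfl⟩ := List.mem_map.mp hy
    exact hAA _ _
  have hcm : ∀ h : σ → ℕ, (↑(Finset.univ : Finset σ) : Set σ).Pairwise
      (Function.onFun Commute fun n => F n (h n)) := fun h n _ m _ _ => hF n m _ _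
  let W : (σ → ℕ) → ι → ℂ := fun h =>
    (Finset.univ.noncommProd (fun n => F n (h n)) (hcm h)).vecMul ω
  have hW0 : W 0 = ω := by
    have : Finset.univ.noncommProd (fun n => F n ((0 : σ → ℕ) n)) (hcm 0) = 1 := by
      refine (Finset.noncommProd_eq_pow_card _ _ _ 1 fun n _ => ?_).trans (one_pow _)
      simp [F]
    simp only [W, this, Matrix.vecMul_one]
  have hWs : ∀ h n, W (Function.update h n (h n + 1)) = (M (ζ n (h n)) 0 0).vecMul (W h) := by
    intro h n
    simp only [W]
    rw [← Finset.noncommProd_erase_mul Finset.univ (Finset.mem_univ n) (fun n => F n (h n)),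
      ← Finset.noncommProd_erase_mul Finset.univ (Finset.mem_univ n)
        (fun m => F m (Function.update h n (h n + 1) m)), Matrix.vecMul_vecMul, mul_assoc]
    simp only [Function.update_self]
    rw [hFs]
    congr 2
    refine Finset.noncommProd_congr rfl (fun m hm => ?_) _
    rw [Function.update_of_ne (Finset.ne_of_mem_erase hm)]
  clear_value W
  have hWB : ∀ h u, (M u 0 1).vecMul (W h) = (∏ n, (u - ζ n (h n))) • W h := by
    intro h
    induction h using update_induction with
    | h0 => intro u; rw [hW0]; exact hB u
    | hs h n ih =>
      rw [hWs]
      set w := ζ n (h n) with hw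
      set b : ℂ → ℂ := fun u => ∏ m, (u - ζ m (Function.update h n (h n + 1) m)) with hb
      have hBw : (M w 0 1).vecMul (W h) = 0 := by
        rw [ih w, Finset.prod_eq_zero (Finset.mem_univ n) (sub_self _), zero_smul]
      have hbh : ∀ u, (u - w) * b u = (u - w + η) * ∏ m, (u - ζ m (h m)) := by
        intro u
        simp only [hb]
        rw [← Finset.mul_prod_erase _ _ (Finset.mem_univ n),
          ← Finset.mul_prod_erase (a := n) _ (fun m => u - ζ m (h m)) (Finset.mem_univ n),
          Function.update_self, hζ, Finset.prod_congr rfl (g := fun m => u - ζ m (h m))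
            fun m hm => by rw [Function.update_of_ne (Finset.ne_of_mem_erase hm)]]
        ring
      -- In (u - w + η) B(u)A(w) = (u - w) A(w)B(u) + η B(w)A(u), the last term dies on `W h`
      -- because w is a zero of its B-eigenvalue. Division by u - w excludes u = w, which is
      -- recovered by continuity.
      have hne : ∀ u, u ≠ w → (M u 0 1).vecMul ((M w 0 0).vecMul (W h)) =
          b u • (M w 0 0).vecMul (W h) := by
        intro u hu
        have h1 := congrArg (fun Y => Y.vecMul (W h)) (hM u w 0 1 0 0)
        simp only [Matrix.vecMul_add, Matrix.vecMul_smul, ← Matrix.vecMul_vecMul, hBw, ih u,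
          Matrix.zero_vecMul, Matrix.smul_vecMul, smul_zero, add_zero] at h1
        rw [← add_smul, ← sub_eq_zero] at h1
        refine smul_right_injective _ (sub_ne_zero.mpr hu) ?_
        simp only
        rw [smul_smul, hbh, mul_smul, ← sub_eq_zero, ← neg_eq_zero, ← h1]
        module
      have hc1 : Continuous fun u => (M u 0 1).vecMul ((M w 0 0).vecMul (W h)) :=
        continuous_const.matrix_vecMul hcont
      have hc2 : Continuous fun u => b u • (M w 0 0).vecMul (W h) := by
        have hbc : Continuous b := continuous_finsetProd _ fun m _ => by fun_prop
        fun_prop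
      have := Continuous.ext_on (dense_compl_singleton w) hc1 hc2 fun u hu => hne u hu
      exact fun u => congrFun this u
  have hWB0 : ∀ h n, (M (ζ n (h n)) 0 1).vecMul (W h) = 0 := fun h n => by
    rw [hWB, Finset.prod_eq_zero (Finset.mem_univ n) (sub_self _), zero_smul]
  -- The quantum determinant is A(w)D(w - η) - B(w)C(w - η), and the B term vanishes on `W h` at w =
  -- ζ n (h n).
  have hlow : ∀ h n, (M (ζ n (h n + 1)) 1 1).vecMul (W (Function.update h n (h n + 1))) =
      Q (ζ n (h n)) • W h := by
    intro h n
    have h1 := congrArg (fun Y => Y.vecMul (W h)) (hQ (ζ n (h n)) 0 0 1 1)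
    simp only [Matrix.vecMul_sub, Matrix.vecMul_smul, ← Matrix.vecMul_vecMul, hWB0,
      Matrix.zero_vecMul, sub_zero, Matrix.vecMul_one] at h1
    rw [hWs, hζ, h1]
    simp [eps]
  -- D at the top node of the string n is moved past each A of another string. Both B terms of the
  -- exchange relation vanish on `W h`, and the remaining coefficient is nonzero because the strings
  -- are disjoint.
  have hD0 : ∀ h : σ → ℕ, (∀ n, h n ≤ l n) → ∀ n, h n = 0 →
      (M (ζ n 0) 1 1).vecMul (W h) = 0 := by
    intro h
    induction h using update_induction with
    | h0 => intro _ n _; rw [hW0]; exact hD n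
    | hs h m ih =>
      intro hl n hn
      have hmn : m ≠ n := by
        rintro rfl
        simp at hn
      have hle : ∀ p, h p ≤ l p := by
        intro p
        refine le_trans ?_ (hl p)
        by_cases hp : p = m
        · subst hp; simp
        · simp [hp]
      have hn' : h n = 0 := by rwa [Function.update_of_ne hmn.symm] at hn
      have h0 := ih hle n hn'
      have hv := hWB0 h n
      rw [hn'] at hv
      have h1 := congrArg (fun Y => Y.vecMul (W h)) (hM (ζ n 0) (ζ m (h m)) 1 1 0 0)
      simp only [Matrix.vecMul_add, Matrix.vecMul_smul, ← Matrix.vecMul_vecMul, hWB0 h m, hv, h0,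
        Matrix.zero_vecMul, smul_zero, add_zero] at h1
      rw [hWs]
      exact (smul_eq_zero.mp h1.symm).resolve_left
        (sub_ne_zero.mpr (hdisj n m hmn.symm 0 (Nat.zero_le _) _ (hle m)))
  -- Lowering recovers `W h` from its successor up to a nonzero quantum determinant, so the
  -- successor cannot vanish inside the string.
  have hWne : ∀ h : σ → ℕ, (∀ n, h n ≤ l n) → W h ≠ 0 := by
    intro h
    induction h using update_induction with
    | h0 => intro _; rwa [hW0]
    | hs h n ih =>
      intro hl h0
      have hle : ∀ p, h p ≤ l p := by
        intro p
        refine le_trans ?_ (hl p)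
        by_cases hp : p = n
        · subst hp; simp
        · simp [hp]
      have h1 := hlow h n
      rw [h0, Matrix.zero_vecMul] at h1
      have hlt : h n < l n := by
        have := hl n
        rw [Function.update_self] at this
        omega
      exact ih hle ((smul_eq_zero.mp h1.symm).resolve_left (hQ0 n _ hlt))
  have hζk : ∀ n k, ζ n k = ζ n 0 - k * η := by
    intro n k
    induction k with
    | zero => simp
    | succ k ih => rw [hζ, ih]; push_cast; ring
  have hζinj : ∀ n j k, ζ n j = ζ n k → j = k := by
    intro n j k h
    rw [hζk n j, hζk n k] at h
    have h2 : ((j : ℂ) - k) * η = 0 := by linear_combination -h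
    have h3 := (mul_eq_zero.mp h2).resolve_right hη
    exact_mod_cast sub_eq_zero.mp h3
  have hindep : LinearIndependent ℂ fun h : ∀ n, Fin (l n + 1) => W fun n => h n := by
    let p : (∀ n, Fin (l n + 1)) → ℂ[X] := fun h => ∏ n, (X - C (ζ n (h n)))
    have hp : ∀ h h', h ≠ h' → p h - p h' ≠ 0 := by
      intro h h' hne h0
      obtain ⟨n, hn⟩ := Function.ne_iff.mp hne
      have h1 := congrArg (eval (ζ n (h n))) h0
      simp only [p, eval_sub, eval_prod, eval_X, eval_C, eval_zero] at h1
      rw [Finset.prod_eq_zero (Finset.mem_univ n) (sub_self _), zero_sub, neg_eq_zero,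
        Finset.prod_eq_zero_iff] at h1
      obtain ⟨m, _, hm⟩ := h1
      rw [sub_eq_zero] at hm
      by_cases hmn : n = m
      · subst hmn
        exact hn (Fin.ext (hζinj _ _ _ hm))
      · exact hdisj n m hmn _ (by omega) _ (by omega) hm
    have hprod : (∏ x : (∀ n, Fin (l n + 1)) × (∀ n, Fin (l n + 1)),
        if x.1 = x.2 then 1 else p x.1 - p x.2) ≠ 0 := by
      refine Finset.prod_ne_zero_iff.mpr fun x _ => ?_
      split_ifs with hx
      · exact one_ne_zero
      · exact hp _ _ hx
    -- The B-eigenvalues are pairwise distinct polynomials, so a single point u separates all of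
    -- them.
    obtain ⟨u, hu⟩ : ∃ u, eval u (∏ x : (∀ n, Fin (l n + 1)) × (∀ n, Fin (l n + 1)),
        if x.1 = x.2 then 1 else p x.1 - p x.2) ≠ 0 := by
      by_contra hc
      push Not at hc
      exact hprod (Polynomial.funext fun u => by rw [hc u, eval_zero])
    rw [eval_prod, Finset.prod_ne_zero_iff] at hu
    refine Module.End.eigenvectors_linearIndependent' (M u 0 1).vecMulLinear
      (fun h => eval u (p h)) ?_ _ ?_
    · intro h h' heq
      by_contra hne
      have := hu (h, h') (Finset.mem_univ _)
      rw [if_neg hne, eval_sub] at this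
      exact this (sub_eq_zero.mpr heq)
    · intro h
      refine ⟨Module.End.mem_eigenspace_iff.mpr ?_, hWne _ fun n => by omega⟩
      simp only [Matrix.vecMulLinear_apply, hWB, p, eval_prod, eval_sub, eval_X, eval_C]
  have hspan := span_range_eq_top hindep (by simp [hcard])
  refine ⟨W, ⟨?_, ?_, hindep⟩⟩
  · intro h hl n
    rw [Matrix.trace, Fin.sum_univ_two, Matrix.vecMul_add, hWs]
    congr 1
    simp only [Matrix.diag_apply]
    split_ifs with hn
    · rw [hn]; exact hD0 h hl n hn
    · obtain ⟨k, hk⟩ := Nat.exists_eq_succ_of_ne_zero hn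
      have h1 := hlow (Function.update h n k) n
      rw [Function.update_self, Function.update_idem, ← Nat.succ_eq_add_one, ← hk,
        Function.update_eq_self] at h1
      rw [h1, hk]
      simp
  · intro h hl n hn
    set V := W (Function.update h n (h n + 1)) with hV
    obtain ⟨c, hc⟩ := (Submodule.mem_span_range_iff_exists_fun ℂ).mp
      (hspan ▸ Submodule.mem_top : V ∈ _)
    rw [← hc]
    refine Finset.sum_eq_zero fun h' _ => ?_
    rw [smul_eq_zero]
    left
    -- The coefficient of V along `h'` is its pairing with the dual vector v, which is killed by B
    -- at ζ n (h' n). The B-eigenvalue of V there is nonzero: its n-th zero lies just beyond the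
    -- string, and its other zeros lie on other strings.
    obtain ⟨v, hv⟩ := exists_dotProduct_eq hspan (by simp [hcard])
      (fun x => if x = h' then (1 : ℂ) else 0)
    have hVv : V ⬝ᵥ v = c h' := by
      rw [← hc, sum_dotProduct]
      simp [hv]
    set u := ζ n (h' n) with hu
    have hBv : (M u 0 1).mulVec v = 0 := by
      refine eq_zero_of_forall_dotProduct hspan fun x => ?_
      rw [Matrix.dotProduct_mulVec, hWB, smul_dotProduct, hv]
      split_ifs with hx
      · subst hx
        rw [Finset.prod_eq_zero (Finset.mem_univ n) (sub_self _), zero_smul]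
      · simp
    have h1 : (∏ m, (u - ζ m (Function.update h n (h n + 1) m))) * (V ⬝ᵥ v) = 0 := by
      rw [← smul_eq_mul, ← smul_dotProduct, ← hWB, ← Matrix.dotProduct_mulVec, hBv,
        dotProduct_zero]
    rw [← hVv]
    refine (mul_eq_zero.mp h1).resolve_left (Finset.prod_ne_zero_iff.mpr fun m _ => ?_)
    rw [sub_ne_zero]
    by_cases hm : m = n
    · subst hm
      rw [Function.update_self]
      intro he
      have := hζinj _ _ _ he
      have := (h' m).isLt
      omega
    · rw [Function.update_of_ne hm]
      exact hdisj n m (Ne.symm hm) _ (by omega) _ (hl m)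

end Separation

/-! ### Polynomial functions with prescribed top coefficient and their interpolation. -/

section LeadingTerm

/-- `f` is a polynomial function of degree at most `n` with `n`-th coefficient `c`. -/
def LeadPoly (n : ℕ) (c : ℂ) (f : ℂ → ℂ) : Prop :=
  ∃ p : ℂ[X], p.degree < n ∧ ∀ u, f u = c * u ^ n + p.eval u

theorem LeadPoly.add {n : ℕ} {c d : ℂ} {f g : ℂ → ℂ} (hf : LeadPoly n c f)
    (hg : LeadPoly n d g) : LeadPoly n (c + d) fun u => f u + g u := by
  obtain ⟨p, hp, hfp⟩ := hf
  obtain ⟨q, hq, hgq⟩ := hg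
  refine ⟨p + q, (degree_add_le p q).trans_lt (max_lt hp hq), fun u => ?_⟩
  simp only [hfp, hgq, eval_add]
  ring

theorem LeadPoly.const_mul {n : ℕ} {c : ℂ} {f : ℂ → ℂ} (hf : LeadPoly n c f) (a : ℂ) :
    LeadPoly n (a * c) fun u => a * f u := by
  obtain ⟨p, hp, hfp⟩ := hf
  refine ⟨C a * p, ?_, fun u => ?_⟩
  · by_cases ha : a = 0
    · simpa [ha] using WithBot.bot_lt_coe n
    · rwa [degree_C_mul ha]
  · simp only [hfp, eval_mul, eval_C]
    ring

theorem LeadPoly.zero (n : ℕ) : LeadPoly n 0 fun _ => 0 :=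
  ⟨0, by simpa using WithBot.bot_lt_coe n, fun u => by simp⟩

theorem LeadPoly.sum {κ : Type*} {s : Finset κ} {n : ℕ} {c : κ → ℂ} {f : κ → ℂ → ℂ}
    (hf : ∀ k ∈ s, LeadPoly n (c k) (f k)) :
    LeadPoly n (∑ k ∈ s, c k) fun u => ∑ k ∈ s, f k u := by
  classical
  induction s using Finset.induction_on with
  | empty => simpa using LeadPoly.zero n
  | insert a s ha ih =>
    simp only [Finset.sum_insert ha]
    exact (hf a (Finset.mem_insert_self a s)).add
      (ih fun k hk => hf k (Finset.mem_insert_of_mem hk))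

theorem leadPoly_prod {κ : Type*} (s : Finset κ) (z : κ → ℂ) :
    LeadPoly s.card 1 fun u => ∏ k ∈ s, (u - z k) := by
  have hm : (∏ k ∈ s, (X - C (z k))).Monic := monic_prod_of_monic _ _ fun k _ => monic_X_sub_C _
  have hd : (∏ k ∈ s, (X - C (z k))).degree = (s.card : WithBot ℕ) := by
    rw [degree_prod]
    simp
  refine ⟨∏ k ∈ s, (X - C (z k)) - X ^ s.card, ?_, fun u => ?_⟩
  · rw [← hd]
    refine degree_sub_lt_left ?_ hm.ne_zero ?_
    · rw [hd, degree_X_pow]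
    · rw [hm.leadingCoeff, (monic_X_pow _).leadingCoeff]
  · simp [eval_prod]

theorem LeadPoly.of_lt {m n : ℕ} (h : m < n) {c : ℂ} {f : ℂ → ℂ} (hf : LeadPoly m c f) :
    LeadPoly n 0 f := by
  obtain ⟨p, hp, hfp⟩ := hf
  refine ⟨C c * X ^ m + p, ?_, fun u => ?_⟩
  · refine (degree_add_le _ _).trans_lt (max_lt ?_ ?_)
    · exact (degree_C_mul_X_pow_le m c).trans_lt (by exact_mod_cast h)
    · exact hp.trans (by exact_mod_cast h)
  · rw [hfp]; simp

theorem LeadPoly.eq_of_eq_nodes {σ : Type*} [Fintype σ] {c : ℂ} {f g : ℂ → ℂ}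
    (hf : LeadPoly (Fintype.card σ) c f) (hg : LeadPoly (Fintype.card σ) c g) (z : σ → ℂ)
    (hz : Function.Injective z) (h : ∀ n, f (z n) = g (z n)) : f = g := by
  obtain ⟨p, hp, hfp⟩ := hf
  obtain ⟨q, hq, hgq⟩ := hg
  have h0 : p - q = 0 := by
    refine eq_zero_of_degree_lt_of_eval_index_eq_zero (s := Finset.univ) hz.injOn ?_ ?_
    · exact (degree_sub_le p q).trans_lt (max_lt hp hq)
    · intro n _
      have := h n
      rw [hfp, hgq] at this
      rw [eval_sub]
      linear_combination this
  ext u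
  rw [hfp, hgq, sub_eq_zero.mp h0]

end LeadingTerm

/-! ### Reduction of a twist to the reference situation, and the separated eigenvalue problem. -/

section Separation

variable {σ ι : Type*} [Fintype σ] [DecidableEq σ] [Fintype ι] [DecidableEq ι]

/-- Separation of variables for the transfer matrix with a non-scalar twist `K`. -/
theorem exists_isSeparated_twist {l : σ → ℕ} {ζ : σ → ℕ → ℂ} {η : ℂ} (hη : η ≠ 0)
    (hζ : ∀ n k, ζ n (k + 1) = ζ n k - η)
    (hdisj : ∀ n m, n ≠ m → ∀ h ≤ l n, ∀ k ≤ l m, ζ n h ≠ ζ m k)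
    {L : ℂ → Matrix (Fin 2) (Fin 2) (Matrix ι ι ℂ)} {Q : ℂ → ℂ} (hL : RTT η L)
    (hQ : HasQDet η L Q) (hcont : ∀ i j, Continuous fun u => L u i j)
    (hQ0 : ∀ n, ∀ k < l n, Q (ζ n k) ≠ 0)
    (href : ∀ z : ℂ, ∃ ω : ι → ℂ, ω ≠ 0 ∧ ∀ u i, (-z • L u i 0 + L u i 1).vecMul ω =
      ((∏ n, (u - ζ n 0)) * (![-z, 1] : Fin 2 → ℂ) i) • ω)
    (hcard : Fintype.card ι = ∏ n, (l n + 1)) (K : Matrix (Fin 2) (Fin 2) ℂ) (hK : K.det ≠ 0)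
    (hKz : ∃ z : ℂ, K 1 0 * z ^ 2 + (K 0 0 - K 1 1) * z - K 0 1 ≠ 0) :
    ∃ W, IsSeparated l ζ (fun n k => K.det * Q (ζ n k))
      (fun u => (K.map (fun c => c • (1 : Matrix ι ι ℂ)) * L u).trace) W := by
  obtain ⟨z, hz⟩ := hKz
  obtain ⟨ω, hω, hωL⟩ := href z
  -- The columns of `G` are K e and e for e = (-z, 1). Its determinant is minus the expression in
  -- `hKz`, so `G` is invertible exactly when e is not an eigenvector of `K`. With P = G⁻¹K this
  -- gives P e = (1, 0).
  let G : Matrix (Fin 2) (Fin 2) ℂ := !![-z * K 0 0 + K 0 1, -z; -z * K 1 0 + K 1 1, 1]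
  have hG : IsUnit G.det := by
    rw [isUnit_iff_ne_zero, Matrix.det_fin_two_of]
    intro h
    exact hz (by linear_combination -h)
  let P : Matrix (Fin 2) (Fin 2) ℂ := G⁻¹ * K
  have hP : P.mulVec ![-z, 1] = ![1, 0] := by
    have h1 : K.mulVec ![-z, 1] = G.mulVec ![1, 0] := by
      ext i
      fin_cases i <;> simp [G, Matrix.mulVec, dotProduct, Fin.sum_univ_two] <;> ring
    rw [← Matrix.mulVec_mulVec, h1, Matrix.mulVec_mulVec, Matrix.nonsing_inv_mul _ hG,
      Matrix.one_mulVec]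
  have hGP : G * P = K := by rw [← Matrix.mul_assoc, Matrix.mul_nonsing_inv _ hG, Matrix.one_mul]
  let M : ℂ → Matrix (Fin 2) (Fin 2) (Matrix ι ι ℂ) := fun u =>
    P.map (fun c => c • (1 : Matrix ι ι ℂ)) * L u * G.map fun c => c • (1 : Matrix ι ι ℂ)
  have hMapp : ∀ u i j, M u i j = ∑ b, ∑ a, (P i a * G b j) • L u a b := by
    intro u i j
    simp only [M, Matrix.mul_apply, Matrix.map_apply, Finset.sum_mul, smul_mul_assoc, one_mul,
      mul_smul_comm, mul_one, Finset.smul_sum, smul_smul]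
    refine Finset.sum_congr rfl fun b _ => Finset.sum_congr rfl fun a _ => ?_
    rw [mul_comm]
  have hMR : RTT η M :=
    ((rtt_const η P).mul hL fun _ _ _ _ _ _ => commute_const P _ _ _).mul (rtt_const η G)
      fun _ _ _ _ _ _ => (commute_const G _ _ _).symm
  have hMQ : HasQDet η M fun u => K.det * Q u := by
    have h := ((hasQDet_const η P).mul hQ fun _ _ _ _ _ _ => commute_const P _ _ _).mul
      (hasQDet_const η G) fun _ _ _ _ _ _ => (commute_const G _ _ _).symm
    have hdet : ∀ u, P.det * Q u * G.det = K.det * Q u := by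
      intro u
      have h1 : K.det = G.det * P.det := by rw [← Matrix.det_mul, hGP]
      rw [h1]
      ring
    simpa only [hdet] using h
  -- The second column of M is P L e. On `ω` the operator L reproduces e, and P sends e to (1, 0): B
  -- gets the eigenvalue ∏(u - ζ n 0), and D kills `ω`.
  have hcol : ∀ u i, (M u i 1).vecMul ω =
      ((∏ n, (u - ζ n 0)) * (![1, 0] : Fin 2 → ℂ) i) • ω := by
    intro u i
    have h1 : M u i 1 = ∑ a, P i a • (-z • L u a 0 + L u a 1) := by
      rw [hMapp, Finset.sum_comm]
      refine Finset.sum_congr rfl fun a _ => ?_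
      simp only [Fin.sum_univ_two, G, Matrix.of_apply, Matrix.cons_val', Matrix.cons_val_zero,
        Matrix.cons_val_one, Matrix.cons_val_fin_one]
      module
    have h2 : (∑ a, P i a • (-z • L u a 0 + L u a 1)).vecMul ω =
        ∑ a, P i a • (-z • L u a 0 + L u a 1).vecMul ω := by
      rw [Fin.sum_univ_two, Fin.sum_univ_two, Matrix.vecMul_add, Matrix.vecMul_smul,
        Matrix.vecMul_smul]
    rw [h1, h2, ← hP]
    simp only [hωL, Matrix.mulVec, dotProduct, smul_smul, ← Finset.sum_smul]
    congr 1
    rw [Finset.mul_sum]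
    exact Finset.sum_congr rfl fun a _ => by ring
  -- `G` and `P` have scalar entries, so the trace is cyclic and tr(P L G) = tr(G P L).
  have htr : ∀ u, (M u).trace = (K.map (fun c => c • (1 : Matrix ι ι ℂ)) * L u).trace := by
    intro u
    have h1 : ∀ a b, K b a = ∑ i, P i a * G b i := by
      intro a b
      rw [← hGP, Matrix.mul_apply]
      exact Finset.sum_congr rfl fun i _ => mul_comm _ _
    simp only [Matrix.trace, Matrix.diag_apply, hMapp, Matrix.mul_apply, Matrix.map_apply,
      h1, Finset.sum_smul, Finset.sum_mul, smul_mul_assoc, one_mul]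
    rw [Finset.sum_comm]
    refine Finset.sum_congr rfl fun b _ => ?_
    rw [Finset.sum_comm]
  obtain ⟨W, hW⟩ := exists_isSeparated hη hζ hdisj hMR hMQ (by
      simp only [hMapp]
      fun_prop) (fun n k hk => mul_ne_zero hK (hQ0 n k hk)) hω
    (fun u => by rw [hcol]; simp) (fun n => by rw [hcol]; simp) hcard
  exact ⟨W, by simpa only [htr] using hW⟩

variable {l : σ → ℕ} {ζ : σ → ℕ → ℂ} {q : σ → ℕ → ℂ} {T : ℂ → Matrix ι ι ℂ}
  {W : (σ → ℕ) → ι → ℂ}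

/-- One step of the separated action, on vectors. -/
theorem IsSeparated.dot_step (hW : IsSeparated l ζ q T W) (h : σ → ℕ) (hl : ∀ n, h n ≤ l n)
    (n : σ) (v : ι → ℂ) : W h ⬝ᵥ (T (ζ n (h n))).mulVec v =
      W (Function.update h n (h n + 1)) ⬝ᵥ v +
        if h n = 0 then 0 else q n (h n - 1) * (W (Function.update h n (h n - 1)) ⬝ᵥ v) := by
  rw [Matrix.dotProduct_mulVec, hW.step h hl n, add_dotProduct]
  congr 1
  split_ifs
  · simp
  · rw [smul_dotProduct, smul_eq_mul]

/-- The separated action in one variable is the defining recursion of the continuant. The range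
includes `k = l n + 1`, one step past the string, where the quantization condition arises. -/
theorem IsSeparated.dot_update (hW : IsSeparated l ζ q T W) {t : ℂ → ℂ} {v : ι → ℂ}
    (hv : ∀ u, (T u).mulVec v = t u • v) (h : σ → ℕ) (hl : ∀ n, h n ≤ l n) (n : σ)
    (hn : h n = 0) (k : ℕ) (hk : k ≤ l n + 1) :
    W (Function.update h n k) ⬝ᵥ v = cont (fun i => t (ζ n i)) (q n) k * (W h ⬝ᵥ v) := by
  induction k using Nat.twoStepInduction with
  | zero => rw [← hn, Function.update_eq_self, hn, cont, one_mul]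
  | one =>
    have := hW.dot_step h hl n v
    rw [hv, hn, if_pos rfl, add_zero, dotProduct_smul, smul_eq_mul] at this
    rw [cont, this]
  | more k h1 h2 =>
    have hle : ∀ m, Function.update h n (k + 1) m ≤ l m := by
      intro m
      by_cases hm : m = n
      · subst hm; rw [Function.update_self]; omega
      · rw [Function.update_of_ne hm]; exact hl m
    have := hW.dot_step _ hle n v
    rw [hv, Function.update_self, Function.update_idem, Function.update_idem,
      if_neg (Nat.succ_ne_zero k), dotProduct_smul, smul_eq_mul, h2 (by omega),
      Nat.add_sub_cancel, h1 (by omega)] at this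
    rw [cont, smul_eq_mul]
    linear_combination -this

theorem IsSeparated.dot_eq (hW : IsSeparated l ζ q T W) {t : ℂ → ℂ} {v : ι → ℂ}
    (hv : ∀ u, (T u).mulVec v = t u • v) (h : σ → ℕ) (hl : ∀ n, h n ≤ l n) :
    W h ⬝ᵥ v = (∏ n, cont (fun i => t (ζ n i)) (q n) (h n)) * (W 0 ⬝ᵥ v) := by
  have key : ∀ s : Finset σ, W (fun n => if n ∈ s then h n else 0) ⬝ᵥ v =
      (∏ n ∈ s, cont (fun i => t (ζ n i)) (q n) (h n)) * (W 0 ⬝ᵥ v) := by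
    intro s
    induction s using Finset.induction_on with
    | empty =>
      have : (fun n => if n ∈ (∅ : Finset σ) then h n else 0) = 0 := by ext; simp
      rw [this, Finset.prod_empty, one_mul]
    | insert a s ha ih =>
      have h1 : (fun n => if n ∈ insert a s then h n else 0) =
          Function.update (fun n => if n ∈ s then h n else 0) a (h a) := by
        ext n
        by_cases hn : n = a
        · subst hn; simp
        · simp [hn]
      rw [h1, hW.dot_update hv _ _ a (by simp [ha]) (h a) ((hl a).trans (Nat.le_succ _)), ih,
        Finset.prod_insert ha, mul_assoc]
      intro n
      split_ifs
      · exact hl n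
      · exact Nat.zero_le _
  simpa using key Finset.univ

theorem IsSeparated.span (hW : IsSeparated l ζ q T W) (hcard : Fintype.card ι = ∏ n, (l n + 1)) :
    Submodule.span ℂ (Set.range fun h : ∀ n, Fin (l n + 1) => W fun n => h n) = ⊤ :=
  span_range_eq_top hW.indep (by simp [hcard])

theorem IsSeparated.dot_zero_ne (hW : IsSeparated l ζ q T W)
    (hcard : Fintype.card ι = ∏ n, (l n + 1)) {t : ℂ → ℂ} {v : ι → ℂ}
    (hv : ∀ u, (T u).mulVec v = t u • v) (hv0 : v ≠ 0) : W 0 ⬝ᵥ v ≠ 0 := by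
  intro h0
  refine hv0 (eq_zero_of_forall_dotProduct (hW.span hcard) fun h => ?_)
  rw [hW.dot_eq hv _ fun n => by omega, h0, mul_zero]

theorem IsSeparated.cont_eq_zero (hW : IsSeparated l ζ q T W)
    (hcard : Fintype.card ι = ∏ n, (l n + 1)) {t : ℂ → ℂ} {v : ι → ℂ}
    (hv : ∀ u, (T u).mulVec v = t u • v) (hv0 : v ≠ 0) (n : σ) :
    cont (fun i => t (ζ n i)) (q n) (l n + 1) = 0 := by
  have h1 := hW.dot_update hv 0 (fun _ => Nat.zero_le _) n rfl (l n + 1) le_rfl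
  have h2 := hW.boundary (Function.update 0 n (l n)) (fun m => by
    by_cases hm : m = n
    · subst hm; simp
    · simp [hm]) n (by simp)
  rw [Function.update_self, Function.update_idem] at h2
  rw [h2, zero_dotProduct] at h1
  exact (mul_eq_zero.mp h1.symm).resolve_right (hW.dot_zero_ne hcard hv hv0)

theorem IsSeparated.eigen_unique (hW : IsSeparated l ζ q T W)
    (hcard : Fintype.card ι = ∏ n, (l n + 1)) {t : ℂ → ℂ} {v w : ι → ℂ}
    (hv : ∀ u, (T u).mulVec v = t u • v) (hv0 : v ≠ 0) (hw : ∀ u, (T u).mulVec w = t u • w) :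
    ∃ c : ℂ, w = c • v := by
  refine ⟨(W 0 ⬝ᵥ w) / (W 0 ⬝ᵥ v), ?_⟩
  rw [← sub_eq_zero]
  refine eq_zero_of_forall_dotProduct (hW.span hcard) fun h => ?_
  have hne := hW.dot_zero_ne hcard hv hv0
  rw [dotProduct_sub, dotProduct_smul, hW.dot_eq hv (fun n => h n) fun n => by omega,
    hW.dot_eq hw (fun n => h n) fun n => by omega, smul_eq_mul]
  field_simp
  ring

/-- The vector is defined by the product form that an eigenvector must have. The recursion verifies
the eigenvalue equation at the nodes, with `h0` matching the boundary condition, and interpolation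
extends it to every argument. -/
theorem IsSeparated.exists_eigen (hW : IsSeparated l ζ q T W)
    (hcard : Fintype.card ι = ∏ n, (l n + 1))
    (hdisj : ∀ n m, n ≠ m → ∀ h ≤ l n, ∀ k ≤ l m, ζ n h ≠ ζ m k) {c : ℂ}
    (hT : ∀ i j, LeadPoly (Fintype.card σ) (if i = j then c else 0) fun u => T u i j)
    {t : ℂ → ℂ} (ht : LeadPoly (Fintype.card σ) c t)
    (h0 : ∀ n, cont (fun i => t (ζ n i)) (q n) (l n + 1) = 0) :
    ∃ v : ι → ℂ, v ≠ 0 ∧ ∀ u, (T u).mulVec v = t u • v := by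
  obtain ⟨v, hv⟩ := exists_dotProduct_eq (hW.span hcard) (by simp [hcard])
    fun h => ∏ n, cont (fun i => t (ζ n i)) (q n) (h n)
  have hφ : ∀ h : σ → ℕ, (∀ n, h n ≤ l n) →
      W h ⬝ᵥ v = ∏ n, cont (fun i => t (ζ n i)) (q n) (h n) := fun h hl =>
    hv fun n => ⟨h n, Nat.lt_succ_of_le (hl n)⟩
  have hφ' : ∀ h : σ → ℕ, (∀ n, h n ≤ l n) → ∀ n,
      W (Function.update h n (h n + 1)) ⬝ᵥ v =
        ∏ m, cont (fun i => t (ζ m i)) (q m) (Function.update h n (h n + 1) m) := by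
    intro h hl n
    by_cases hn : h n = l n
    · rw [hW.boundary h hl n hn, zero_dotProduct]
      symm
      refine Finset.prod_eq_zero (Finset.mem_univ n) ?_
      rw [Function.update_self, hn]
      exact h0 n
    · refine hφ _ fun m => ?_
      by_cases hm : m = n
      · subst hm
        rw [Function.update_self]
        have := hl m
        omega
      · rw [Function.update_of_ne hm]; exact hl m
  have hupd : ∀ (h : σ → ℕ) n k, (∏ m, cont (fun i => t (ζ m i)) (q m) (Function.update h n k m)) =
      cont (fun i => t (ζ n i)) (q n) k *
        ∏ m ∈ Finset.univ.erase n, cont (fun i => t (ζ m i)) (q m) (h m) := by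
    intro h n k
    rw [← Finset.mul_prod_erase _ _ (Finset.mem_univ n), Function.update_self]
    congr 1
    refine Finset.prod_congr rfl fun m hm => ?_
    rw [Function.update_of_ne (Finset.ne_of_mem_erase hm)]
  have hnode : ∀ h : σ → ℕ, (∀ n, h n ≤ l n) → ∀ n,
      W h ⬝ᵥ (T (ζ n (h n))).mulVec v = t (ζ n (h n)) * (W h ⬝ᵥ v) := by
    intro h hl n
    rw [hW.dot_step h hl n v, hφ' h hl n, hφ h hl, hupd]
    have h2 := hupd h n (h n)
    rw [Function.update_eq_self] at h2
    rw [h2]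
    split_ifs with hn
    · rw [hn]
      simp only [cont]
      ring
    · obtain ⟨k, hk⟩ := Nat.exists_eq_succ_of_ne_zero hn
      rw [hφ (Function.update h n (h n - 1)) fun m => ?_, hupd, hk]
      · simp only [Nat.succ_eq_add_one, Nat.add_sub_cancel, cont, smul_eq_mul]
        ring
      · by_cases hm : m = n
        · subst hm
          rw [Function.update_self]
          have := hl m
          omega
        · rw [Function.update_of_ne hm]; exact hl m
  -- For fixed h the nodes ζ n (h n), one per site, are distinct and as many as the degree bound.
  -- The two sides share the coefficient in that degree, so agreement at the nodes suffices.
  have hall : ∀ h : ∀ n, Fin (l n + 1), ∀ u,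
      W (fun n => h n) ⬝ᵥ (T u).mulVec v = t u * (W (fun n => h n) ⬝ᵥ v) := by
    intro h
    have hlead : LeadPoly (Fintype.card σ) (W (fun n => h n) ⬝ᵥ v * c)
        fun u => W (fun n => h n) ⬝ᵥ (T u).mulVec v := by
      have h1 := LeadPoly.sum (s := Finset.univ) fun i _ =>
        (LeadPoly.sum (s := Finset.univ) fun j _ =>
          (hT i j).const_mul (v j)).const_mul (W (fun n => h n) i)
      simp only [dotProduct, Matrix.mulVec]
      convert h1 using 1
      · rw [Finset.sum_mul]
        refine Finset.sum_congr rfl fun i _ => ?_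
        simp
        ring
      · ext u
        simp only [mul_comm]
    have hlead2 : LeadPoly (Fintype.card σ) (W (fun n => h n) ⬝ᵥ v * c)
        fun u => W (fun n => h n) ⬝ᵥ v * t u := ht.const_mul _
    have := hlead.eq_of_eq_nodes hlead2 (fun n => ζ n (h n)) (fun n m hnm => by
      by_contra hne
      exact hdisj n m hne _ (by omega) _ (by omega) hnm) fun n => by
        rw [hnode (fun n => h n) (fun n => by omega) n, mul_comm]
    intro u
    rw [mul_comm]
    exact congrFun this u
  refine ⟨v, ?_, fun u => ?_⟩
  · rintro rfl
    have := hφ 0 fun _ => Nat.zero_le _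
    simp [cont] at this
  · rw [← sub_eq_zero]
    refine eq_zero_of_forall_dotProduct (hW.span hcard) fun h => ?_
    rw [dotProduct_sub, hall, dotProduct_smul, smul_eq_mul, sub_self]

end Separation

/-! ### Continuants of operators on a common eigenvector. -/

section ContEigen

variable {ι : Type*} [Fintype ι] [DecidableEq ι]

theorem cont_mulVec {T : ℕ → Matrix ι ι ℂ} {q t : ℕ → ℂ} {v : ι → ℂ}
    (h : ∀ k, (T k).mulVec v = t k • v) (m : ℕ) :
    (cont T q m).mulVec v = cont t q m • v := by
  induction m using Nat.twoStepInduction with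
  | zero => simp [cont]
  | one => simp [cont, h]
  | more m h1 h2 =>
    simp only [cont]
    rw [Matrix.sub_mulVec, ← Matrix.mulVec_mulVec, h, Matrix.mulVec_smul, h2, Matrix.smul_mulVec,
      h1, sub_smul, smul_smul, smul_smul, smul_eq_mul, mul_comm (t (m + 1))]

end ContEigen

/-! ### The chain -/

section Chain

variable {N : ℕ}

/-- The embedding of the operators of the site `n`. -/
abbrev siteHom (l : Fin N → ℕ) (n : Fin N) :
    Matrix (Fin (l n + 1)) (Fin (l n + 1)) ℂ →ₐ[ℂ] Op l :=
  legHom (d := fun n => Fin (l n + 1)) n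

theorem lax_eq_map (l : Fin N → ℕ) (η : ℂ) (n : Fin N) (u : ℂ) :
    lax l η n u = (siteLax (l n) η u).map (siteHom l n) := by
  ext i j : 2
  rw [Matrix.map_apply, legHom_apply, siteLax_apply]
  fin_cases i <;> fin_cases j <;> simp [lax, siteGen]

/-- The ordered product of the Lax operators of the sites in a list. -/
def chain (l : Fin N → ℕ) (ξ : Fin N → ℂ) (η : ℂ) (ns : List (Fin N)) (u : ℂ) :
    Matrix (Fin 2) (Fin 2) (Op l) :=
  (ns.map fun n => lax l η n (u - ξ n)).prod

theorem chain_cons (l : Fin N → ℕ) (ξ : Fin N → ℂ) (η : ℂ) (n : Fin N) (ns : List (Fin N))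
    (u : ℂ) : chain l ξ η (n :: ns) u = lax l η n (u - ξ n) * chain l ξ η ns u := by
  simp [chain]

theorem commute_leg_chain (l : Fin N → ℕ) (ξ : Fin N → ℂ) (η : ℂ) {ns : List (Fin N)} {n : Fin N}
    (hn : n ∉ ns) (A : Matrix (Fin (l n + 1)) (Fin (l n + 1)) ℂ) (u : ℂ) (i j : Fin 2) :
    Commute (leg n A) (chain l ξ η ns u i j) := by
  induction ns generalizing i j with
  | nil =>
    simp only [chain, List.map_nil, List.prod_nil, Matrix.one_apply]
    split_ifs
    · exact Commute.one_right _
    · exact Commute.zero_right _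
  | cons m ns ih =>
    rw [List.mem_cons, not_or] at hn
    rw [chain_cons, Matrix.mul_apply]
    refine Commute.sum_right _ _ _ fun a _ => Commute.mul_right ?_ (ih hn.2 a j)
    rw [lax_eq_map, Matrix.map_apply, legHom_apply]
    exact commute_leg hn.1 _ _

theorem commute_lax_chain (l : Fin N → ℕ) (ξ : Fin N → ℂ) (η : ℂ) {ns : List (Fin N)} {n : Fin N}
    (hn : n ∉ ns) (u v : ℂ) (i j a b : Fin 2) :
    Commute (lax l η n u i j) (chain l ξ η ns v a b) := by
  rw [lax_eq_map, Matrix.map_apply, legHom_apply]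
  exact commute_leg_chain l ξ η hn _ _ _ _

theorem rtt_chain (l : Fin N → ℕ) (ξ : Fin N → ℂ) (η : ℂ) {ns : List (Fin N)} (hns : ns.Nodup) :
    RTT η (chain l ξ η ns) := by
  induction ns with
  | nil =>
    intro u v i j k m
    simp only [chain, List.map_nil, List.prod_nil, Matrix.one_apply]
    split_ifs <;> simp
  | cons n ns ih =>
    rw [List.nodup_cons] at hns
    have h1 : RTT η fun u => lax l η n (u - ξ n) := by
      simp only [lax_eq_map]
      exact ((rtt_siteLax (l n) η).map (siteHom l n)).shift (ξ n)
    have h2 := h1.mul (ih hns.2) fun u v i j k m => commute_lax_chain l ξ η hns.1 _ _ _ _ _ _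
    simpa only [← chain_cons] using h2

theorem hasQDet_chain (l : Fin N → ℕ) (ξ : Fin N → ℂ) (η : ℂ) {ns : List (Fin N)}
    (hns : ns.Nodup) : HasQDet η (chain l ξ η ns) fun u => (ns.map fun n =>
      (u - ξ n + η / 2 + (l n : ℂ) / 2 * η) * (u - ξ n - η / 2 - (l n : ℂ) / 2 * η)).prod := by
  induction ns with
  | nil =>
    have h := hasQDet_const (A := Op l) η 1
    simp only [Matrix.map_one (fun c : ℂ => c • (1 : Op l)) (zero_smul _ _) (one_smul _ _),
      Matrix.det_one] at h
    exact h
  | cons n ns ih =>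
    rw [List.nodup_cons] at hns
    have h1 : HasQDet η (fun u => lax l η n (u - ξ n)) fun u =>
        (u - ξ n + η / 2 + (l n : ℂ) / 2 * η) * (u - ξ n - η / 2 - (l n : ℂ) / 2 * η) := by
      simp only [lax_eq_map]
      exact ((hasQDet_siteLax (l n) η).map (siteHom l n)).shift (ξ n)
    have h2 := h1.mul (ih hns.2) fun u v i j k m => commute_lax_chain l ξ η hns.1 _ _ _ _ _ _
    simpa only [← chain_cons, List.map_cons, List.prod_cons] using h2

/-- One value of z serves every site: each Lax operator returns the same vector (-z, 1) times a
scalar, so the product of the coherent covectors works for the whole chain. Operators at distinct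
sites commute, which allows the induction on the list. -/
theorem exists_chain_reference (l : Fin N → ℕ) (ξ : Fin N → ℂ) (η z : ℂ) :
    ∃ ω : Conf l → ℂ, ω ≠ 0 ∧ ∀ ns : List (Fin N), ns.Nodup → ∀ u i,
      (-z • chain l ξ η ns u i 0 + chain l ξ η ns u i 1).vecMul ω =
        ((ns.map fun n => u - node l ξ η n 0).prod * (![-z, 1] : Fin 2 → ℂ) i) • ω := by
  choose w hw0 hw using fun n : Fin N => exists_site_reference (l n) η z
  refine ⟨prodVec w, prodVec_ne_zero w hw0, fun ns hns u => ?_⟩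
  induction ns with
  | nil =>
    intro i
    fin_cases i <;> simp [chain, Matrix.vecMul_neg, Matrix.vecMul_smul]
  | cons n ns ih =>
    intro i
    rw [List.nodup_cons] at hns
    have hsite : (-z • lax l η n (u - ξ n) i 0 + lax l η n (u - ξ n) i 1).vecMul (prodVec w) =
        ((u - node l ξ η n 0) * (![-z, 1] : Fin 2 → ℂ) i) • prodVec w := by
      have h1 : -z • lax l η n (u - ξ n) i 0 + lax l η n (u - ξ n) i 1 =
          leg n (-z • siteLax (l n) η (u - ξ n) i 0 + siteLax (l n) η (u - ξ n) i 1) := by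
        rw [leg_add, leg_smul, lax_eq_map]
        rfl
      rw [h1]
      refine prodVec_vecMul_leg n _ w _ ((hw n _ i).trans ?_)
      congr 2
      simp only [node]
      push_cast
      ring
    have h2 : -z • chain l ξ η (n :: ns) u i 0 + chain l ξ η (n :: ns) u i 1 =
        ∑ j, (-z • chain l ξ η ns u j 0 + chain l ξ η ns u j 1) * lax l η n (u - ξ n) i j := by
      rw [chain_cons, Matrix.mul_apply, Matrix.mul_apply, Finset.smul_sum,
        ← Finset.sum_add_distrib]
      refine Finset.sum_congr rfl fun j _ => ?_
      rw [(commute_lax_chain l ξ η hns.1 _ _ _ _ _ _).eq,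
        (commute_lax_chain l ξ η hns.1 _ _ _ _ _ _).eq, add_mul, smul_mul_assoc]
    rw [h2, Fin.sum_univ_two, Matrix.vecMul_add, ← Matrix.vecMul_vecMul, ← Matrix.vecMul_vecMul,
      ih hns.2, ih hns.2, Matrix.smul_vecMul, Matrix.smul_vecMul, mul_smul, mul_smul, ← smul_add]
    have h3 : (![-z, 1] : Fin 2 → ℂ) 0 • (lax l η n (u - ξ n) i 0).vecMul (prodVec w) +
        (![-z, 1] : Fin 2 → ℂ) 1 • (lax l η n (u - ξ n) i 1).vecMul (prodVec w) =
        ((u - node l ξ η n 0) * (![-z, 1] : Fin 2 → ℂ) i) • prodVec w := by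
      rw [← hsite, Matrix.vecMul_add, Matrix.vecMul_smul]
      simp
    rw [h3, smul_smul]
    congr 1
    simp only [List.map_cons, List.prod_cons]
    ring

theorem chain_expansion (l : Fin N → ℕ) (ξ : Fin N → ℂ) (η : ℂ) (ns : List (Fin N)) :
    ∃ b : ℕ → Matrix (Fin 2) (Fin 2) (Op l), ∀ u, chain l ξ η ns u =
      u ^ ns.length • (1 : Matrix (Fin 2) (Fin 2) (Op l)) +
        ∑ k ∈ Finset.range ns.length, u ^ k • b k := by
  induction ns with
  | nil => exact ⟨0, fun u => by simp [chain]⟩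
  | cons n ns ih =>
    obtain ⟨b, hb⟩ := ih
    set e : Matrix (Fin 2) (Fin 2) (Op l) := (-ξ n) • 1 + η • (siteGen (l n)).map (siteHom l n)
      with he
    have hlax : ∀ u, lax l η n (u - ξ n) = u • 1 + e := by
      intro u
      rw [lax_eq_map]
      ext i j : 2
      rw [Matrix.map_apply, siteLax_apply, map_add, map_smul, map_smul, he]
      simp only [Matrix.add_apply, Matrix.smul_apply, Matrix.map_apply, Matrix.one_apply]
      split_ifs
      · rw [map_one]; module
      · rw [map_zero]; module
    refine ⟨fun k => (if k = 0 then 0 else b (k - 1)) +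
      e * (if k = ns.length then 1 else b k), fun u => ?_⟩
    rw [chain_cons, hlax, hb, List.length_cons]
    simp only [smul_add, Finset.sum_add_distrib]
    rw [Finset.sum_range_succ' (fun k => u ^ k • if k = 0 then 0 else b (k - 1)),
      Finset.sum_range_succ (fun k => u ^ k • (e * if k = ns.length then 1 else b k))]
    have hs : ∑ k ∈ Finset.range ns.length, u ^ k • (e * if k = ns.length then 1 else b k) =
        ∑ k ∈ Finset.range ns.length, u ^ k • (e * b k) :=
      Finset.sum_congr rfl fun k hk => by rw [if_neg (Finset.mem_range.mp hk).ne]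
    rw [hs]
    simp only [if_true, smul_zero, add_zero, Nat.succ_ne_zero, if_false, Nat.add_sub_cancel,
      mul_one]
    rw [add_mul, mul_add, mul_add, smul_mul_assoc, one_mul, smul_mul_assoc, one_mul,
      Finset.smul_sum, Finset.mul_sum]
    simp only [smul_smul, mul_smul_comm, mul_one, ← pow_succ']
    abel

theorem monodromy_eq (l : Fin N → ℕ) (ξ : Fin N → ℂ) (η : ℂ) (K : Matrix (Fin 2) (Fin 2) ℂ)
    (u : ℂ) : monodromy l ξ η K u =
      K.map (fun c => c • (1 : Op l)) * chain l ξ η (List.finRange N).reverse u := rfl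

theorem leadPoly_transfer (l : Fin N → ℕ) (ξ : Fin N → ℂ) (η : ℂ) (K : Matrix (Fin 2) (Fin 2) ℂ)
    (i j : Conf l) :
    LeadPoly N (if i = j then K.trace else 0) fun u => transfer l ξ η K u i j := by
  obtain ⟨b, hb⟩ := chain_expansion l ξ η (List.finRange N).reverse
  rw [List.length_reverse, List.length_finRange] at hb
  set K' := K.map fun c => c • (1 : Op l) with hK'
  refine ⟨∑ k ∈ Finset.range N, C ((K' * b k).trace i j) * X ^ k, ?_, fun u => ?_⟩
  · refine (degree_sum_le _ _).trans_lt ((Finset.sup_lt_iff (WithBot.bot_lt_coe N)).mpr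
      fun k hk => (degree_C_mul_X_pow_le _ _).trans_lt ?_)
    exact WithBot.coe_lt_coe.mpr (Finset.mem_range.mp hk)
  · have h1 : K'.trace i j = if i = j then K.trace else 0 := by
      simp only [hK', Matrix.trace, Matrix.diag_apply, Matrix.map_apply, Matrix.sum_apply,
        Matrix.smul_apply, Matrix.one_apply]
      split_ifs <;> simp
    rw [← h1]
    simp only [transfer, monodromy_eq, hb, mul_add, Matrix.trace_add, Matrix.mul_sum,
      Matrix.trace_sum, mul_smul_comm, Matrix.trace_smul, mul_one, Matrix.add_apply,
      Matrix.sum_apply, Matrix.smul_apply, eval_finsetSum, eval_mul, eval_C, eval_pow, eval_X,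
      smul_eq_mul, ← hK']
    congr 1
    · ring
    · exact Finset.sum_congr rfl fun k _ => mul_comm _ _

theorem continuous_chain_apply (l : Fin N → ℕ) (ξ : Fin N → ℂ) (η : ℂ) (ns : List (Fin N))
    (i j : Fin 2) : Continuous fun u => chain l ξ η ns u i j := by
  obtain ⟨b, hb⟩ := chain_expansion l ξ η ns
  simp only [hb, Matrix.add_apply, Matrix.sum_apply, Matrix.smul_apply]
  fun_prop

theorem node_succ (l : Fin N → ℕ) (ξ : Fin N → ℂ) (η : ℂ) (n : Fin N) (k : ℕ) :
    node l ξ η n (k + 1) = node l ξ η n k - η := by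
  simp only [node]
  push_cast
  ring

theorem node_eq (l : Fin N → ℕ) (ξ : Fin N → ℂ) (η : ℂ) (n : Fin N) (k : ℕ) :
    node l ξ η n k = node l ξ η n 0 - k * η := by
  simp only [node]
  push_cast
  ring

theorem aFun_eq (l : Fin N → ℕ) (ξ : Fin N → ℂ) (η u : ℂ) :
    aFun l ξ η u = ∏ n, (u - node l ξ η n (l n)) := by
  refine Finset.prod_congr rfl fun n _ => ?_
  simp only [node]
  ring

theorem dFun_eq (l : Fin N → ℕ) (ξ : Fin N → ℂ) (η u : ℂ) :
    dFun l ξ η u = ∏ n, (u - node l ξ η n 0) := by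
  refine Finset.prod_congr rfl fun n _ => ?_
  simp only [node]
  push_cast
  ring

theorem hasQDet_chain_univ (l : Fin N → ℕ) (ξ : Fin N → ℂ) (η : ℂ) :
    HasQDet η (chain l ξ η (List.finRange N).reverse)
      fun u => aFun l ξ η u * dFun l ξ η (u - η) := by
  have h := hasQDet_chain l ξ η (List.nodup_reverse.mpr (List.nodup_finRange N))
  convert h using 2 with u
  rw [List.map_reverse, List.prod_reverse, ← List.ofFn_eq_map, List.prod_ofFn, aFun, dFun,
    ← Finset.prod_mul_distrib]
  refine Finset.prod_congr rfl fun n _ => ?_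
  ring

theorem hasQDet_monodromy (l : Fin N → ℕ) (ξ : Fin N → ℂ) (η : ℂ)
    (K : Matrix (Fin 2) (Fin 2) ℂ) : HasQDet η (monodromy l ξ η K)
      fun u => K.det * (aFun l ξ η u * dFun l ξ η (u - η)) :=
  (hasQDet_const η K).mul (hasQDet_chain_univ l ξ η) fun _ _ _ _ _ _ => commute_const K _ _ _

/-- The off-diagonal weights of the separated equations. -/
def weight (l : Fin N → ℕ) (ξ : Fin N → ℂ) (η c : ℂ) (n : Fin N) (k : ℕ) : ℂ :=
  c * (aFun l ξ η (node l ξ η n k) * dFun l ξ η (node l ξ η n (k + 1)))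

/-- The fused arguments start at ξ_n^{(m-1)} + (m - 1)η = ξ_n^{(0)} and descend by η, so they run
through the string from its top. -/
theorem fusedTransfer_eq_cont (l : Fin N → ℕ) (ξ : Fin N → ℂ) (η : ℂ)
    (K : Matrix (Fin 2) (Fin 2) ℂ) (n : Fin N) (m : ℕ) (hm : 1 ≤ m) :
    fusedTransfer l ξ η K m (node l ξ η n (m - 1)) =
      cont (fun k => transfer l ξ η K (node l ξ η n k)) (weight l ξ η K.det n) m := by
  have h1 : node l ξ η n (m - 1) + ((m : ℂ) - 1) * η = node l ξ η n 0 := by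
    rw [node_eq, Nat.cast_sub hm, Nat.cast_one]
    ring
  rw [fusedTransfer_eq_fusedSum l ξ η K (hasQDet_monodromy l ξ η K), h1,
    fusedSum_eq_cont (hasQDet_monodromy l ξ η K)]
  simp only [← node_eq, ← node_succ]
  rfl

/-- If every (-z, 1) were an eigenvector, `K` would be scalar, contradicting distinct eigenvalues.
The values z = 0, 1, -1 already force this. -/
theorem exists_not_eigenvector {K : Matrix (Fin 2) (Fin 2) ℂ} {k₁ k₂ : ℂ}
    (htr : K.trace = k₁ + k₂) (hdet : K.det = k₁ * k₂) (hne : k₁ ≠ k₂) :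
    ∃ z : ℂ, K 1 0 * z ^ 2 + (K 0 0 - K 1 1) * z - K 0 1 ≠ 0 := by
  by_contra hc
  push Not at hc
  have h0 := hc 0
  have h1 := hc 1
  have h2 := hc (-1)
  rw [Matrix.trace_fin_two] at htr
  rw [Matrix.det_fin_two] at hdet
  have h01 : K 0 1 = 0 := by linear_combination -h0
  have h10 : K 1 0 = 0 := by linear_combination (h1 + h2) / 2 - h0
  have h00 : K 0 0 - K 1 1 = 0 := by linear_combination (h1 - h2) / 2
  have : (k₁ - k₂) ^ 2 = 0 := by
    rw [h01] at hdet
    linear_combination (-(K 0 0 + K 1 1) - k₁ - k₂) * htr + 4 * hdet + (K 0 0 - K 1 1) * h00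
  exact hne (sub_eq_zero.mp (pow_eq_zero_iff two_ne_zero |>.mp this))

theorem charpoly_trace_det {K : Matrix (Fin 2) (Fin 2) ℂ} {k₁ k₂ : ℂ}
    (hK : K.charpoly = (X - C k₁) * (X - C k₂)) : K.trace = k₁ + k₂ ∧ K.det = k₁ * k₂ := by
  rw [Matrix.charpoly_fin_two] at hK
  have h0 := congrArg (eval 0) hK
  have h1 := congrArg (eval 1) hK
  simp at h0 h1
  constructor
  · linear_combination h0 - h1
  · linear_combination h0

theorem exists_isSeparated_chain (l : Fin N → ℕ) (ξ : Fin N → ℂ) {η : ℂ} (hη : η ≠ 0)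
    {K : Matrix (Fin 2) (Fin 2) ℂ} {k₁ k₂ : ℂ} (htr : K.trace = k₁ + k₂)
    (hdet : K.det = k₁ * k₂) (hne : k₁ ≠ k₂) (hk : K.det ≠ 0) (hξ : StringsDisjoint l ξ η) :
    ∃ W, IsSeparated l (node l ξ η) (weight l ξ η K.det) (transfer l ξ η K) W := by
  have hnd : (List.finRange N).reverse.Nodup := List.nodup_reverse.mpr (List.nodup_finRange N)
  have h := exists_isSeparated_twist hη (node_succ l ξ η) hξ (rtt_chain l ξ η hnd)
    (hasQDet_chain_univ l ξ η) (continuous_chain_apply l ξ η _) ?_ ?_ (by simp) K hk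
    (exists_not_eigenvector htr hdet hne)
  · simp only [← node_succ] at h
    exact h
  · intro n k hk
    -- The factors of the site n itself are (l n - k)η and -(k + 1)η, nonzero for k < l n; those of
    -- the other sites are nonzero by disjointness.
    rw [← node_succ, aFun_eq, dFun_eq]
    refine mul_ne_zero (Finset.prod_ne_zero_iff.mpr fun m _ => ?_)
      (Finset.prod_ne_zero_iff.mpr fun m _ => ?_)
    · rw [sub_ne_zero]
      by_cases hm : n = m
      · subst hm
        rw [node_eq l ξ η n k, node_eq l ξ η n (l n)]
        intro he
        have h2 : ((l n : ℂ) - k) * η = 0 := by linear_combination he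
        have h3 := (mul_eq_zero.mp h2).resolve_right hη
        have h4 : l n = k := by exact_mod_cast sub_eq_zero.mp h3
        omega
      · exact hξ n m hm _ hk.le _ le_rfl
    · rw [sub_ne_zero]
      by_cases hm : n = m
      · subst hm
        rw [node_eq]
        intro he
        have h2 : ((k + 1 : ℕ) : ℂ) * η = 0 := by linear_combination -he
        exact (Nat.cast_ne_zero.mpr (Nat.succ_ne_zero k)) ((mul_eq_zero.mp h2).resolve_right hη)
      · exact hξ n m hm _ hk _ (Nat.zero_le _)
  · intro z
    obtain ⟨ω, hω, h⟩ := exists_chain_reference l ξ η z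
    refine ⟨ω, hω, fun u i => ?_⟩
    rw [h _ hnd, List.map_reverse, List.prod_reverse, ← List.ofFn_eq_map, List.prod_ofFn]

end Chain

/-! ### Determinants of tridiagonal matrices -/

section Tridiagonal

/-- The tridiagonal matrix with diagonal `t`, superdiagonal `a` and subdiagonal `b`, all indexed
by the row. -/
def tridiag (t a b : ℕ → ℂ) (m : ℕ) : Matrix (Fin m) (Fin m) ℂ :=
  Matrix.of fun i j =>
    if j = i then t i else if (j : ℕ) = i + 1 then a i else if (i : ℕ) = j + 1 then b i else 0

theorem tridiag_submatrix (t a b : ℕ → ℂ) (m : ℕ) :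
    (tridiag t a b (m + 1)).submatrix Fin.castSucc Fin.castSucc = tridiag t a b m := by
  ext i j
  simp [tridiag]

theorem det_tridiag_succ_succ (t a b : ℕ → ℂ) (m : ℕ) : (tridiag t a b (m + 2)).det =
    (tridiag t a b (m + 1)).det * t (m + 1) - a m * b (m + 1) * (tridiag t a b m).det := by
  rw [Matrix.det_succ_row _ (Fin.last (m + 1)), Fin.sum_univ_castSucc, Fin.sum_univ_castSucc,
    Finset.sum_eq_zero, zero_add]
  · have h1 : ((tridiag t a b (m + 2)).submatrix (Fin.last (m + 1)).succAbove
        (Fin.castSucc (Fin.last m)).succAbove).det = a m * (tridiag t a b m).det := by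
      rw [Matrix.det_succ_column _ (Fin.last m), Fin.sum_univ_castSucc, Finset.sum_eq_zero,
        zero_add]
      · have h2 : ((tridiag t a b (m + 2)).submatrix (Fin.last (m + 1)).succAbove
            (Fin.castSucc (Fin.last m)).succAbove).submatrix (Fin.last m).succAbove
            (Fin.last m).succAbove = tridiag t a b m := by
          ext i j
          have h3 : (Fin.castSucc (Fin.last m)).succAbove (Fin.castSucc j) =
              Fin.castSucc (Fin.castSucc j) := by
            rw [Fin.succAbove_of_castSucc_lt]
            simp [Fin.lt_def]
          simp [tridiag, h3]
        rw [h2, Matrix.submatrix_apply, Fin.succAbove_last,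
          Fin.succAbove_of_le_castSucc _ _ le_rfl]
        simp [tridiag, Fin.ext_iff, ← two_mul]
      · intro i _
        rw [Matrix.submatrix_apply, Fin.succAbove_last, Fin.succAbove_of_le_castSucc _ _ le_rfl]
        have h4 := i.isLt
        simp only [tridiag, Matrix.of_apply, Fin.ext_iff, Fin.val_castSucc, Fin.val_succ,
          Fin.val_last]
        rw [if_neg (by omega), if_neg (by omega), if_neg (by omega)]
        ring
    have e1 : tridiag t a b (m + 2) (Fin.last (m + 1)) (Fin.castSucc (Fin.last m)) = b (m + 1) := by
      simp only [tridiag, Matrix.of_apply, Fin.ext_iff, Fin.val_castSucc, Fin.val_last]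
      rw [if_neg (by omega), if_neg (by omega), if_pos trivial]
    have e2 : tridiag t a b (m + 2) (Fin.last (m + 1)) (Fin.last (m + 1)) = t (m + 1) := by
      simp [tridiag]
    have e3 : (-1 : ℂ) ^ (((Fin.last (m + 1) : Fin (m + 2)) : ℕ) +
        ((Fin.castSucc (Fin.last m) : Fin (m + 2)) : ℕ)) = -1 :=
      Odd.neg_one_pow ⟨m, by simp only [Fin.val_castSucc, Fin.val_last]; ring⟩
    have e4 : (-1 : ℂ) ^ (((Fin.last (m + 1) : Fin (m + 2)) : ℕ) +
        ((Fin.last (m + 1) : Fin (m + 2)) : ℕ)) = 1 := Even.neg_one_pow ⟨_, rfl⟩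
    rw [h1, e1, e2, e3, e4]
    simp only [Fin.succAbove_last, tridiag_submatrix]
    ring
  · intro j _
    have h4 := j.isLt
    simp only [tridiag, Matrix.of_apply, Fin.ext_iff, Fin.val_castSucc, Fin.val_last]
    rw [if_neg (by omega), if_neg (by omega), if_neg (by omega)]
    ring

theorem det_tridiag (t a b : ℕ → ℂ) (m : ℕ) :
    (tridiag t a b m).det = cont t (fun k => a k * b (k + 1)) m := by
  induction m using Nat.twoStepInduction with
  | zero => simp [cont]
  | one => simp [cont, tridiag]
  | more m h1 h2 =>
    rw [det_tridiag_succ_succ, h1, h2]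
    simp [cont]

end Tridiagonal

/-! ### The determinants as continuants, and the unknowns as interpolation data. -/

section SeparatedEquations

variable {N : ℕ}

theorem dMat_eq_tridiag (l : Fin N → ℕ) (ξ : Fin N → ℂ) (η k₁ k₂ : ℂ) (t : ℂ → ℂ) (n : Fin N) :
    dMat l ξ η k₁ k₂ t n = tridiag (fun i => t (node l ξ η n i))
      (fun i => -k₁ * aFun l ξ η (node l ξ η n i)) (fun i => -k₂ * dFun l ξ η (node l ξ η n i))
      (l n + 1) := rfl

theorem det_dMat (l : Fin N → ℕ) (ξ : Fin N → ℂ) (η k₁ k₂ : ℂ) (t : ℂ → ℂ) (n : Fin N) :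
    (dMat l ξ η k₁ k₂ t n).det =
      cont (fun i => t (node l ξ η n i)) (weight l ξ η (k₁ * k₂) n) (l n + 1) := by
  rw [dMat_eq_tridiag, det_tridiag]
  congr 1
  ext k
  simp only [weight]
  ring

theorem det_dMinor (l : Fin N → ℕ) (ξ : Fin N → ℂ) (η k₁ k₂ : ℂ) (t : ℂ → ℂ) (n : Fin N) :
    (dMinor l ξ η k₁ k₂ t n).det =
      cont (fun i => t (node l ξ η n i)) (weight l ξ η (k₁ * k₂) n) (l n) := by
  rw [dMinor, dMat_eq_tridiag, tridiag_submatrix, det_tridiag]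
  congr 1
  ext k
  simp only [weight]
  ring

theorem node_zero_injective {l : Fin N → ℕ} {ξ : Fin N → ℂ} {η : ℂ} (hξ : StringsDisjoint l ξ η) :
    Function.Injective fun n => node l ξ η n 0 := by
  intro n m h
  by_contra hne
  exact hξ n m hne 0 (Nat.zero_le _) 0 (Nat.zero_le _) h

theorem leadPoly_gFun (l : Fin N → ℕ) (ξ : Fin N → ℂ) (η : ℂ) (a : Fin N) :
    LeadPoly N 0 (gFun l ξ η a) := by
  have h := (leadPoly_prod (Finset.univ.erase a) fun b => node l ξ η b 0).const_mul
    (∏ b ∈ Finset.univ.erase a, (node l ξ η a 0 - node l ξ η b 0))⁻¹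
  have hlt : (Finset.univ.erase a).card < N := by
    rw [Finset.card_erase_of_mem (Finset.mem_univ a), Finset.card_univ, Fintype.card_fin]
    have := a.pos
    omega
  convert h.of_lt hlt using 1
  ext u
  rw [gFun, Finset.prod_div_distrib, div_eq_inv_mul]

theorem gFun_node {l : Fin N → ℕ} {ξ : Fin N → ℂ} {η : ℂ} (hξ : StringsDisjoint l ξ η)
    (a b : Fin N) : gFun l ξ η a (node l ξ η b 0) = if a = b then 1 else 0 := by
  split_ifs with h
  · subst h
    refine Finset.prod_eq_one fun c hc => div_self (sub_ne_zero.mpr ?_)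
    exact (node_zero_injective hξ).ne (Finset.ne_of_mem_erase hc).symm
  · refine Finset.prod_eq_zero (i := b) (Finset.mem_erase.mpr ⟨Ne.symm h, Finset.mem_univ b⟩) ?_
    rw [sub_self, zero_div]

theorem leadPoly_tFun (l : Fin N → ℕ) (ξ : Fin N → ℂ) (η : ℂ) (K : Matrix (Fin 2) (Fin 2) ℂ)
    (x : Fin N → ℂ) : LeadPoly N K.trace (tFun l ξ η K x) := by
  have h1 := (leadPoly_prod Finset.univ fun a => node l ξ η a 0).const_mul K.trace
  rw [Finset.card_univ, Fintype.card_fin] at h1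
  have h2 : LeadPoly N (∑ a, x a * 0) fun u => ∑ a, x a * gFun l ξ η a u :=
    LeadPoly.sum fun a _ => (leadPoly_gFun l ξ η a).const_mul (x a)
  have h3 := h1.add h2
  convert h3 using 1
  · simp
  · ext u
    simp only [tFun, mul_comm]

theorem tFun_node {l : Fin N → ℕ} {ξ : Fin N → ℂ} {η : ℂ} (hξ : StringsDisjoint l ξ η)
    (K : Matrix (Fin 2) (Fin 2) ℂ) (x : Fin N → ℂ) (b : Fin N) :
    tFun l ξ η K x (node l ξ η b 0) = x b := by
  rw [tFun, Finset.prod_eq_zero (Finset.mem_univ b) (sub_self _), mul_zero, zero_add]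
  simp [gFun_node hξ]

/-- Lagrange interpolation of the constant 1. The site `n` serves to ensure N > 0, without which the
sum is empty. -/
theorem sum_gFun {l : Fin N → ℕ} {ξ : Fin N → ℂ} {η : ℂ} (hξ : StringsDisjoint l ξ η)
    (n : Fin N) (u : ℂ) : ∑ a, gFun l ξ η a u = 1 := by
  have h1 : LeadPoly (Fintype.card (Fin N)) (∑ _a : Fin N, 0) fun u => ∑ a, gFun l ξ η a u :=
    LeadPoly.sum fun a _ => by
      rw [Fintype.card_fin]
      exact leadPoly_gFun l ξ η a
  have h2 : LeadPoly (Fintype.card (Fin N)) (∑ _a : Fin N, 0) fun _ => 1 := by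
    rw [Fintype.card_fin, Finset.sum_const_zero]
    refine LeadPoly.of_lt (m := 0) (c := 1) n.pos ⟨0, by simp, fun u => by simp⟩
  exact congrFun (h1.eq_of_eq_nodes h2 _ (node_zero_injective hξ) fun b => by
    simp [gFun_node hξ]) u

/-- The quantum spectral curve equations have degree `2 s_n + 1`. -/
theorem exists_mvPolynomial_det_dMat {l : Fin N → ℕ} {ξ : Fin N → ℂ} {η : ℂ}
    (hξ : StringsDisjoint l ξ η) (K : Matrix (Fin 2) (Fin 2) ℂ) (k₁ k₂ : ℂ) (n : Fin N) :
    ∃ Q : MvPolynomial (Fin N) ℂ, Q.totalDegree = l n + 1 ∧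
      ∀ x, MvPolynomial.eval x Q = (dMat l ξ η k₁ k₂ (tFun l ξ η K x) n).det := by
  let D0 := dMat l ξ η k₁ k₂ (tFun l ξ η K 0) n
  let E : Matrix (Fin (l n + 1)) (Fin (l n + 1)) (MvPolynomial (Fin N) ℂ) :=
    Matrix.of fun i j => MvPolynomial.C (D0 i j) + if j = i then
      ∑ a, MvPolynomial.C (gFun l ξ η a (node l ξ η n i)) * MvPolynomial.X a else 0
  have heval : ∀ x, MvPolynomial.eval x E.det = (dMat l ξ η k₁ k₂ (tFun l ξ η K x) n).det := by
    intro x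
    rw [RingHom.map_det]
    congr 1
    ext i j
    simp only [E, D0, RingHom.mapMatrix_apply, Matrix.map_apply, Matrix.of_apply, dMat, map_add,
      MvPolynomial.eval_C]
    by_cases hij : j = i
    · simp [hij, tFun]
    · simp [hij]
  refine ⟨E.det, le_antisymm ?_ ?_, heval⟩
  · have hE : ∀ i j, (E i j).totalDegree ≤ 1 := by
      intro i j
      refine (MvPolynomial.totalDegree_add _ _).trans (max_le ?_ ?_)
      · rw [MvPolynomial.totalDegree_C]; exact Nat.zero_le 1
      · split_ifs
        · refine (MvPolynomial.totalDegree_finsetSum _ _).trans (Finset.sup_le fun a _ => ?_)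
          refine (MvPolynomial.totalDegree_mul _ _).trans ?_
          rw [MvPolynomial.totalDegree_C, MvPolynomial.totalDegree_X]
        · simp
    rw [Matrix.det_apply]
    refine (MvPolynomial.totalDegree_finsetSum _ _).trans (Finset.sup_le fun π _ => ?_)
    refine (MvPolynomial.totalDegree_smul_le _ _).trans ?_
    refine (MvPolynomial.totalDegree_finsetProd _ _).trans ?_
    calc ∑ i, (E (π i) i).totalDegree ≤ ∑ _i : Fin (l n + 1), 1 :=
          Finset.sum_le_sum fun i _ => hE _ _
      _ = l n + 1 := by simp
  · let p : ℂ[X] := MvPolynomial.aeval (fun _ => (X : ℂ[X])) E.det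
    have hp : p = (-D0).charpoly := by
      refine Polynomial.funext fun s => ?_
      have h1 : eval s p = MvPolynomial.eval (fun _ => s) E.det := by
        simp only [p]
        rw [← Polynomial.coe_evalRingHom, MvPolynomial.aeval_def, MvPolynomial.hom_eval₂,
          MvPolynomial.eval, MvPolynomial.coe_eval₂Hom]
        congr 1
        · ext c; simp
        · ext; simp
      rw [h1, heval, Matrix.eval_charpoly]
      congr 1
      ext i j
      rw [Matrix.sub_apply, Matrix.neg_apply, sub_neg_eq_add, Matrix.scalar_apply,
        Matrix.diagonal_apply]
      simp only [D0, dMat, Matrix.of_apply]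
      by_cases hij : j = i
      · subst hij
        simp only [if_true, tFun, ← Finset.sum_mul, sum_gFun hξ n, Pi.zero_apply, mul_zero,
          Finset.sum_const_zero]
        ring
      · rw [if_neg hij, if_neg hij, if_neg (Ne.symm hij), zero_add]
    have h2 : p.natDegree ≤ E.det.totalDegree := by
      have := MvPolynomial.aeval_natDegree_le (n := 1) E.det le_rfl (fun _ => (X : ℂ[X]))
        fun _ => natDegree_X_le
      simpa using this
    rwa [hp, Matrix.charpoly_natDegree_eq_dim, Fintype.card_fin] at h2

end SeparatedEquations

/-! ### Spectrum and eigenvectors -/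

section Spectrum

variable {N : ℕ}

/-- A nonzero component of v expresses t as a linear combination of matrix elements of the transfer
matrix, so t inherits polynomiality and the leading coefficient. -/
theorem leadPoly_of_isEigen {l : Fin N → ℕ} {ξ : Fin N → ℂ} {η : ℂ}
    {K : Matrix (Fin 2) (Fin 2) ℂ} {t : ℂ → ℂ} {v : Conf l → ℂ} (hv0 : v ≠ 0)
    (hv : IsEigen l ξ η K t v) : LeadPoly N K.trace t := by
  obtain ⟨i, hi⟩ := Function.ne_iff.mp hv0
  have h1 := (LeadPoly.sum (s := Finset.univ) fun j _ =>
    (leadPoly_transfer l ξ η K i j).const_mul (v j)).const_mul (v i)⁻¹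
  convert h1 using 1
  · have hi' : v i ≠ 0 := hi
    simp only [mul_ite, mul_zero, Finset.sum_ite_eq, Finset.mem_univ, if_true]
    field_simp
  · ext u
    have h2 := congrFun (hv u) i
    simp only [Matrix.mulVec, dotProduct, Pi.smul_apply, smul_eq_mul] at h2
    rw [Finset.sum_congr rfl fun j _ => mul_comm (v j) _, h2]
    have hi' : v i ≠ 0 := hi
    field_simp

theorem transferSpectrum_eq (l : Fin N → ℕ) (ξ : Fin N → ℂ) {η : ℂ} (hη : η ≠ 0)
    {K : Matrix (Fin 2) (Fin 2) ℂ} {k₁ k₂ : ℂ} (htr : K.trace = k₁ + k₂)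
    (hdet : K.det = k₁ * k₂) (hne : k₁ ≠ k₂) (hk : K.det ≠ 0) (hξ : StringsDisjoint l ξ η) :
    transferSpectrum l ξ η K = tFun l ξ η K '' solutions l ξ η K k₁ k₂ := by
  obtain ⟨W, hW⟩ := exists_isSeparated_chain l ξ hη htr hdet hne hk hξ
  rw [hdet] at hW
  ext t
  constructor
  · rintro ⟨v, hv0, hv⟩
    have hlead : LeadPoly (Fintype.card (Fin N)) K.trace t := by
      rw [Fintype.card_fin]
      exact leadPoly_of_isEigen hv0 hv
    have ht : tFun l ξ η K (fun a => t (node l ξ η a 0)) = t := by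
      refine LeadPoly.eq_of_eq_nodes ?_ hlead _ (node_zero_injective hξ) fun n => tFun_node hξ K _ n
      rw [Fintype.card_fin]
      exact leadPoly_tFun l ξ η K _
    refine ⟨fun a => t (node l ξ η a 0), fun n => ?_, ht⟩
    rw [ht, det_dMat]
    exact hW.cont_eq_zero (by simp) hv hv0 n
  · rintro ⟨x, hx, rfl⟩
    refine hW.exists_eigen (c := K.trace) (by simp) hξ ?_ ?_ fun n => ?_
    · rw [Fintype.card_fin]
      exact leadPoly_transfer l ξ η K
    · rw [Fintype.card_fin]
      exact leadPoly_tFun l ξ η K x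
    · rw [← det_dMat]
      exact hx n

theorem list_prod_mulVec {ι κ : Type*} [Fintype ι] [DecidableEq ι] (ns : List κ)
    {X : κ → Matrix ι ι ℂ} {c : κ → ℂ} {v : ι → ℂ} (h : ∀ n, (X n).mulVec v = c n • v) :
    (ns.map X).prod.mulVec v = (ns.map c).prod • v := by
  induction ns with
  | nil => simp
  | cons n ns ih =>
    simp only [List.map_cons, List.prod_cons]
    rw [← Matrix.mulVec_mulVec, ih, Matrix.mulVec_smul, h, smul_smul, mul_comm]

theorem pow_mulVec {ι : Type*} [Fintype ι] [DecidableEq ι] {X : Matrix ι ι ℂ} {c : ℂ}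
    {v : ι → ℂ} (h : X.mulVec v = c • v) (k : ℕ) : (X ^ k).mulVec v = c ^ k • v := by
  induction k with
  | zero => simp
  | succ k ih =>
    rw [pow_succ, ← Matrix.mulVec_mulVec, h, Matrix.mulVec_smul, ih, smul_smul, pow_succ, mul_comm]

theorem fusedTransfer_mulVec {l : Fin N → ℕ} {ξ : Fin N → ℂ} {η : ℂ}
    {K : Matrix (Fin 2) (Fin 2) ℂ} {k₁ k₂ : ℂ} (hdet : K.det = k₁ * k₂) {t : ℂ → ℂ}
    {v : Conf l → ℂ} (hv : IsEigen l ξ η K t v) (n : Fin N) (hl : 1 ≤ l n) :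
    (fusedTransfer l ξ η K (l n) (node l ξ η n (l n - 1))).mulVec v =
      (dMinor l ξ η k₁ k₂ t n).det • v := by
  rw [fusedTransfer_eq_cont l ξ η K n (l n) hl, det_dMinor, ← hdet]
  exact cont_mulVec (fun k => hv _) _

/-- On an eigenvector each fused operator is the scalar det of the minor, both being the same
continuant. -/
theorem sovCovector_dotProduct {l : Fin N → ℕ} (hl : ∀ n, 1 ≤ l n) {ξ : Fin N → ℂ} {η : ℂ}
    {K : Matrix (Fin 2) (Fin 2) ℂ} {k₁ k₂ : ℂ} (hdet : K.det = k₁ * k₂) {t : ℂ → ℂ}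
    {v : Conf l → ℂ} (hv : IsEigen l ξ η K t v) (S : Conf l → ℂ) (h : Conf l) :
    dotProduct (sovCovector l ξ η K S h) v =
      (∏ n, (dMinor l ξ η k₁ k₂ t n).det ^ (h n : ℕ)) * dotProduct S v := by
  rw [sovCovector, ← Matrix.dotProduct_mulVec, list_prod_mulVec _ fun n =>
    pow_mulVec (fusedTransfer_mulVec hdet hv n (hl n)) (h n), dotProduct_smul,
    ← List.ofFn_eq_map, List.prod_ofFn, smul_eq_mul]

theorem IsEigen.smul {l : Fin N → ℕ} {ξ : Fin N → ℂ} {η : ℂ} {K : Matrix (Fin 2) (Fin 2) ℂ}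
    {t : ℂ → ℂ} {v : Conf l → ℂ} (hv : IsEigen l ξ η K t v) (c : ℂ) :
    IsEigen l ξ η K t (c • v) := fun u => by
  rw [Matrix.mulVec_smul, hv u, smul_comm]

theorem exists_eigen_unique (l : Fin N → ℕ) (ξ : Fin N → ℂ) {η : ℂ} (hη : η ≠ 0)
    {K : Matrix (Fin 2) (Fin 2) ℂ} {k₁ k₂ : ℂ} (htr : K.trace = k₁ + k₂)
    (hdet : K.det = k₁ * k₂) (hne : k₁ ≠ k₂) (hk : K.det ≠ 0) (hξ : StringsDisjoint l ξ η)
    {t : ℂ → ℂ} (ht : t ∈ transferSpectrum l ξ η K) :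
    ∃ v : Conf l → ℂ, v ≠ 0 ∧ ∀ w, IsEigen l ξ η K t w ↔ ∃ c : ℂ, w = c • v := by
  obtain ⟨W, hW⟩ := exists_isSeparated_chain l ξ hη htr hdet hne hk hξ
  obtain ⟨v, hv0, hv⟩ := ht
  refine ⟨v, hv0, fun w => ⟨fun hw => hW.eigen_unique (by simp) hv hv0 hw, ?_⟩⟩
  rintro ⟨c, rfl⟩
  exact hv.smul c

theorem exists_factorized_eigen {l : Fin N → ℕ} (hl : ∀ n, 1 ≤ l n) {ξ : Fin N → ℂ} {η : ℂ}
    {K : Matrix (Fin 2) (Fin 2) ℂ} {k₁ k₂ : ℂ} (hdet : K.det = k₁ * k₂) {t : ℂ → ℂ}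
    (ht : ∃ v : Conf l → ℂ, v ≠ 0 ∧ ∀ w, IsEigen l ξ η K t w ↔ ∃ c : ℂ, w = c • v)
    {S : Conf l → ℂ} (hS : IsSoVBasis l ξ η K S) :
    ∃ v : Conf l → ℂ, IsEigen l ξ η K t v ∧ dotProduct S v = 1 ∧ ∀ w : Conf l → ℂ,
      (IsEigen l ξ η K t w ∧ dotProduct S w = 1 ↔ w = v) ∧
      ((∀ h : Conf l, dotProduct (sovCovector l ξ η K S h) w =
        ∏ n, (dMinor l ξ η k₁ k₂ t n).det ^ (h n : ℕ)) ↔ w = v) := by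
  obtain ⟨v, hv0, hv⟩ := ht
  have hve : IsEigen l ξ η K t v := (hv v).mpr ⟨1, (one_smul _ _).symm⟩
  -- If ⟨S| annihilated v, all the basis covectors would, since they pair with v through ⟨S|v⟩.
  have hSv : dotProduct S v ≠ 0 := by
    intro h0
    refine hv0 (eq_zero_of_forall_dotProduct hS.2 fun h => ?_)
    rw [sovCovector_dotProduct hl hdet hve, h0, mul_zero]
  have hue := hve.smul (dotProduct S v)⁻¹
  have hu1 : dotProduct S ((dotProduct S v)⁻¹ • v) = 1 := by
    rw [dotProduct_smul, smul_eq_mul, inv_mul_cancel₀ hSv]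
  set u := (dotProduct S v)⁻¹ • v with hu
  have huh : ∀ h : Conf l, dotProduct (sovCovector l ξ η K S h) u =
      ∏ n, (dMinor l ξ η k₁ k₂ t n).det ^ (h n : ℕ) := fun h => by
    rw [sovCovector_dotProduct hl hdet hue, hu1, mul_one]
  refine ⟨u, hue, hu1, fun w => ⟨⟨?_, ?_⟩, ⟨?_, ?_⟩⟩⟩
  · rintro ⟨hw, hw1⟩
    obtain ⟨c, rfl⟩ := (hv w).mp hw
    rw [dotProduct_smul, smul_eq_mul] at hw1
    rw [hu, eq_inv_of_mul_eq_one_left hw1]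
  · rintro rfl
    exact ⟨hue, hu1⟩
  · intro hw
    rw [← sub_eq_zero]
    refine eq_zero_of_forall_dotProduct hS.2 fun h => ?_
    rw [dotProduct_sub, hw, huh, sub_self]
  · rintro rfl
    exact huh

end Spectrum

/-! ### The spectrum of one site -/

section Krawtchouk

theorem derivative_pow_mul_self (A : ℂ[X]) (p : ℕ) :
    derivative (A ^ p) * A = C (p : ℂ) * derivative A * A ^ p := by
  cases p with
  | zero => simp
  | succ p =>
    rw [derivative_pow_succ, pow_succ A p]
    simp
    ring

/-- Generating function of Krawtchouk polynomials. -/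
def krawGen (r : ℂ) (p j : ℕ) : ℂ[X] := (1 + X) ^ p * (1 + C r * X) ^ j

/-- The logarithmic derivative of (1 + X)^p (1 + rX)^j, cleared of denominators. Comparing
coefficients gives a three-term recursion. -/
theorem krawGen_ode (r : ℂ) (p j : ℕ) :
    derivative (krawGen r p j) + C (1 + r) * (X * derivative (krawGen r p j)) +
      C r * (X * (X * derivative (krawGen r p j))) =
      C (p + j * r) * krawGen r p j + C (r * (p + j)) * (X * krawGen r p j) := by
  have h1 := derivative_pow_mul_self (1 + X) p
  have h2 := derivative_pow_mul_self (1 + C r * X) j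
  have d1 : derivative (1 + X : ℂ[X]) = 1 := by simp
  have d2 : derivative (1 + C r * X : ℂ[X]) = C r := by simp
  rw [d1] at h1
  rw [d2] at h2
  simp only [krawGen, derivative_mul, C_add, C_mul, C_1]
  linear_combination ((1 + C r * X) ^ j * (1 + C r * X)) * h1 + ((1 + X) ^ p * (1 + X)) * h2

theorem krawGen_coeff_zero (r : ℂ) (p j : ℕ) : (krawGen r p j).coeff 0 = 1 := by
  simp [krawGen, coeff_zero_eq_eval_zero]

theorem krawGen_coeff_one (r : ℂ) (p j : ℕ) : (krawGen r p j).coeff 1 = p + j * r := by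
  have h := congrArg (fun f => coeff f 0) (krawGen_ode r p j)
  simpa [coeff_C_mul, coeff_X_mul_zero, coeff_derivative, krawGen_coeff_zero] using h

theorem krawGen_coeff_succ_succ (r : ℂ) (p j m : ℕ) :
    ((m : ℂ) + 2) * (krawGen r p j).coeff (m + 2) =
      ((p - (m + 1)) + (j - (m + 1)) * r) * (krawGen r p j).coeff (m + 1) +
        r * (p + j - m) * (krawGen r p j).coeff m := by
  have h := congrArg (fun f => coeff f (m + 1)) (krawGen_ode r p j)
  have h2 : (X * derivative (krawGen r p j)).coeff m = m * (krawGen r p j).coeff m := by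
    cases m with
    | zero => simp
    | succ m => rw [coeff_X_mul, coeff_derivative]; push_cast; ring
  simp only [coeff_add, coeff_C_mul, coeff_X_mul, coeff_derivative, h2] at h
  push_cast at h
  linear_combination h

theorem krawGen_coeff_top (r : ℂ) (p j : ℕ) : (krawGen r p j).coeff (p + j) = r ^ j := by
  have h1 : (1 + X : ℂ[X]).natDegree ≤ 1 :=
    (natDegree_add_le _ _).trans (max_le (by simp) natDegree_X_le)
  have h2 : (1 + C r * X : ℂ[X]).natDegree ≤ 1 :=
    (natDegree_add_le _ _).trans (max_le (by simp) ((natDegree_C_mul_le r X).trans natDegree_X_le))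
  have h3 := coeff_pow_of_natDegree_le (m := p) h1
  have h4 := coeff_pow_of_natDegree_le (m := j) h2
  rw [mul_one] at h3 h4
  have h5 := natDegree_pow_le_of_le p h1
  have h6 := natDegree_pow_le_of_le j h2
  rw [mul_one] at h5 h6
  rw [krawGen, coeff_mul_add_eq_of_natDegree_le h5 h6, h3, h4]
  simp [coeff_one, coeff_X]

theorem krawGen_coeff_top_succ (r : ℂ) (p j : ℕ) : (krawGen r p j).coeff (p + j + 1) = 0 := by
  have h1 : (1 + X : ℂ[X]).natDegree ≤ 1 :=
    (natDegree_add_le _ _).trans (max_le (by simp) natDegree_X_le)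
  have h2 : (1 + C r * X : ℂ[X]).natDegree ≤ 1 :=
    (natDegree_add_le _ _).trans (max_le (by simp) ((natDegree_C_mul_le r X).trans natDegree_X_le))
  have h5 := natDegree_pow_le_of_le p h1
  have h6 := natDegree_pow_le_of_le j h2
  rw [mul_one] at h5 h6
  refine coeff_eq_zero_of_natDegree_lt (Nat.lt_succ_of_le ?_)
  exact natDegree_mul_le_of_le h5 h6

/-- The one-site continuant recursion is the coefficient recursion of `krawGen` with r = k₂/k₁,
after removing (k₁η)^m m!. Coefficient p + j + 1 vanishes, which is the quantization condition, and
coefficient p + j is r^j. -/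
theorem cont_krawtchouk {k₁ k₂ η : ℂ} (hk : k₁ ≠ 0) (p j m : ℕ) :
    cont (fun i => η * ((p - i) * k₁ + (j - i) * k₂))
      (fun i => k₁ * k₂ * (((p + j - i) * η) * (-(i + 1) * η))) m =
      (k₁ * η) ^ m * m.factorial * (krawGen (k₂ / k₁) p j).coeff m := by
  induction m using Nat.twoStepInduction with
  | zero => simp [cont, krawGen_coeff_zero]
  | one =>
    simp only [cont, krawGen_coeff_one]
    field_simp
    simp
  | more m h1 h2 =>
    have h3 := krawGen_coeff_succ_succ (k₂ / k₁) p j m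
    rw [cont, h1, h2, Nat.factorial_succ (m + 1), Nat.factorial_succ m, smul_eq_mul]
    push_cast
    have h4 : k₁ * (((m : ℂ) + 2) * (krawGen (k₂ / k₁) p j).coeff (m + 2)) =
      ((p - (m + 1)) * k₁ + (j - (m + 1)) * k₂) * (krawGen (k₂ / k₁) p j).coeff (m + 1) +
        k₂ * (p + j - m) * (krawGen (k₂ / k₁) p j).coeff m := by
      rw [h3]
      field_simp
    linear_combination (-(k₁ ^ (m + 1) * η ^ (m + 2) * (m + 1) * m.factorial)) * h4

end Krawtchouk

/-! ### The fused operator of a single site. -/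

section OneSite

/-- The transfer matrix of one site. -/
def siteTransfer (l : ℕ) (η : ℂ) (K : Matrix (Fin 2) (Fin 2) ℂ) (u : ℂ) :
    Matrix (Fin (l + 1)) (Fin (l + 1)) ℂ :=
  (K.map (fun c => c • (1 : Matrix (Fin (l + 1)) (Fin (l + 1)) ℂ)) * siteLax l η u).trace

/-- The nodes of one site with inhomogeneity zero. -/
def siteNode (l : ℕ) (η : ℂ) (k : ℕ) : ℂ := -η / 2 + ((l : ℂ) / 2 - k) * η

/-- The off-diagonal weights of one site. -/
def siteWeight (l : ℕ) (η c : ℂ) (k : ℕ) : ℂ := c * (((l - k) * η) * (-(k + 1) * η))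

/-- The fused transfer matrix of one site at its distinguished point. -/
def siteFused (l : ℕ) (η : ℂ) (K : Matrix (Fin 2) (Fin 2) ℂ) :
    Matrix (Fin (l + 1)) (Fin (l + 1)) ℂ :=
  cont (fun k => siteTransfer l η K (siteNode l η k)) (siteWeight l η K.det) l

theorem siteTransfer_eq (l : ℕ) (η : ℂ) (K : Matrix (Fin 2) (Fin 2) ℂ) (u : ℂ) :
    siteTransfer l η K u = u • (K.trace • 1) + (η • (K.map (fun c => c •
      (1 : Matrix (Fin (l + 1)) (Fin (l + 1)) ℂ)) * siteGen l).trace) := by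
  rw [siteTransfer, siteLax, mul_add, Matrix.trace_add, mul_smul_comm, mul_smul_comm,
    Matrix.trace_smul, Matrix.trace_smul, mul_one]
  congr 2
  simp [Matrix.trace, add_smul]

theorem exists_siteFused_eigen {l p j : ℕ} (hp : l = p + j) {η : ℂ} (hη : η ≠ 0) {K : Matrix (Fin 2) (Fin 2) ℂ}
    {k₁ k₂ : ℂ} (htr : K.trace = k₁ + k₂) (hdet : K.det = k₁ * k₂) (hne : k₁ ≠ k₂)
    (hk₁ : k₁ ≠ 0) (hk₂ : k₂ ≠ 0) :
    ∃ w : Fin (l + 1) → ℂ, w ≠ 0 ∧ (siteFused l η K).mulVec w =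
      ((k₁ * η) ^ l * l.factorial * (k₂ / k₁) ^ j) • w := by
  have hk : K.det ≠ 0 := by rw [hdet]; exact mul_ne_zero hk₁ hk₂
  have hQ : ∀ k : ℕ, (siteNode l η k + η / 2 + (l : ℂ) / 2 * η) *
      (siteNode l η k - η / 2 - (l : ℂ) / 2 * η) = ((l - k) * η) * (-(k + 1) * η) := by
    intro k
    simp only [siteNode]
    ring
  -- The chain argument with one site: `σ = Unit`, so that disjointness of strings is vacuous.
  obtain ⟨W, hW⟩ := exists_isSeparated_twist (σ := Unit) (l := fun _ => l)
    (ζ := fun _ k => siteNode l η k) hη (fun _ k => by simp only [siteNode]; push_cast; ring)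
    (fun n m h => absurd rfl h) (rtt_siteLax l η) (hasQDet_siteLax l η)
    (fun i j => by simp only [siteLax_apply]; fun_prop)
    (fun _ k hkl => by
      rw [hQ]
      have h1 : (l : ℂ) - k ≠ 0 := sub_ne_zero.mpr (by exact_mod_cast hkl.ne')
      have h2 : -((k : ℂ) + 1) ≠ 0 := neg_ne_zero.mpr (by exact_mod_cast Nat.succ_ne_zero k)
      exact mul_ne_zero (mul_ne_zero h1 hη) (mul_ne_zero h2 hη))
    (fun z => by
      obtain ⟨ω, hω, h⟩ := exists_site_reference l η z
      refine ⟨ω, hω, fun u i => ?_⟩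
      rw [h]
      congr 2
      simp [siteNode]
      ring) (by simp) K hk (exists_not_eigenvector htr hdet hne)
  simp only [hQ] at hW
  have hlc : (l : ℂ) = p + j := by rw [hp]; push_cast; ring
  -- The candidate eigenvalue has slope tr K and the value η(p k₁ + j k₂) at the top node.
  set t : ℂ → ℂ := fun u => K.trace * u + (-(K.trace * siteNode l η 0) +
    η * (p * k₁ + j * k₂)) with ht
  have htn : ∀ i : ℕ, t (siteNode l η i) = η * ((p - i) * k₁ + (j - i) * k₂) := by
    intro i
    simp only [ht, siteNode, htr]
    push_cast
    ring
  have hcont : ∀ m, cont (fun i => t (siteNode l η i))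
      (fun i : ℕ => K.det * (((l - i) * η) * (-(i + 1) * η))) m =
      (k₁ * η) ^ m * m.factorial * (krawGen (k₂ / k₁) p j).coeff m := by
    intro m
    rw [← cont_krawtchouk hk₁]
    simp only [htn, hdet, hlc]
  have hex : ∃ w : Fin (l + 1) → ℂ, w ≠ 0 ∧ ∀ u, (siteTransfer l η K u).mulVec w = t u • w := by
    refine hW.exists_eigen (c := K.trace) (t := t) (by simp) (fun n m h => absurd rfl h) ?_ ?_ ?_
    · intro a b
      set B := (η • (K.map (fun c => c •
        (1 : Matrix (Fin (l + 1)) (Fin (l + 1)) ℂ)) * siteGen l).trace) with hB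
      refine ⟨C (B a b), degree_C_le.trans_lt (by simp), fun u => ?_⟩
      have := congrFun₂ (siteTransfer_eq l η K u) a b
      rw [siteTransfer, ← hB] at this
      refine this.trans ?_
      rw [Matrix.add_apply, Matrix.smul_apply, Matrix.smul_apply, Matrix.one_apply, eval_C]
      split_ifs <;> simp [mul_comm]
    · exact ⟨C (-(K.trace * siteNode l η 0) + η * (p * k₁ + j * k₂)),
        degree_C_le.trans_lt (by simp), fun u => by simp [ht]⟩
    · intro _
      rw [hcont, hp, krawGen_coeff_top_succ, mul_zero]
  obtain ⟨w, hw0, hw⟩ := hex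
  refine ⟨w, hw0, ?_⟩
  have h1 : (siteFused l η K).mulVec w = _ := cont_mulVec (fun k => hw _) l
  rw [h1]
  congr 1
  rw [← krawGen_coeff_top (k₂ / k₁) p j, ← hp]
  exact hcont l

/-- The l + 1 eigenvalues are proportional to (k₂/k₁)^j with 0 ≤ j ≤ l, and the power condition
makes them distinct. The eigenvectors then form a basis, so a covector pairing to 1 with each of
them exists. -/
theorem exists_siteFused_cyclic {l : ℕ} {η : ℂ} (hη : η ≠ 0) {K : Matrix (Fin 2) (Fin 2) ℂ}
    {k₁ k₂ : ℂ} (htr : K.trace = k₁ + k₂) (hdet : K.det = k₁ * k₂) (hne : k₁ ≠ k₂)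
    (hk₁ : k₁ ≠ 0) (hk₂ : k₂ ≠ 0) (hpow : ∀ j, 1 ≤ j → j ≤ l → k₁ ^ j ≠ k₂ ^ j) :
    ∃ (w : Fin (l + 1) → Fin (l + 1) → ℂ) (y : Fin (l + 1) → ℂ) (s : Fin (l + 1) → ℂ),
      Function.Injective y ∧ (∀ j, (siteFused l η K).mulVec (w j) = y j • w j) ∧
      ∀ j, s ⬝ᵥ w j = 1 := by
  choose w hw0 hw using fun j : Fin (l + 1) =>
    exists_siteFused_eigen
    (Nat.sub_add_cancel (Nat.lt_succ_iff.mp j.isLt)).symm hη htr hdet hne hk₁ hk₂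
  have hlt : ∀ i j : Fin (l + 1), i < j → (k₂ / k₁) ^ (i : ℕ) ≠ (k₂ / k₁) ^ (j : ℕ) := by
    intro i j hij he
    obtain ⟨d, hd⟩ := Nat.exists_eq_add_of_lt (show (i : ℕ) < j from hij)
    have hr : k₂ / k₁ ≠ 0 := div_ne_zero hk₂ hk₁
    rw [hd, add_assoc, pow_add] at he
    have h1 : (k₂ / k₁) ^ (d + 1) = 1 := by
      have := mul_left_cancel₀ (pow_ne_zero i hr) (he.symm.trans (mul_one _).symm)
      exact this
    rw [div_pow, div_eq_one_iff_eq (pow_ne_zero _ hk₁)] at h1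
    exact hpow (d + 1) (by omega) (by omega) h1.symm
  have hc : (k₁ * η) ^ l * (l.factorial : ℂ) ≠ 0 :=
    mul_ne_zero (pow_ne_zero _ (mul_ne_zero hk₁ hη)) (Nat.cast_ne_zero.mpr l.factorial_ne_zero)
  have hinj : Function.Injective fun j : Fin (l + 1) =>
      (k₁ * η) ^ l * l.factorial * (k₂ / k₁) ^ (j : ℕ) := by
    intro i j hij
    have h1 := mul_left_cancel₀ hc hij
    rcases lt_trichotomy i j with h | h | h
    · exact absurd h1 (hlt i j h)
    · exact h
    · exact absurd h1.symm (hlt j i h)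
  have hind : LinearIndependent ℂ w :=
    Module.End.eigenvectors_linearIndependent' (siteFused l η K).mulVecLin _ hinj w fun j =>
      ⟨Module.End.mem_eigenspace_iff.mpr (by rw [Matrix.mulVecLin_apply, hw]), hw0 j⟩
  obtain ⟨s, hs⟩ := exists_dotProduct_eq (span_range_eq_top hind rfl) rfl fun _ => (1 : ℂ)
  exact ⟨w, _, s, hinj, hw, fun j => by rw [dotProduct_comm, hs]⟩

end OneSite

/-! ### The chain with widely separated inhomogeneities -/

section Lists

theorem list_prod_map_smul {κ A : Type*} [Ring A] [Algebra ℂ A] (L : List κ) (c : κ → ℂ)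
    (M : κ → A) : (L.map fun b => c b • M b).prod = (L.map c).prod • (L.map M).prod := by
  induction L with
  | nil => simp
  | cons b L ih => simp only [List.map_cons, List.prod_cons, ih, smul_mul_smul_comm]

theorem list_prod_map_ite {κ A : Type*} [DecidableEq κ] [Monoid A] (L : List κ) (n : κ) (M : A) :
    (L.map fun b => if b = n then M else 1).prod = M ^ L.count n := by
  induction L with
  | nil => simp
  | cons b L ih =>
    rw [List.map_cons, List.prod_cons, ih, List.count_cons]
    by_cases h : b = n
    · simp [h, pow_succ']
    · simp [h]

theorem prod_ite_eq_mul {N : ℕ} (n : Fin N) (x : ℂ) (c : Fin N → ℂ) :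
    (∏ b, if b = n then x else c b) = (∏ b, if b = n then 1 else c b) * x := by
  have h : ∀ b, (if b = n then x else c b) =
      (if b = n then 1 else c b) * (if b = n then x else 1) := by
    intro b; split_ifs <;> simp
  simp only [h, Finset.prod_mul_distrib, Finset.prod_ite_eq', Finset.mem_univ, if_true]

theorem prod_reverse_finRange {N : ℕ} (c : Fin N → ℂ) :
    ((List.finRange N).reverse.map c).prod = ∏ b, c b := by
  rw [List.map_reverse, List.prod_reverse, ← List.ofFn_eq_map, List.prod_ofFn]

end Lists

/-- The continuant is homogeneous when the operators have weight 1 and the scalars weight 2, which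
allows a whole fused operator to be rescaled at once. -/
theorem cont_smul {A : Type*} [Ring A] [Algebra ℂ A] (c : ℂ) (T : ℕ → A) (q : ℕ → ℂ) (m : ℕ) :
    cont (fun k => c • T k) (fun k => c ^ 2 * q k) m = c ^ m • cont T q m := by
  induction m using Nat.twoStepInduction with
  | zero => simp [cont]
  | one => simp [cont]
  | more m h1 h2 =>
    rw [cont, cont, h1, h2, smul_sub, smul_mul_smul_comm, smul_smul, smul_smul]
    congr 2
    ring

theorem continuous_cont {A X : Type*} [Ring A] [Algebra ℂ A] [TopologicalSpace X]
    [TopologicalSpace A] [IsTopologicalRing A] [ContinuousSMul ℂ A] {T : X → ℕ → A}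
    {q : X → ℕ → ℂ} (hT : ∀ k, Continuous fun x => T x k) (hq : ∀ k, Continuous fun x => q x k)
    (m : ℕ) : Continuous fun x => cont (T x) (q x) m := by
  induction m using Nat.twoStepInduction with
  | zero => exact continuous_const
  | one => exact hT 0
  | more m h1 h2 => exact (h2.mul (hT _)).sub ((hq m).smul h1)

theorem cont_map {A B : Type*} [Ring A] [Algebra ℂ A] [Ring B] [Algebra ℂ B] (f : A →ₐ[ℂ] B)
    (T : ℕ → A) (q : ℕ → ℂ) (m : ℕ) : cont (fun k => f (T k)) q m = f (cont T q m) := by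
  induction m using Nat.twoStepInduction with
  | zero => simp [cont]
  | one => simp [cont]
  | more m h1 h2 => rw [cont, cont, h1, h2, map_sub, map_mul, map_smul]

/-! ### Decoupling of the sites in the limit ε → 0. -/

section Scaled

variable {N : ℕ}

/-- Inhomogeneities that move apart as `ε → 0`. -/
def farXi (ε : ℂ) (b : Fin N) : ℂ := (b : ℕ) / ε

theorem node_farXi_sub (l : Fin N → ℕ) (η ε : ℂ) (n b : Fin N) (k : ℕ) :
    node l (farXi ε) η n k - farXi ε b = ((n : ℕ) - (b : ℕ) : ℂ) / ε + siteNode (l n) η k := by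
  simp only [node, farXi, siteNode]
  ring

/-- The operator `α + β E` at the site `b`, `E` the generators of `gl₂`. -/
def laxPair (l : Fin N → ℕ) (b : Fin N) (α β : ℂ) : Matrix (Fin 2) (Fin 2) (Op l) :=
  α • 1 + β • (siteGen (l b)).map (siteHom l b)

theorem lax_eq_laxPair (l : Fin N → ℕ) (η : ℂ) (b : Fin N) (u : ℂ) :
    lax l η b u = laxPair l b u η := by
  rw [lax_eq_map]
  ext i j : 2
  rw [Matrix.map_apply, siteLax_apply, map_add, map_smul, map_smul, laxPair]
  simp only [Matrix.add_apply, Matrix.smul_apply, Matrix.one_apply, Matrix.map_apply]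
  split_ifs <;> simp

theorem smul_laxPair (l : Fin N → ℕ) (b : Fin N) (c α β : ℂ) :
    c • laxPair l b α β = laxPair l b (c * α) (c * β) := by
  simp only [laxPair, smul_add, smul_smul]

/-- The factor of the site `b` in the rescaled transfer matrix at the nodes of the site `n`. -/
def scaledFactor (l : Fin N → ℕ) (η : ℂ) (n : Fin N) (k : ℕ) (ε : ℂ) (b : Fin N) :
    Matrix (Fin 2) (Fin 2) (Op l) :=
  if b = n then lax l η n (siteNode (l n) η k)
  else laxPair l b (((n : ℕ) - (b : ℕ) : ℂ) + ε * siteNode (l n) η k) (ε * η)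

/-- The rescaled transfer matrix at the nodes of the site `n`. -/
def scaledTransfer (l : Fin N → ℕ) (η : ℂ) (K : Matrix (Fin 2) (Fin 2) ℂ) (n : Fin N) (k : ℕ)
    (ε : ℂ) : Op l :=
  (K.map (fun c => c • (1 : Op l)) *
    ((List.finRange N).reverse.map fun b => scaledFactor l η n k ε b).prod).trace

/-- The rescaled off-diagonal weights of the site `n`. -/
def scaledWeight (l : Fin N → ℕ) (η c : ℂ) (n : Fin N) (k : ℕ) (ε : ℂ) : ℂ :=
  c * ((∏ b, if b = n then (l n - k) * η else ((n : ℕ) - (b : ℕ) : ℂ) +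
      ε * (siteNode (l n) η k - siteNode (l b) η (l b))) *
    ∏ b, if b = n then -(k + 1) * η else ((n : ℕ) - (b : ℕ) : ℂ) +
      ε * (siteNode (l n) η (k + 1) - siteNode (l b) η 0))

/-- The rescaled fused transfer matrix at the distinguished point of the site `n`. -/
def scaledFused (l : Fin N → ℕ) (η : ℂ) (K : Matrix (Fin 2) (Fin 2) ℂ) (n : Fin N) (ε : ℂ) :
    Op l :=
  cont (fun k => scaledTransfer l η K n k ε) (fun k => scaledWeight l η K.det n k ε) (l n)

/-- The scale factor of the site `n`. -/
def farScale (N : ℕ) (n : Fin N) (ε : ℂ) : ℂ := ∏ b : Fin N, if b = n then 1 else ε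

theorem farScale_ne_zero (n : Fin N) {ε : ℂ} (hε : ε ≠ 0) : farScale N n ε ≠ 0 :=
  Finset.prod_ne_zero_iff.mpr fun b _ => by split_ifs <;> simp [hε]

theorem scaledTransfer_eq (l : Fin N → ℕ) (η : ℂ) (K : Matrix (Fin 2) (Fin 2) ℂ) (n : Fin N)
    (k : ℕ) {ε : ℂ} (hε : ε ≠ 0) : scaledTransfer l η K n k ε =
      farScale N n ε • transfer l (farXi ε) η K (node l (farXi ε) η n k) := by
  have h : ∀ b, scaledFactor l η n k ε b = (if b = n then 1 else ε) •
      lax l η b (node l (farXi ε) η n k - farXi ε b) := by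
    intro b
    rw [scaledFactor, node_farXi_sub]
    by_cases hb : b = n
    · subst hb; simp
    · rw [if_neg hb, if_neg hb, lax_eq_laxPair, smul_laxPair]
      congr 1
      field_simp
  simp only [scaledTransfer, h, transfer, monodromy, farScale]
  rw [list_prod_map_smul, prod_reverse_finRange, mul_smul_comm, Matrix.trace_smul]

theorem scaledWeight_eq (l : Fin N → ℕ) (η c : ℂ) (n : Fin N)
    (k : ℕ) {ε : ℂ} (hε : ε ≠ 0) : scaledWeight l η c n k ε =
      farScale N n ε ^ 2 * weight l (farXi ε) η c n k := by
  have h : ∀ b i, node l (farXi ε) η b i = (b : ℕ) / ε + siteNode (l b) η i := by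
    intro b i
    simp only [node, farXi, siteNode]
    ring
  have h1 : (∏ b, if b = n then (l n - k) * η else ((n : ℕ) - (b : ℕ) : ℂ) +
      ε * (siteNode (l n) η k - siteNode (l b) η (l b))) =
      farScale N n ε * aFun l (farXi ε) η (node l (farXi ε) η n k) := by
    rw [aFun_eq, farScale, ← Finset.prod_mul_distrib]
    refine Finset.prod_congr rfl fun b _ => ?_
    rw [h, h]
    split_ifs with hb
    · subst hb; simp only [siteNode]; ring
    · field_simp; ring
  have h2 : (∏ b, if b = n then -(k + 1) * η else ((n : ℕ) - (b : ℕ) : ℂ) +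
      ε * (siteNode (l n) η (k + 1) - siteNode (l b) η 0)) =
      farScale N n ε * dFun l (farXi ε) η (node l (farXi ε) η n (k + 1)) := by
    rw [dFun_eq, farScale, ← Finset.prod_mul_distrib]
    refine Finset.prod_congr rfl fun b _ => ?_
    rw [h, h]
    split_ifs with hb
    · subst hb; simp only [siteNode]; push_cast; ring
    · field_simp; ring
  rw [scaledWeight, h1, h2, weight]
  ring

theorem scaledFused_eq (l : Fin N → ℕ) (η : ℂ) (K : Matrix (Fin 2) (Fin 2) ℂ) (n : Fin N)
    (hl : 1 ≤ l n) {ε : ℂ} (hε : ε ≠ 0) : scaledFused l η K n ε =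
      farScale N n ε ^ l n •
        fusedTransfer l (farXi ε) η K (l n) (node l (farXi ε) η n (l n - 1)) := by
  rw [fusedTransfer_eq_cont l (farXi ε) η K n (l n) hl, ← cont_smul, scaledFused]
  simp only [scaledTransfer_eq l η K n _ hε, scaledWeight_eq l η _ n _ hε]

/-- The limit of the scale factor relative to the differences of the inhomogeneities. -/
def farConst (n : Fin N) : ℂ := ∏ b : Fin N, if b = n then 1 else ((n : ℕ) - (b : ℕ) : ℂ)

theorem farConst_ne_zero (n : Fin N) : farConst n ≠ 0 :=
  Finset.prod_ne_zero_iff.mpr fun b _ => by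
    split_ifs with h
    · exact one_ne_zero
    · refine sub_ne_zero.mpr fun he => h (Fin.ext ?_)
      exact_mod_cast he.symm

/-- At ε = 0 each site b ≠ n contributes only the scalar n - b, leaving the transfer matrix of the
site n. The rescaled expressions have no poles, so ε = 0 is a legitimate value although `farXi 0` is
not the limit point. -/
theorem scaledTransfer_zero (l : Fin N → ℕ) (η : ℂ) (K : Matrix (Fin 2) (Fin 2) ℂ) (n : Fin N)
    (k : ℕ) : scaledTransfer l η K n k 0 =
      farConst n • siteHom l n (siteTransfer (l n) η K (siteNode (l n) η k)) := by
  have h : ∀ b, scaledFactor l η n k 0 b = (if b = n then 1 else ((n : ℕ) - (b : ℕ) : ℂ)) •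
      if b = n then lax l η n (siteNode (l n) η k) else 1 := by
    intro b
    rw [scaledFactor]
    split_ifs
    · rw [one_smul]
    · simp [laxPair]
  simp only [scaledTransfer, h]
  rw [list_prod_map_smul, prod_reverse_finRange, list_prod_map_ite, List.count_reverse,
    List.count_eq_one_of_mem (List.nodup_finRange N) (List.mem_finRange n), pow_one,
    mul_smul_comm, Matrix.trace_smul, farConst, lax_eq_map]
  congr 1
  simp [siteTransfer, Matrix.trace, Matrix.mul_apply]

theorem scaledWeight_zero (l : Fin N → ℕ) (η c : ℂ) (n : Fin N) (k : ℕ) :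
    scaledWeight l η c n k 0 = farConst n ^ 2 * siteWeight (l n) η c k := by
  simp only [scaledWeight, zero_mul, add_zero]
  rw [prod_ite_eq_mul, prod_ite_eq_mul n (-((k : ℂ) + 1) * η), ← farConst, siteWeight]
  ring

theorem scaledFused_zero (l : Fin N → ℕ) (η : ℂ) (K : Matrix (Fin 2) (Fin 2) ℂ) (n : Fin N) :
    scaledFused l η K n 0 = farConst n ^ l n • leg n (siteFused (l n) η K) := by
  simp only [scaledFused, scaledTransfer_zero, scaledWeight_zero]
  rw [cont_smul, cont_map, siteFused]
  rfl

theorem continuous_scaledFused (l : Fin N → ℕ) (η : ℂ) (K : Matrix (Fin 2) (Fin 2) ℂ)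
    (n : Fin N) : Continuous (scaledFused l η K n) := by
  refine continuous_cont (fun k => ?_) (fun k => ?_) _
  · refine (continuous_const.mul (continuous_list_prod _ fun b _ => ?_)).matrix_trace
    simp only [scaledFactor, laxPair]
    split_ifs
    · exact continuous_const
    · fun_prop
  · simp only [scaledWeight]
    refine continuous_const.mul ((continuous_finsetProd _ fun b _ => ?_).mul
      (continuous_finsetProd _ fun b _ => ?_)) <;> split_ifs <;> fun_prop

/-- A multivariate Vandermonde argument: a polynomial of degree at most l n in the n-th variable,
vanishing on a grid with l n + 1 points in each direction, is zero. -/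
theorem eq_zero_of_forall_sum_prod_pow {l : Fin N → ℕ} {z : ∀ n, Fin (l n + 1) → ℂ}
    (hz : ∀ n, Function.Injective (z n)) {g : Conf l → ℂ}
    (h : ∀ j : Conf l, ∑ i : Conf l, g i * ∏ n, z n (j n) ^ (i n : ℕ) = 0) : g = 0 := by
  set e : Conf l → Fin N →₀ ℕ := fun i => Finsupp.equivFunOnFinite.symm fun n => (i n : ℕ) with he
  have heinj : Function.Injective e := fun i j hij => funext fun n => Fin.ext (by
    have := DFunLike.congr_fun hij n
    simpa [he] using this)
  set P : MvPolynomial (Fin N) ℂ := ∑ i, MvPolynomial.monomial (e i) (g i) with hP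
  have hP0 : P = 0 := by
    refine MvPolynomial.eq_zero_of_eval_zero_at_prod_finset P
      (fun n => Finset.univ.image (z n)) (fun n => ?_) fun x hx => ?_
    · rw [Finset.card_image_of_injective _ (hz n), Finset.card_univ, Fintype.card_fin,
        Nat.lt_succ_iff]
      refine (MvPolynomial.degreeOf_sum_le _ _ _).trans (Finset.sup_le fun i _ => ?_)
      by_cases hg : g i = 0
      · simp [hg]
      · rw [MvPolynomial.degreeOf_monomial_eq _ _ hg]
        exact Nat.lt_succ_iff.mp (i n).isLt
    · have hx2 : ∀ n, ∃ j, z n j = x n := fun n => by simpa using hx n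
      choose j hj using hx2
      rw [← h j, hP, map_sum]
      refine Finset.sum_congr rfl fun i _ => ?_
      rw [MvPolynomial.eval_monomial, Finsupp.prod_fintype _ _ fun n => pow_zero _]
      simp [he, hj]
  funext i
  have h2 := congrArg (MvPolynomial.coeff (e i)) hP0
  rw [hP, MvPolynomial.coeff_sum] at h2
  simpa [MvPolynomial.coeff_monomial, heinj.eq_iff] using h2

theorem prodVec_dotProduct (l : Fin N → ℕ) (s w : ∀ n, Fin (l n + 1) → ℂ) :
    (prodVec s : Conf l → ℂ) ⬝ᵥ prodVec w = ∏ n, s n ⬝ᵥ w n := by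
  simp only [dotProduct, Finset.prod_univ_sum, Fintype.piFinset_univ, prodVec,
    Finset.prod_mul_distrib]

/-- At ε = 0 the fused operators are diagonal on products of one-site eigenvectors, with simple
one-site spectra, and the product covector pairs to 1 with each of these. Independence in the limit
persists for small nonzero ε. -/
theorem exists_linearIndependent_sovCovector (l : Fin N → ℕ) (hl : ∀ n, 1 ≤ l n) {η : ℂ}
    (hη : η ≠ 0) {K : Matrix (Fin 2) (Fin 2) ℂ} {k₁ k₂ : ℂ} (htr : K.trace = k₁ + k₂)
    (hdet : K.det = k₁ * k₂) (hne : k₁ ≠ k₂) (hk₁ : k₁ ≠ 0) (hk₂ : k₂ ≠ 0)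
    (hpow : ∀ n, ∀ j, 1 ≤ j → j ≤ l n → k₁ ^ j ≠ k₂ ^ j) :
    ∃ (ξ : Fin N → ℂ) (S : Conf l → ℂ), LinearIndependent ℂ (sovCovector l ξ η K S) := by
  choose w y s hy hw hs using fun n =>
    exists_siteFused_cyclic (l := l n) hη htr hdet hne hk₁ hk₂ (hpow n)
  set S : Conf l → ℂ := prodVec s with hS
  set R : ℂ → Matrix (Conf l) (Conf l) ℂ := fun ε => Matrix.of fun h =>
    Matrix.vecMul S ((List.finRange N).map fun n => scaledFused l η K n ε ^ (h n : ℕ)).prod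
    with hR
  have hcont : Continuous fun ε => (R ε).det := by
    refine Continuous.matrix_det (continuous_pi fun h => ?_)
    exact continuous_const.matrix_vecMul (continuous_list_prod _ fun n _ =>
      (continuous_scaledFused l η K n).pow _)
  have h0 : (R 0).det ≠ 0 := by
    refine ((Matrix.isUnit_iff_isUnit_det _).mp
      (Matrix.linearIndependent_rows_iff_isUnit.mp ?_)).ne_zero
    rw [Fintype.linearIndependent_iff]
    intro g hg
    have hg0 : g = 0 := by
      refine eq_zero_of_forall_sum_prod_pow
        (z := fun n j => farConst n ^ l n * y n j) (fun n => ?_) fun j => ?_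
      · exact (mul_right_injective₀ (pow_ne_zero _ (farConst_ne_zero n))).comp (hy n)
      -- Tested on a product of eigenvectors, each row becomes a monomial in the one-site
      -- eigenvalues.
      · have hrow : ∀ i : Conf l, (R 0).row i ⬝ᵥ prodVec (fun n => w n (j n)) =
            ∏ n, (farConst n ^ l n * y n (j n)) ^ (i n : ℕ) := by
          intro i
          have h1 : ∀ n, (scaledFused l η K n 0).mulVec (prodVec fun n => w n (j n)) =
              (farConst n ^ l n * y n (j n)) • prodVec fun n => w n (j n) := by
            intro n
            rw [scaledFused_zero, Matrix.smul_mulVec,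
              leg_mulVec_prodVec n _ _ _ (hw n (j n)), smul_smul]
          change Matrix.vecMul S _ ⬝ᵥ _ = _
          rw [← Matrix.dotProduct_mulVec, list_prod_mulVec _ fun n => pow_mulVec (h1 n) (i n),
            dotProduct_smul, ← List.ofFn_eq_map, List.prod_ofFn, hS, prodVec_dotProduct]
          simp [hs]
        have h2 := congrArg (fun v => v ⬝ᵥ prodVec fun n => w n (j n)) hg
        simpa [sum_dotProduct, hrow] using h2
    exact fun i => congrFun hg0 i
  obtain ⟨ε, hε, hdetε⟩ : ∃ ε : ℂ, ε ≠ 0 ∧ (R ε).det ≠ 0 := by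
    have h1 := hcont.continuousAt.eventually_ne h0
    have h2 := (h1.filter_mono nhdsWithin_le_nhds).and
      (self_mem_nhdsWithin : ({0}ᶜ : Set ℂ) ∈ nhdsWithin 0 _)
    obtain ⟨ε, h3, h4⟩ := h2.exists
    exact ⟨ε, h4, h3⟩
  refine ⟨farXi ε, S, ?_⟩
  have hli := Matrix.linearIndependent_rows_iff_isUnit.mpr
    ((Matrix.isUnit_iff_isUnit_det _).mpr (isUnit_iff_ne_zero.mpr hdetε))
  -- For ε ≠ 0 the rescaling multiplies each covector by a nonzero scalar, which does not affect
  -- independence.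
  have hrow : (R ε).row = (fun h : Conf l => Units.mk0 (∏ n, (farScale N n ε ^ l n) ^ (h n : ℕ))
      (Finset.prod_ne_zero_iff.mpr fun n _ =>
        pow_ne_zero _ (pow_ne_zero _ (farScale_ne_zero n hε)))) •
      sovCovector l (farXi ε) η K S := by
    funext h
    change Matrix.vecMul S _ = (∏ n, (farScale N n ε ^ l n) ^ (h n : ℕ)) • sovCovector _ _ _ _ _ h
    simp only [scaledFused_eq l η K _ (hl _) hε, _root_.smul_pow]
    rw [list_prod_map_smul, ← List.ofFn_eq_map, List.prod_ofFn, Matrix.vecMul_smul, sovCovector]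
  rw [hrow, LinearIndependent.units_smul_iff] at hli
  exact hli

end Scaled

/-! ### Polynomial dependence on the parameters -/

section PolyFun

variable {σ : Type*} {A B : Type*} [Ring A] [Algebra ℂ A] [Ring B] [Algebra ℂ B]

/-- The functions of `x : σ → ℂ` of the form `∑ i, p_i(x) a_i` with polynomials `p_i`. -/
def polyFun (σ A : Type*) [Ring A] [Algebra ℂ A] : Subalgebra ℂ ((σ → ℂ) → A) :=
  (Submodule.span ℂ {f | ∃ (p : MvPolynomial σ ℂ) (a : A),
      f = fun x => MvPolynomial.eval x p • a}).toSubalgebra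
    (Submodule.subset_span ⟨1, 1, by ext; simp⟩) (by
      intro f g hf hg
      induction hf, hg using Submodule.span_induction₂ with
      | mem_mem f g hf hg =>
        obtain ⟨p, a, rfl⟩ := hf
        obtain ⟨q, b, rfl⟩ := hg
        exact Submodule.subset_span ⟨p * q, a * b, by
          funext x
          rw [Pi.mul_apply, smul_mul_smul_comm, map_mul]⟩
      | zero_left => simp
      | zero_right => simp
      | add_left _ _ _ _ _ _ h1 h2 => rw [add_mul]; exact add_mem h1 h2
      | add_right _ _ _ _ _ _ h1 h2 => rw [mul_add]; exact add_mem h1 h2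
      | smul_left c _ _ _ _ h => rw [smul_mul_assoc]; exact Submodule.smul_mem _ c h
      | smul_right c _ _ _ _ h => rw [mul_smul_comm]; exact Submodule.smul_mem _ c h)

theorem mem_polyFun_of_eval (p : MvPolynomial σ ℂ) (a : A) :
    (fun x => MvPolynomial.eval x p • a) ∈ polyFun σ A :=
  Submodule.subset_span ⟨p, a, rfl⟩

theorem const_mem_polyFun (a : A) : (fun _ : σ → ℂ => a) ∈ polyFun σ A := by
  simpa using mem_polyFun_of_eval (σ := σ) 1 a

theorem comp_mem_polyFun (φ : A →ₗ[ℂ] B) {f : (σ → ℂ) → A} (hf : f ∈ polyFun σ A) :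
    (fun x => φ (f x)) ∈ polyFun σ B := by
  change f ∈ Submodule.span ℂ _ at hf
  induction hf using Submodule.span_induction with
  | mem f h =>
    obtain ⟨p, a, rfl⟩ := h
    simpa using mem_polyFun_of_eval p (φ a)
  | zero => simpa using const_mem_polyFun (σ := σ) (0 : B)
  | add f g _ _ hf hg => simp only [Pi.add_apply, map_add]; exact add_mem hf hg
  | smul c f _ hf => simp only [Pi.smul_apply, map_smul]; exact Subalgebra.smul_mem _ hf c

theorem exists_eval_of_mem_polyFun {f : (σ → ℂ) → ℂ} (hf : f ∈ polyFun σ ℂ) :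
    ∃ p : MvPolynomial σ ℂ, ∀ x, MvPolynomial.eval x p = f x := by
  change f ∈ Submodule.span ℂ _ at hf
  induction hf using Submodule.span_induction with
  | mem f h =>
    obtain ⟨p, a, rfl⟩ := h
    exact ⟨p * MvPolynomial.C a, fun x => by simp⟩
  | zero => exact ⟨0, fun x => by simp⟩
  | add f g _ _ hf hg =>
    obtain ⟨p, hp⟩ := hf
    obtain ⟨q, hq⟩ := hg
    exact ⟨p + q, fun x => by simp [hp, hq]⟩
  | smul c f _ hf =>
    obtain ⟨p, hp⟩ := hf
    exact ⟨MvPolynomial.C c * p, fun x => by simp [hp]⟩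

theorem smul_mem_polyFun {c : (σ → ℂ) → ℂ} {f : (σ → ℂ) → A} (hc : c ∈ polyFun σ ℂ)
    (hf : f ∈ polyFun σ A) : (fun x => c x • f x) ∈ polyFun σ A := by
  have h := mul_mem (comp_mem_polyFun (Algebra.linearMap ℂ A) hc) hf
  convert h using 2 with x
  rw [Algebra.smul_def]
  rfl

theorem list_prod_mem_polyFun {κ : Type*} (L : List κ) {f : (σ → ℂ) → κ → A}
    (hf : ∀ k, (fun x => f x k) ∈ polyFun σ A) :
    (fun x => (L.map (f x)).prod) ∈ polyFun σ A := by
  induction L with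
  | nil => simpa using const_mem_polyFun (σ := σ) (1 : A)
  | cons k L ih => simp only [List.map_cons, List.prod_cons]; exact mul_mem (hf k) ih

theorem cont_mem_polyFun {T : (σ → ℂ) → ℕ → A} {q : (σ → ℂ) → ℕ → ℂ}
    (hT : ∀ k, (fun x => T x k) ∈ polyFun σ A) (hq : ∀ k, (fun x => q x k) ∈ polyFun σ ℂ)
    (m : ℕ) : (fun x => cont (T x) (q x) m) ∈ polyFun σ A := by
  induction m using Nat.twoStepInduction with
  | zero => exact const_mem_polyFun 1
  | one => exact hT 0
  | more m h1 h2 => exact sub_mem (mul_mem h2 (hT _)) (smul_mem_polyFun (hq m) h1)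

theorem det_mem_polyFun {ι : Type*} [Fintype ι] [DecidableEq ι] {M : (σ → ℂ) → Matrix ι ι ℂ}
    (hM : ∀ i j, (fun x => M x i j) ∈ polyFun σ ℂ) : (fun x => (M x).det) ∈ polyFun σ ℂ := by
  have h : (fun x => (M x).det) = ∑ π : Equiv.Perm ι,
      ((Equiv.Perm.sign π : ℤ) : ℂ) • ∏ i, fun x => M x (π i) i := by
    ext x
    simp [Matrix.det_apply', Finset.prod_apply]
  rw [h]
  exact sum_mem fun π _ => Subalgebra.smul_mem _ (prod_mem fun i _ => hM _ _) _

end PolyFun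

/-! ### Polynomiality in the inhomogeneities and in the covector, and genericity. -/

section Parameters

variable {N : ℕ} {σ : Type*}

theorem node_mem_polyFun (l : Fin N → ℕ) {ξ : (σ → ℂ) → Fin N → ℂ} (η : ℂ)
    (hξ : ∀ b, (fun x => ξ x b) ∈ polyFun σ ℂ) (n : Fin N) (k : ℕ) :
    (fun x => node l (ξ x) η n k) ∈ polyFun σ ℂ :=
  add_mem (sub_mem (hξ n) (const_mem_polyFun _)) (const_mem_polyFun _)

theorem transfer_mem_polyFun (l : Fin N → ℕ) {ξ : (σ → ℂ) → Fin N → ℂ} (η : ℂ)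
    (K : Matrix (Fin 2) (Fin 2) ℂ) (hξ : ∀ b, (fun x => ξ x b) ∈ polyFun σ ℂ)
    {u : (σ → ℂ) → ℂ} (hu : u ∈ polyFun σ ℂ) :
    (fun x => transfer l (ξ x) η K (u x)) ∈ polyFun σ (Op l) := by
  refine comp_mem_polyFun (Matrix.traceLinearMap (Fin 2) ℂ (Op l))
    (mul_mem (const_mem_polyFun _) (list_prod_mem_polyFun _ fun b => ?_))
  simp only [lax_eq_laxPair, laxPair]
  exact add_mem (smul_mem_polyFun (sub_mem hu (hξ b)) (const_mem_polyFun _))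
    (const_mem_polyFun _)

theorem prod_sub_mem_polyFun {u : (σ → ℂ) → ℂ} {v : (σ → ℂ) → Fin N → ℂ}
    (hu : u ∈ polyFun σ ℂ) (hv : ∀ b, (fun x => v x b) ∈ polyFun σ ℂ) :
    (fun x => ∏ b, (u x - v x b)) ∈ polyFun σ ℂ := by
  have h : (fun x => ∏ b, (u x - v x b)) = ∏ b, (u - fun x => v x b) := by
    ext x
    simp
  rw [h]
  exact prod_mem fun b _ => sub_mem hu (hv b)

theorem weight_mem_polyFun (l : Fin N → ℕ) {ξ : (σ → ℂ) → Fin N → ℂ} (η c : ℂ)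
    (hξ : ∀ b, (fun x => ξ x b) ∈ polyFun σ ℂ) (n : Fin N) (k : ℕ) :
    (fun x => weight l (ξ x) η c n k) ∈ polyFun σ ℂ := by
  simp only [weight, aFun_eq, dFun_eq]
  have h := node_mem_polyFun l η hξ
  exact mul_mem (const_mem_polyFun c) (mul_mem (prod_sub_mem_polyFun (h n k) fun b => h b (l b))
    (prod_sub_mem_polyFun (h n (k + 1)) fun b => h b 0))

/-- The continuant form of the fused operators is used because it is built from sums and products of
manifestly polynomial functions. -/
theorem exists_mvPolynomial_det_sovCovector (l : Fin N → ℕ) (hl : ∀ n, 1 ≤ l n) (η : ℂ)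
    (K : Matrix (Fin 2) (Fin 2) ℂ) : ∃ P : MvPolynomial (Fin N ⊕ Conf l) ℂ,
      ∀ ξ S, MvPolynomial.eval (Sum.elim ξ S) P =
        (Matrix.of (sovCovector l ξ η K S)).det := by
  have hX : ∀ i, (fun x : (Fin N ⊕ Conf l) → ℂ => x i) ∈ polyFun (Fin N ⊕ Conf l) ℂ := fun i => by
    simpa using mem_polyFun_of_eval (MvPolynomial.X i) (1 : ℂ)
  have hξ := fun b : Fin N => hX (Sum.inl b)
  have hF : ∀ n, (fun x : (Fin N ⊕ Conf l) → ℂ => fusedTransfer l (fun b => x (Sum.inl b)) η K (l n)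
      (node l (fun b => x (Sum.inl b)) η n (l n - 1))) ∈ polyFun _ (Op l) := by
    intro n
    simp only [fun ξ => fusedTransfer_eq_cont l ξ η K n (l n) (hl n)]
    exact cont_mem_polyFun
      (fun k => transfer_mem_polyFun l η K hξ (node_mem_polyFun l η hξ n k))
      (fun k => weight_mem_polyFun l η K.det hξ n k) (l n)
  have hdet : (fun x : (Fin N ⊕ Conf l) → ℂ => (Matrix.of (sovCovector l (fun b => x (Sum.inl b)) η K
      fun c => x (Sum.inr c))).det) ∈ polyFun _ ℂ := by
    refine det_mem_polyFun fun h c => ?_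
    have hL := list_prod_mem_polyFun (List.finRange N) fun n => pow_mem (hF n) (h n : ℕ)
    have he : (fun x : (Fin N ⊕ Conf l) → ℂ => Matrix.of (sovCovector l (fun b => x (Sum.inl b)) η K
        fun c => x (Sum.inr c)) h c) = ∑ i : Conf l, (fun x => x (Sum.inr i)) * fun x =>
          ((List.finRange N).map fun n => fusedTransfer l (fun b => x (Sum.inl b)) η K (l n)
            (node l (fun b => x (Sum.inl b)) η n (l n - 1)) ^ (h n : ℕ)).prod i c := by
      ext x
      simp [sovCovector, Matrix.vecMul, dotProduct]
    rw [he]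
    exact sum_mem fun i _ => mul_mem (hX _) (comp_mem_polyFun (Matrix.entryLinearMap ℂ ℂ i c) hL)
  obtain ⟨P, hP⟩ := exists_eval_of_mem_polyFun hdet
  exact ⟨P, fun ξ S => hP (Sum.elim ξ S)⟩

theorem exists_mvPolynomial_stringsDisjoint (l : Fin N → ℕ) (η : ℂ) (τ : Type*) :
    ∃ P : MvPolynomial (Fin N ⊕ τ) ℂ, P ≠ 0 ∧ ∀ ξ (S : τ → ℂ),
      MvPolynomial.eval (Sum.elim ξ S) P ≠ 0 → StringsDisjoint l ξ η := by
  set F : ∀ n m : Fin N, ℕ → ℕ → MvPolynomial (Fin N ⊕ τ) ℂ := fun n m h k =>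
    if n = m then 1 else MvPolynomial.X (Sum.inl n) - MvPolynomial.X (Sum.inl m) +
      MvPolynomial.C (node l 0 η n h - node l 0 η m k) with hF
  refine ⟨∏ n, ∏ m, ∏ h ∈ Finset.range (l n + 1), ∏ k ∈ Finset.range (l m + 1), F n m h k,
    ?_, fun ξ S hP n m hnm h hh k hk he => hP ?_⟩
  · simp only [Finset.prod_ne_zero_iff]
    intro n _ m _ h _ k _ h0
    by_cases hnm : n = m
    · simp [hF, hnm] at h0
    · have h1 := congrArg (MvPolynomial.eval (Sum.elim (Pi.single n
        (1 - (node l 0 η n h - node l 0 η m k))) (fun _ : τ => 0))) h0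
      simp [hF, hnm, Ne.symm hnm] at h1
  · simp only [map_prod]
    refine Finset.prod_eq_zero (Finset.mem_univ n) (Finset.prod_eq_zero (Finset.mem_univ m)
      (Finset.prod_eq_zero (Finset.mem_range.mpr (Nat.lt_succ_of_le hh))
        (Finset.prod_eq_zero (Finset.mem_range.mpr (Nat.lt_succ_of_le hk)) ?_)))
    simp only [hF, if_neg hnm, map_add, map_sub, MvPolynomial.eval_X, MvPolynomial.eval_C,
      Sum.elim_inl]
    simp only [node, Pi.zero_apply] at he ⊢
    linear_combination he

theorem isSoVBasis_of_det_ne_zero {l : Fin N → ℕ} {ξ : Fin N → ℂ} {η : ℂ}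
    {K : Matrix (Fin 2) (Fin 2) ℂ} {S : Conf l → ℂ}
    (h : (Matrix.of (sovCovector l ξ η K S)).det ≠ 0) : IsSoVBasis l ξ η K S := by
  have hli : LinearIndependent ℂ (sovCovector l ξ η K S) :=
    Matrix.linearIndependent_rows_iff_isUnit.mpr
      ((Matrix.isUnit_iff_isUnit_det _).mpr (isUnit_iff_ne_zero.mpr h))
  exact ⟨hli, span_range_eq_top hli rfl⟩

/-- The product of two nonzero polynomials, one for disjoint strings and one for the determinant of
the covectors. The second is nonzero because widely separated inhomogeneities give independent
covectors. -/
theorem exists_mvPolynomial_isSoVBasis (l : Fin N → ℕ) (hl : ∀ n, 1 ≤ l n) {η : ℂ}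
    (hη : η ≠ 0) {K : Matrix (Fin 2) (Fin 2) ℂ} {k₁ k₂ : ℂ} (htr : K.trace = k₁ + k₂)
    (hdet : K.det = k₁ * k₂) (hne : k₁ ≠ k₂) (hk₁ : k₁ ≠ 0) (hk₂ : k₂ ≠ 0)
    (hpow : ∀ n, ∀ j, 1 ≤ j → j ≤ l n → k₁ ^ j ≠ k₂ ^ j) :
    ∃ P : MvPolynomial (Fin N ⊕ Conf l) ℂ, P ≠ 0 ∧ ∀ ξ S,
      MvPolynomial.eval (Sum.elim ξ S) P ≠ 0 → StringsDisjoint l ξ η ∧ IsSoVBasis l ξ η K S := by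
  obtain ⟨P, hP⟩ := exists_mvPolynomial_det_sovCovector l hl η K
  obtain ⟨Q, hQ0, hQ⟩ := exists_mvPolynomial_stringsDisjoint l η (Conf l)
  refine ⟨Q * P, mul_ne_zero hQ0 ?_, fun ξ S h => ?_⟩
  · rintro rfl
    obtain ⟨ξ, S, hli⟩ :=
      exists_linearIndependent_sovCovector l hl hη htr hdet hne hk₁ hk₂ hpow
    have h1 : IsUnit (Matrix.of (sovCovector l ξ η K S)) :=
      Matrix.linearIndependent_rows_iff_isUnit.mp hli
    refine ((Matrix.isUnit_iff_isUnit_det _).mp h1).ne_zero ?_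
    rw [← hP, map_zero]
  · rw [map_mul, hP] at h
    exact ⟨hQ ξ S (left_ne_zero_of_mul h), isSoVBasis_of_det_ne_zero (right_ne_zero_of_mul h)⟩

end Parameters

end SpinChain

end

theorem theorem4p3 (N : ℕ) (l : Fin N → ℕ) (hl : ∀ n, 1 ≤ l n) (η : ℂ) (hη : η ≠ 0)
    (K : Matrix (Fin 2) (Fin 2) ℂ) (k₁ k₂ : ℂ)
    (hK : K.charpoly = (Polynomial.X - Polynomial.C k₁) * (Polynomial.X - Polynomial.C k₂))
    (hne : k₁ ≠ k₂) (hk₁ : k₁ ≠ 0) (hk₂ : k₂ ≠ 0) :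
    -- for almost all inhomogeneities and covectors `⟨S|`, the SoV covectors form a basis
    ((∀ n, ∀ j, 1 ≤ j → j ≤ l n → k₁ ^ j ≠ k₂ ^ j) →
      ∃ P : MvPolynomial (Fin N ⊕ SpinChain.Conf l) ℂ, P ≠ 0 ∧
        ∀ (ξ : Fin N → ℂ) (S : SpinChain.Conf l → ℂ),
          MvPolynomial.eval (Sum.elim ξ S) P ≠ 0 →
            SpinChain.StringsDisjoint l ξ η ∧ SpinChain.IsSoVBasis l ξ η K S) ∧
    ∀ ξ : Fin N → ℂ, SpinChain.StringsDisjoint l ξ η →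
      -- the spectrum
      SpinChain.transferSpectrum l ξ η K =
        SpinChain.tFun l ξ η K '' SpinChain.solutions l ξ η K k₁ k₂ ∧
      -- the `n`-th equation is polynomial of degree `2 s_n + 1` in the unknowns
      (∀ n, ∃ Q : MvPolynomial (Fin N) ℂ, Q.totalDegree = l n + 1 ∧
        ∀ x : Fin N → ℂ, MvPolynomial.eval x Q =
          (SpinChain.dMat l ξ η k₁ k₂ (SpinChain.tFun l ξ η K x) n).det) ∧
      ∀ t ∈ SpinChain.transferSpectrum l ξ η K,
        -- uniqueness of the eigenvector up to normalization
        (∃ v : SpinChain.Conf l → ℂ, v ≠ 0 ∧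
          ∀ w, SpinChain.IsEigen l ξ η K t w ↔ ∃ c : ℂ, w = c • v) ∧
        -- factorized wavefunction in the SoV basis, which characterizes the eigenvector
        ∀ S : SpinChain.Conf l → ℂ, SpinChain.IsSoVBasis l ξ η K S →
          ∃ v : SpinChain.Conf l → ℂ, SpinChain.IsEigen l ξ η K t v ∧ dotProduct S v = 1 ∧
            ∀ w : SpinChain.Conf l → ℂ,
              (SpinChain.IsEigen l ξ η K t w ∧ dotProduct S w = 1 ↔ w = v) ∧
              ((∀ h : SpinChain.Conf l, dotProduct (SpinChain.sovCovector l ξ η K S h) w =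
                  ∏ n, (SpinChain.dMinor l ξ η k₁ k₂ t n).det ^ (h n : ℕ)) ↔ w = v) := by
  obtain ⟨htr, hdet⟩ := SpinChain.charpoly_trace_det hK
  have hk : K.det ≠ 0 := by
    rw [hdet]
    exact mul_ne_zero hk₁ hk₂
  refine ⟨SpinChain.exists_mvPolynomial_isSoVBasis l hl hη htr hdet hne hk₁ hk₂, fun ξ hξ =>
    ⟨SpinChain.transferSpectrum_eq l ξ hη htr hdet hne hk hξ,
      SpinChain.exists_mvPolynomial_det_dMat hξ K k₁ k₂, fun t ht => ?_⟩⟩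
  have h := SpinChain.exists_eigen_unique l ξ hη htr hdet hne hk hξ ht
  exact ⟨h, fun S hS => SpinChain.exists_factorized_eigen hl hdet h hS⟩
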